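/- Let $\mu$ be a probability measure on the strictly positive integers, let $\mathcal P$ be a homogeneous Poisson process on $\mathbb R$ with intensity $1$, with point set $[\mathcal P]$, and, conditionally on $\mathcal P$, let the degrees $(D_x)_{x\in[\mathcal P]}$ be i.i.d. with law $\mu$. Let $G$ be a stable multi-matching of this marked process, i.e. a random simple graph with vertex set $[\mathcal P]$ such that almost surely every $x\in[\mathcal P]$ has degree $D_x$ and, for any two distinct $x,y\in[\mathcal P]$, either $x$ and $y$ are linked by an edge or at least one of them has no incident edge longer than $|x-y|$. Let $M_x$ be the length of the longest edge incident to $x\in[\mathcal P]$, and let $N$ be the number of points $x\in[\mathcal P]$ that desire the origin, that is, with $|x|<M_x$. (i) For every $\mu$: if almost surely $G$ has no infinite connected component, then $N=\infty$ almost surely. (ii) If $\mu(\{1,2\})=1$ and $G$ has an infinite connected component with positive probability, then $N<\infty$ almost surely. Consequently, if $\mu(\{1,2\})=1$, then $G$ has an infinite connected component almost surely if and only if $N<\infty$ almost surely. -/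

import Mathlib

open MeasureTheory ProbabilityTheory
open scoped ENNReal

noncomputable section

namespace StablePoisson

/-- The point set `[ν] = {x : ν {x} > 0}` of a counting measure `ν` on the line. -/
def pts (ν : Measure ℝ) : Set ℝ := {x | 0 < ν {x}}

/-- A point process on the line: a random measure on `ℝ` which is almost surely integer-valued
(and finite) on bounded Borel sets. -/
structure IsPointProcess {Ω : Type*} [MeasurableSpace Ω] (P : Measure Ω)
    (η : Ω → Measure ℝ) : Prop where
  measurable : Measurable η
  integer_valued : ∀ᵐ ω ∂P, ∀ B : Set ℝ, MeasurableSet B → Bornology.IsBounded B →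
    ∃ n : ℕ, η ω B = (n : ℝ≥0∞)

/-- A homogeneous Poisson process on `ℝ` with intensity `1`: the number of points in a Borel set
of finite Lebesgue measure is Poisson with that measure as its parameter, and the numbers of
points in disjoint Borel sets are independent. -/
structure IsPoissonProcess {Ω : Type*} [MeasurableSpace Ω] (P : Measure Ω)
    (η : Ω → Measure ℝ) : Prop extends IsPointProcess P η where
  law_count : ∀ B : Set ℝ, MeasurableSet B → volume B < ⊤ →
    HasLaw (fun ω => η ω B) ((poissonMeasure (volume B).toNNReal).map (fun n : ℕ => (n : ℝ≥0∞))) P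
  indep_count : ∀ (k : ℕ) (B : Fin k → Set ℝ), (∀ i, MeasurableSet (B i)) →
    Pairwise (fun i j => Disjoint (B i) (B j)) → iIndepFun (fun i ω => η ω (B i)) P

/-- `ξ` is a random integer-valued measure with the same point set as `η` which, conditionally on
`η`, assigns i.i.d. values with law `μ` to the points of `η`. The conditioning is expressed along
an enumeration without repetition `n ↦ X n (η ω)` of the points of `η`, measurable in `η`: the
masses that `ξ` gives to the successive points are i.i.d. with law `μ`, and this whole sequence of
masses is independent of `η`. -/
structure IsIIDMarking {Ω : Type*} [MeasurableSpace Ω] (P : Measure Ω) (μ : Measure ℕ)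
    (η ξ : Ω → Measure ℝ) : Prop where
  isPointProcess : IsPointProcess P ξ
  same_support : ∀ᵐ ω ∂P, pts (ξ ω) = pts (η ω)
  iid_marks : ∃ X : ℕ → Measure ℝ → ℝ, (∀ n, Measurable (X n)) ∧
    (∀ᵐ ω ∂P, Function.Injective (fun n => X n (η ω)) ∧
      Set.range (fun n => X n (η ω)) = pts (η ω)) ∧
    (∀ n, HasLaw (fun ω => ξ ω {X n (η ω)}) (μ.map (fun k : ℕ => (k : ℝ≥0∞))) P) ∧
    iIndepFun (fun n ω => ξ ω {X n (η ω)}) P ∧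
    IndepFun (fun ω n => ξ ω {X n (η ω)}) η P

/-- `E` is the edge set of a simple graph on the point set of `ν` in which every point `x` has
degree `ζ {x}`. -/
structure IsSimpleMatching (ν ζ : Measure ℝ) (E : Set (Sym2 ℝ)) : Prop where
  mem_pts : ∀ x y : ℝ, s(x, y) ∈ E → x ∈ pts ν ∧ y ∈ pts ν
  ne : ∀ x y : ℝ, s(x, y) ∈ E → x ≠ y
  degree : ∀ x ∈ pts ν, (({y : ℝ | s(x, y) ∈ E}.encard : ℕ∞) : ℝ≥0∞) = ζ {x}

/-- A stable multi-matching: a simple matching such that any two distinct points are linked by an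
edge, or at least one of them has no incident edge longer than their distance. -/
structure IsStableMultiMatching (ν ζ : Measure ℝ) (E : Set (Sym2 ℝ)) : Prop
    extends IsSimpleMatching ν ζ E where
  stable : ∀ x ∈ pts ν, ∀ y ∈ pts ν, x ≠ y →
    s(x, y) ∈ E ∨ (∀ z, s(x, z) ∈ E → dist x z ≤ dist x y) ∨
      (∀ z, s(y, z) ∈ E → dist y z ≤ dist x y)

/-- The graph with vertex set `[ν]` and edge set `E`. -/
def graph (ν : Measure ℝ) (E : Set (Sym2 ℝ)) : SimpleGraph (pts ν) :=
  (SimpleGraph.fromEdgeSet E).induce (pts ν)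

/-- The graph has a connected component with infinitely many vertices. -/
def HasInfiniteComponent (ν : Measure ℝ) (E : Set (Sym2 ℝ)) : Prop :=
  ∃ C : (graph ν E).ConnectedComponent, C.supp.Infinite

/-- `M_x`, the length of the longest edge incident to `x`. (The supremum is a maximum when `x` has
finite positive degree.) -/
def longestEdge (E : Set (Sym2 ℝ)) (x : ℝ) : ℝ :=
  sSup {r : ℝ | ∃ z, s(x, z) ∈ E ∧ r = dist x z}

/-- The vertex `x` desires the site `y` if `|y - x| < M_x`. -/
def Desires (E : Set (Sym2 ℝ)) (x y : ℝ) : Prop := |y - x| < longestEdge E x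

/-- `N`, the number of vertices that desire the origin. -/
def numDesire (ν : Measure ℝ) (E : Set (Sym2 ℝ)) : ℕ∞ :=
  {x | x ∈ pts ν ∧ Desires E x 0}.encard

end StablePoisson

end

/-!
The proof transfers everything to the law `Q` of the marked configuration (points and degrees) on a
space `Config` of pairs of locally finite measures.

**The matching is a function of the configuration.** Almost surely there are no multiple points, no
point is the midpoint of two others, and there are arbitrarily long gaps in both directions. In
such a configuration an edge is present if and only if both of its endpoints have strictly fewer
shorter edges than their degree (`IsPartialStable.iff_count`). Recursion on this rule gives a
measurable relation `link`, and the gaps make the recursion end after finitely many steps, so that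
*every* stable multi-matching, and even every partial one that leaves some degrees unsaturated, coincides
with `link` (`IsPartialStable.iff_link`). Hence the events of the theorem are events for `Q`. The
law `Q` is invariant under isometries, has independent restrictions to complementary sets, and makes
bounded windows empty with positive probability (`isMatchingLaw_map_cfg`). In consequence it is
ergodic (`measure_eq_zero_or_one`), and finitely many points may be erased (`ae_delete`).

**No infinite component.** Suppose that only finitely many points desire a point `y`. Erase their
components and that of `y`, but keep `y`. The other edges form a partial stable matching of the
remaining points, hence the whole matching, and leave `y` isolated although its degree is positive.
So every point is desired by infinitely many others (`infinite_desire_point`). By stationarity the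
integer sites are either all desired by infinitely many points to their right, or none is
(`ae_desireRight`), and likewise on the left; as some point is desired infinitely often, so is the
origin (`ae_infinite_desire`).

**An infinite component, degrees at most two.** Mass transport (`ae_finite_of_transport`) forbids an
infinite component with a distinguished point (`ae_no_special`). So the component is unbounded on
both sides and has no point of degree one: it is a two-ended path. If two edges cross, then their
inner endpoints are linked; therefore every other component is trapped below one edge of the
path and is finite, and two edges of the path over the same site are close to each other along the
path, which leaves room for at most five of them (`IsPathParam.encard_le`). Transporting mass along
the edges of the path, the bound five shows that finitely many points of the path desire the origin
by an edge away from it (`ae_finite_desire_right`). A point off the path lies below some edge of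
the path, and if it desires the origin, this edge also lies over the origin
(`IsStableGraph.finite_desire`); so the number of points that desire the origin is finite.
-/

noncomputable section

open MeasureTheory ProbabilityTheory Set Filter
open scoped ENNReal

namespace StablePoisson

/-! ### Locally finite configurations and the measurable construction of the matching -/

/-- A marked configuration: a pair of measures on the line, both finite on bounded intervals. The
first one counts the points, the second one gives to each point its degree. Local finiteness is
part of the type, so that evaluation of the measures on sections of measurable sets is measurable
in the configuration. -/
abbrev Config : Type :=
  {c : Measure ℝ × Measure ℝ //
    ∀ n : ℕ, c.1 (Icc (-n : ℝ) n) < ⊤ ∧ c.2 (Icc (-n : ℝ) n) < ⊤}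

namespace Config

/-- The counting measure of the points. -/
def pt (c : Config) : Measure ℝ := c.1.1

/-- The measure of the degrees. -/
def mk (c : Config) : Measure ℝ := c.1.2

lemma pt_Icc_lt_top (c : Config) (n : ℕ) : c.pt (Icc (-n : ℝ) n) < ⊤ := (c.2 n).1

lemma mk_Icc_lt_top (c : Config) (n : ℕ) : c.mk (Icc (-n : ℝ) n) < ⊤ := (c.2 n).2

lemma exists_subset_Icc {B : Set ℝ} (hB : Bornology.IsBounded B) :
    ∃ n : ℕ, B ⊆ Icc (-n : ℝ) n := by
  obtain ⟨r, hr⟩ := hB.subset_closedBall 0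
  obtain ⟨n, hn⟩ := exists_nat_ge r
  refine ⟨n, hr.trans ?_⟩
  rw [Real.closedBall_eq_Icc]
  exact Icc_subset_Icc (by linarith) (by linarith)

lemma pt_lt_top (c : Config) {B : Set ℝ} (hB : Bornology.IsBounded B) : c.pt B < ⊤ := by
  obtain ⟨n, hn⟩ := exists_subset_Icc hB
  exact (measure_mono hn).trans_lt (c.pt_Icc_lt_top n)

lemma mk_lt_top (c : Config) {B : Set ℝ} (hB : Bornology.IsBounded B) : c.mk B < ⊤ := by
  obtain ⟨n, hn⟩ := exists_subset_Icc hB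
  exact (measure_mono hn).trans_lt (c.mk_Icc_lt_top n)

lemma measurable_pt : Measurable pt := measurable_fst.comp measurable_subtype_coe

lemma measurable_mk : Measurable mk := measurable_snd.comp measurable_subtype_coe

/-- The set of points of a configuration. -/
def points (c : Config) : Set ℝ := {x | c.pt {x} ≠ 0}

lemma points_eq (c : Config) : c.points = pts c.pt := by
  ext x; simp [points, pts, pos_iff_ne_zero]

/-- The image of a configuration under an isometry of the line. -/
def map (φ : ℝ ≃ᵢ ℝ) (c : Config) : Config :=
  ⟨(c.pt.map φ, c.mk.map φ), fun n => by
    have h : Bornology.IsBounded (φ ⁻¹' Icc (-n : ℝ) n) :=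
      φ.isometry.antilipschitz.isBounded_preimage (Metric.isBounded_Icc _ _)
    have hφ : Measurable φ := φ.continuous.measurable
    simp only [Measure.map_apply hφ measurableSet_Icc]
    exact ⟨c.pt_lt_top h, c.mk_lt_top h⟩⟩

lemma pt_map (φ : ℝ ≃ᵢ ℝ) (c : Config) (A : Set ℝ) : (c.map φ).pt A = c.pt (φ ⁻¹' A) :=
  φ.toHomeomorph.toMeasurableEquiv.map_apply A

lemma mk_map (φ : ℝ ≃ᵢ ℝ) (c : Config) (A : Set ℝ) : (c.map φ).mk A = c.mk (φ ⁻¹' A) :=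
  φ.toHomeomorph.toMeasurableEquiv.map_apply A

lemma measurable_map (φ : ℝ ≃ᵢ ℝ) : Measurable (map φ) := by
  have hφ : Measurable φ := φ.continuous.measurable
  exact (((Measure.measurable_map _ hφ).comp measurable_pt).prodMk
    ((Measure.measurable_map _ hφ).comp measurable_mk)).subtype_mk

lemma measurable_measure_restrict {J : Set ℝ} (hJ : MeasurableSet J) :
    Measurable fun ν : Measure ℝ => ν.restrict J := by
  refine Measure.measurable_of_measurable_coe _ fun s hs => ?_
  simp_rw [Measure.restrict_apply hs]
  exact Measure.measurable_coe (hs.inter hJ)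

/-- The restriction of a configuration to a set. -/
def restrict (J : Set ℝ) (c : Config) : Config :=
  ⟨(c.pt.restrict J, c.mk.restrict J), fun n =>
    ⟨(Measure.restrict_le_self _).trans_lt (c.pt_Icc_lt_top n),
      (Measure.restrict_le_self _).trans_lt (c.mk_Icc_lt_top n)⟩⟩

lemma pt_restrict (J : Set ℝ) (c : Config) : (c.restrict J).pt = c.pt.restrict J := rfl

lemma mk_restrict (J : Set ℝ) (c : Config) : (c.restrict J).mk = c.mk.restrict J := rfl

lemma measurable_restrict {J : Set ℝ} (hJ : MeasurableSet J) : Measurable (restrict J) :=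
  (((measurable_measure_restrict hJ).comp measurable_pt).prodMk
    ((measurable_measure_restrict hJ).comp measurable_mk)).subtype_mk

/-- Measurability of the mass of a section, for random measures that are finite on bounded
intervals. -/
lemma measurable_apply_section {β : Type*} [MeasurableSpace β] {m : β → Measure ℝ}
    (hm : Measurable m) (hfin : ∀ b (n : ℕ), m b (Icc (-n : ℝ) n) < ⊤)
    {S : Set (β × ℝ)} (hS : MeasurableSet S) : Measurable fun b => m b {z | (b, z) ∈ S} := by
  have key : ∀ n : ℕ,
      Measurable fun b => (m b).restrict (Icc (-n : ℝ) n) {z | (b, z) ∈ S} := fun n =>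
    Kernel.measurable_kernel_prodMk_left_of_finite
      (κ := ⟨fun b => (m b).restrict (Icc (-n : ℝ) n),
        (measurable_measure_restrict measurableSet_Icc).comp hm⟩) hS
      (fun b => ⟨by simpa using hfin b n⟩)
  have hU : (⋃ n : ℕ, Icc (-n : ℝ) n) = univ := by
    refine eq_univ_of_forall fun x => ?_
    obtain ⟨n, hn⟩ := exists_nat_ge |x|
    exact mem_iUnion.2 ⟨n, abs_le.1 hn⟩
  have heq : (fun b => m b {z | (b, z) ∈ S}) =
      fun b => ⨆ n : ℕ, (m b).restrict (Icc (-n : ℝ) n) {z | (b, z) ∈ S} := by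
    funext b
    have hz : MeasurableSet {z | (b, z) ∈ S} := measurable_prodMk_left hS
    have hmono : Monotone fun n : ℕ => {z | (b, z) ∈ S} ∩ Icc (-n : ℝ) n := by
      intro i j hij
      have : (i : ℝ) ≤ j := by exact_mod_cast hij
      exact inter_subset_inter_right _ (Icc_subset_Icc (by linarith) this)
    simp_rw [Measure.restrict_apply hz]
    rw [← hmono.measure_iUnion, ← inter_iUnion, hU, inter_univ]
  rw [heq]
  exact .iSup key

lemma measurable_pt_section {β : Type*} [MeasurableSpace β] {f : β → Config} (hf : Measurable f)
    {p : β → ℝ → Prop} (hp : MeasurableSet {q : β × ℝ | p q.1 q.2}) :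
    Measurable fun b => (f b).pt {z | p b z} :=
  measurable_apply_section (measurable_pt.comp hf) (fun b => (f b).pt_Icc_lt_top) hp

lemma measurable_mk_section {β : Type*} [MeasurableSpace β] {f : β → Config} (hf : Measurable f)
    {p : β → ℝ → Prop} (hp : MeasurableSet {q : β × ℝ | p q.1 q.2}) :
    Measurable fun b => (f b).mk {z | p b z} :=
  measurable_apply_section (measurable_mk.comp hf) (fun b => (f b).mk_Icc_lt_top) hp

lemma measurable_pt_singleton {β : Type*} [MeasurableSpace β] {f : β → Config}
    (hf : Measurable f) {g : β → ℝ} (hg : Measurable g) :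
    Measurable fun b => (f b).pt {g b} :=
  measurable_pt_section hf (p := fun b z => z = g b)
    (measurableSet_eq_fun measurable_snd (hg.comp measurable_fst))

lemma measurable_mk_singleton {β : Type*} [MeasurableSpace β] {f : β → Config}
    (hf : Measurable f) {g : β → ℝ} (hg : Measurable g) :
    Measurable fun b => (f b).mk {g b} :=
  measurable_mk_section hf (p := fun b z => z = g b)
    (measurableSet_eq_fun measurable_snd (hg.comp measurable_fst))

/-- The approximations of the stable multi-matching: at depth `k + 1`, two points are linked if the
number of strictly shorter links of depth `k` is below the degree for both of them. -/
def approx : ℕ → Config → ℝ → ℝ → Prop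
  | 0, _, _, _ => False
  | k + 1, c, x, y => x ≠ y ∧ c.pt {x} ≠ 0 ∧ c.pt {y} ≠ 0 ∧
      c.pt {z | approx k c x z ∧ dist x z < dist x y} < c.mk {x} ∧
      c.pt {z | approx k c y z ∧ dist y z < dist x y} < c.mk {y}

/-- The edge relation of the stable multi-matching, as a function of the configuration: the
approximations are eventually true. -/
def link (c : Config) (x y : ℝ) : Prop := ∃ K, ∀ k ≥ K, approx k c x y

lemma approx_symm {k : ℕ} {c : Config} {x y : ℝ} (h : approx k c x y) : approx k c y x := by
  cases k with
  | zero => exact h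
  | succ k =>
    obtain ⟨h1, h2, h3, h4, h5⟩ := h
    refine ⟨h1.symm, h3, h2, ?_, ?_⟩ <;> simpa [dist_comm y x]

lemma link_symm {c : Config} {x y : ℝ} (h : link c x y) : link c y x := by
  obtain ⟨K, hK⟩ := h
  exact ⟨K, fun k hk => approx_symm (hK k hk)⟩

lemma link_mem {c : Config} {x y : ℝ} (h : link c x y) :
    x ∈ c.points ∧ y ∈ c.points ∧ x ≠ y := by
  obtain ⟨K, hK⟩ := h
  obtain ⟨h1, h2, h3, -⟩ := hK (K + 1) (by omega)
  exact ⟨h2, h3, h1⟩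

lemma measurableSet_approx (k : ℕ) :
    MeasurableSet {q : (Config × ℝ) × ℝ | approx k q.1.1 q.1.2 q.2} := by
  induction k with
  | zero => simp [approx]
  | succ k ih =>
    have hc : Measurable fun q : (Config × ℝ) × ℝ => q.1.1 := by fun_prop
    have hx : Measurable fun q : (Config × ℝ) × ℝ => q.1.2 := by fun_prop
    have hy : Measurable fun q : (Config × ℝ) × ℝ => q.2 := by fun_prop
    have h1 : Measurable fun q : (Config × ℝ) × ℝ =>
        q.1.1.pt {z | approx k q.1.1 q.1.2 z ∧ dist q.1.2 z < dist q.1.2 q.2} := by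
      refine measurable_pt_section hc (MeasurableSet.inter ?_ ?_)
      · exact (measurable_fst.fst.prodMk measurable_snd :
          Measurable fun r : ((Config × ℝ) × ℝ) × ℝ => (r.1.1, r.2)) ih
      · exact measurableSet_lt (f := fun r : ((Config × ℝ) × ℝ) × ℝ => dist r.1.1.2 r.2)
          (g := fun r => dist r.1.1.2 r.1.2) (by fun_prop) (by fun_prop)
    have h2 : Measurable fun q : (Config × ℝ) × ℝ =>
        q.1.1.pt {z | approx k q.1.1 q.2 z ∧ dist q.2 z < dist q.1.2 q.2} := by
      refine measurable_pt_section hc (MeasurableSet.inter ?_ ?_)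
      · exact ((by fun_prop :
          Measurable fun r : ((Config × ℝ) × ℝ) × ℝ => ((r.1.1.1, r.1.2), r.2))) ih
      · exact measurableSet_lt (f := fun r : ((Config × ℝ) × ℝ) × ℝ => dist r.1.2 r.2)
          (g := fun r => dist r.1.1.2 r.1.2) (by fun_prop) (by fun_prop)
    refine ((measurableSet_eq_fun hx hy).compl).inter (.inter ?_ (.inter ?_ (.inter ?_ ?_)))
    · exact (measurableSet_eq_fun (measurable_pt_singleton hc hx) measurable_const).compl
    · exact (measurableSet_eq_fun (measurable_pt_singleton hc hy) measurable_const).compl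
    · exact measurableSet_lt h1 (measurable_mk_singleton hc hx)
    · exact measurableSet_lt h2 (measurable_mk_singleton hc hy)

lemma measurableSet_link : MeasurableSet {q : (Config × ℝ) × ℝ | link q.1.1 q.1.2 q.2} := by
  have : {q : (Config × ℝ) × ℝ | link q.1.1 q.1.2 q.2} =
      ⋃ K : ℕ, ⋂ k : ℕ, ⋂ _ : K ≤ k, {q | approx k q.1.1 q.1.2 q.2} := by
    ext q; simp [link]
  rw [this]
  exact .iUnion fun K => .iInter fun k => .iInter fun _ => measurableSet_approx k

lemma measurableSet_link_comp {β : Type*} [MeasurableSpace β] {f : β → Config}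
    (hf : Measurable f) {g h : β → ℝ} (hg : Measurable g) (hh : Measurable h) :
    MeasurableSet {b | link (f b) (g b) (h b)} :=
  ((hf.prodMk hg).prodMk hh) measurableSet_link

lemma mem_points_map {φ : ℝ ≃ᵢ ℝ} {c : Config} {x : ℝ} :
    φ x ∈ (c.map φ).points ↔ x ∈ c.points := by
  have : φ ⁻¹' {φ x} = {x} := by ext; simp
  simp [points, pt_map, this]

lemma approx_map (φ : ℝ ≃ᵢ ℝ) (k : ℕ) (c : Config) (x y : ℝ) :
    approx k (c.map φ) (φ x) (φ y) ↔ approx k c x y := by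
  induction k generalizing x y with
  | zero => rfl
  | succ k ih =>
    have hs : ∀ x, φ ⁻¹' {φ x} = {x} := fun x => by ext; simp
    simp only [approx, pt_map, mk_map, hs, preimage_ofPred_eq, ih, φ.dist_eq, ne_eq,
      EmbeddingLike.apply_eq_iff_eq]

lemma link_map (φ : ℝ ≃ᵢ ℝ) (c : Config) (x y : ℝ) :
    link (c.map φ) (φ x) (φ y) ↔ link c x y := by
  simp [link, approx_map]

/-- Two sites are connected in the graph of the matching. -/
def Conn (c : Config) : ℝ → ℝ → Prop := Relation.ReflTransGen (link c)

/-- The component of `x` has infinite mass. -/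
def InfAt (c : Config) (x : ℝ) : Prop := c.pt {y | Conn c x y} = ⊤

lemma conn_map (φ : ℝ ≃ᵢ ℝ) (c : Config) (x y : ℝ) :
    Conn (c.map φ) (φ x) (φ y) ↔ Conn c x y := by
  constructor
  · intro h
    have : ∀ z, Conn (c.map φ) (φ x) z → Conn c x (φ.symm z) := by
      intro z hz
      induction hz with
      | refl => rw [φ.symm_apply_apply]; exact .refl
      | tail _ h2 ih =>
        refine ih.tail ?_
        rw [← link_map φ]; simpa using h2
    simpa using this _ h
  · intro h
    induction h with
    | refl => exact Relation.ReflTransGen.refl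
    | tail _ h2 ih => exact ih.tail ((link_map φ _ _ _).2 h2)

lemma infAt_map (φ : ℝ ≃ᵢ ℝ) (c : Config) (x : ℝ) : InfAt (c.map φ) (φ x) ↔ InfAt c x := by
  simp only [InfAt, pt_map, preimage_ofPred_eq, conn_map]

/-- Two sites are joined by a walk with a given number of steps. -/
def connIn (c : Config) : ℕ → ℝ → ℝ → Prop
  | 0, x, y => x = y
  | n + 1, x, y => ∃ z, connIn c n x z ∧ link c z y

lemma conn_iff {c : Config} {x y : ℝ} : Conn c x y ↔ ∃ n, connIn c n x y := by
  constructor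
  · intro h
    induction h with
    | refl => exact ⟨0, rfl⟩
    | tail _ h2 ih =>
      obtain ⟨n, hn⟩ := ih
      exact ⟨n + 1, _, hn, h2⟩
  · rintro ⟨n, hn⟩
    induction n generalizing y with
    | zero => cases hn; exact .refl
    | succ n ih =>
      obtain ⟨z, h1, h2⟩ := hn
      exact (ih h1).tail h2

lemma exists_iff_pt_ne_zero {c : Config} {p : ℝ → Prop} (hp : ∀ z, p z → z ∈ c.points) :
    (∃ z, p z) ↔ c.pt {z | p z} ≠ 0 := by
  constructor
  · rintro ⟨z, hz⟩ h0
    exact hp z hz (measure_mono_null (singleton_subset_iff.2 hz) h0)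
  · intro h
    by_contra! hne
    simp [hne] at h

lemma measurableSet_connIn (n : ℕ) :
    MeasurableSet {q : (Config × ℝ) × ℝ | connIn q.1.1 n q.1.2 q.2} := by
  induction n with
  | zero => exact measurableSet_eq_fun measurable_fst.snd measurable_snd
  | succ n ih =>
    have : {q : (Config × ℝ) × ℝ | connIn q.1.1 (n + 1) q.1.2 q.2} =
        {q | q.1.1.pt {z | connIn q.1.1 n q.1.2 z ∧ link q.1.1 z q.2} = 0}ᶜ := by
      ext q
      exact exists_iff_pt_ne_zero (c := q.1.1) (fun z hz => (link_mem hz.2).1)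
    rw [this]
    refine (measurableSet_eq_fun (measurable_pt_section (by fun_prop) ?_) measurable_const).compl
    refine MeasurableSet.inter ?_ ?_
    · exact (measurable_fst.fst.prodMk measurable_snd :
          Measurable fun r : ((Config × ℝ) × ℝ) × ℝ => (r.1.1, r.2)) ih
    · exact measurableSet_link_comp (by fun_prop) (by fun_prop) (by fun_prop)

lemma measurableSet_conn : MeasurableSet {q : (Config × ℝ) × ℝ | Conn q.1.1 q.1.2 q.2} := by
  simp only [conn_iff, ofPred_exists]
  exact .iUnion measurableSet_connIn

lemma measurableSet_conn_comp {β : Type*} [MeasurableSpace β] {f : β → Config}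
    (hf : Measurable f) {g h : β → ℝ} (hg : Measurable g) (hh : Measurable h) :
    MeasurableSet {b | Conn (f b) (g b) (h b)} :=
  ((hf.prodMk hg).prodMk hh) measurableSet_conn

lemma measurableSet_infAt : MeasurableSet {q : Config × ℝ | InfAt q.1 q.2} :=
  measurableSet_eq_fun
    (measurable_pt_section measurable_fst
      (measurableSet_conn_comp (by fun_prop) (by fun_prop) (by fun_prop))) measurable_const

end Config

namespace Config

/-! ### Partial stable matchings of a nondegenerate configuration -/

/-- The almost sure properties of the points that make the stable matching unique: there are no
multiple points, no point is the midpoint of two others, and there are arbitrarily long gaps in both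
directions. -/
structure Nice (c : Config) : Prop where
  simple : ∀ᵐ x ∂c.pt, c.pt {x} = 1
  noMid : ∀ x ∈ c.points, ∀ y ∈ c.points, ∀ z ∈ c.points, x ≠ y → dist x y = dist x z → y = z
  gapR : ∀ r a : ℝ, ∃ b ≥ a, ∀ x ∈ c.points, ¬ (b ≤ x ∧ x ≤ b + r)
  gapL : ∀ r a : ℝ, ∃ b ≤ a, ∀ x ∈ c.points, ¬ (b - r ≤ x ∧ x ≤ b)

/-- A partial stable matching: degrees may stay below the prescribed ones, but of two points that
are not linked, at least one is saturated and has no edge longer than their distance. -/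
structure IsPartialStable (c : Config) (R : ℝ → ℝ → Prop) : Prop where
  symm : ∀ x y, R x y → R y x
  mem : ∀ x y, R x y → x ∈ c.points ∧ x ≠ y
  deg_le : ∀ x ∈ c.points, (({y | R x y}.encard : ℕ∞) : ℝ≥0∞) ≤ c.mk {x}
  stable : ∀ x ∈ c.points, ∀ y ∈ c.points, x ≠ y → R x y ∨
    ((({z | R x z}.encard : ℕ∞) : ℝ≥0∞) = c.mk {x} ∧ ∀ z, R x z → dist x z ≤ dist x y) ∨
    ((({z | R y z}.encard : ℕ∞) : ℝ≥0∞) = c.mk {y} ∧ ∀ z, R y z → dist y z ≤ dist x y)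

section Simple

variable {c : Config} (hs : ∀ᵐ x ∂c.pt, c.pt {x} = 1)
include hs

lemma pt_singleton_of_simple {x : ℝ} (hx : x ∈ c.points) : c.pt {x} = 1 := by
  by_contra h
  exact hx (measure_mono_null (singleton_subset_iff.2 h) hs)

lemma pt_finset {F : Finset ℝ} (hF : ↑F ⊆ c.points) : c.pt F = F.card := by
  rw [← sum_measure_singleton, Finset.sum_congr rfl fun x hx => pt_singleton_of_simple hs (hF hx)]
  simp

lemma finite_of_pt_lt_top {A : Set ℝ} (hA : c.pt A < ⊤) : (A ∩ c.points).Finite := by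
  by_contra hinf
  obtain ⟨N, hN⟩ := ENNReal.exists_nat_gt hA.ne
  obtain ⟨F, hF, hcard⟩ := Set.Infinite.exists_subset_card_eq hinf N
  have h1 := pt_finset hs (hF.trans inter_subset_right)
  have h2 : c.pt F ≤ c.pt A := measure_mono (hF.trans inter_subset_left)
  rw [h1, hcard] at h2
  exact absurd h2 (not_le.2 hN)

lemma finite_points_inter {A : Set ℝ} (hA : Bornology.IsBounded A) : (A ∩ c.points).Finite :=
  finite_of_pt_lt_top hs (c.pt_lt_top hA)

lemma pt_eq_encard (A : Set ℝ) : c.pt A = (((A ∩ c.points).encard : ℕ∞) : ℝ≥0∞) := by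
  have h0 : c.pt A = c.pt (A ∩ c.points) := by
    refine measure_congr ?_
    filter_upwards [hs] with x hx
    have : x ∈ c.points := by simp [points, hx]
    exact propext ⟨fun h => ⟨h, this⟩, fun h => h.1⟩
  by_cases hf : (A ∩ c.points).Finite
  · rw [h0]
    have h1 := pt_finset hs (F := hf.toFinset) (by simp)
    rw [hf.coe_toFinset] at h1
    rw [h1, hf.encard_eq_coe_toFinset_card]
    simp
  · have : c.pt A = ⊤ := by
      by_contra h
      exact hf (finite_of_pt_lt_top hs (lt_top_iff_ne_top.2 h))
    rw [this, Set.encard_eq_top_iff.2 hf]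
    simp

lemma pt_eq_encard_of_subset {A : Set ℝ} (hA : A ⊆ c.points) :
    c.pt A = ((A.encard : ℕ∞) : ℝ≥0∞) := by
  rw [pt_eq_encard hs, inter_eq_left.2 hA]

lemma infAt_iff {x : ℝ} (hx : x ∈ c.points) : InfAt c x ↔ {y | Conn c x y}.Infinite := by
  have hsub : {y | Conn c x y} ⊆ c.points := by
    intro y hy
    rcases Relation.ReflTransGen.cases_tail hy with h | ⟨z, -, h⟩
    · rwa [h]
    · exact (link_mem h).2.1
  rw [InfAt, pt_eq_encard_of_subset hs hsub, ← Set.encard_eq_top_iff]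
  exact ENat.toENNReal_eq_top

end Simple

lemma approx_mem {k : ℕ} {c : Config} {x y : ℝ} (h : approx k c x y) :
    x ∈ c.points ∧ y ∈ c.points ∧ x ≠ y := by
  cases k with
  | zero => exact h.elim
  | succ k => exact ⟨h.2.1, h.2.2.1, h.1⟩

/-- A window of the configuration that no link of length at most `r` leaves. -/
lemma Nice.exists_block {c : Config} (hc : c.Nice) {x y : ℝ} (hx : x ∈ c.points)
    (hy : y ∈ c.points) (r : ℝ) :
    ∃ F : Set ℝ, F.Finite ∧ F ⊆ c.points ∧ x ∈ F ∧ y ∈ F ∧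
      ∀ p ∈ F, ∀ q ∈ c.points, dist p q ≤ r → q ∈ F := by
  obtain ⟨b, hb, hb'⟩ := hc.gapR r (max x y)
  obtain ⟨a, ha, ha'⟩ := hc.gapL r (min x y)
  refine ⟨Icc a b ∩ c.points, finite_points_inter hc.simple (Metric.isBounded_Icc _ _),
    inter_subset_right, ⟨⟨ha.trans (min_le_left _ _), (le_max_left _ _).trans hb⟩, hx⟩,
    ⟨⟨ha.trans (min_le_right _ _), (le_max_right _ _).trans hb⟩, hy⟩, ?_⟩
  rintro p ⟨⟨hp1, hp2⟩, hp⟩ q hq hd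
  rw [Real.dist_eq, abs_le] at hd
  refine ⟨⟨?_, ?_⟩, hq⟩
  · by_contra h
    exact ha' q hq ⟨by linarith, by linarith⟩
  · by_contra h
    exact hb' q hq ⟨by linarith, by linarith⟩

/-- Membership of an edge is decided by the strictly shorter edges at its endpoints. -/
lemma IsPartialStable.iff_count {c : Config} (hc : c.Nice) {R : ℝ → ℝ → Prop}
    (hR : c.IsPartialStable R) {x y : ℝ} (hx : x ∈ c.points) (hy : y ∈ c.points) (hxy : x ≠ y) :
    R x y ↔ c.pt {z | R x z ∧ dist x z < dist x y} < c.mk {x} ∧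
      c.pt {z | R y z ∧ dist y z < dist x y} < c.mk {y} := by
  have hsub : ∀ x, {z | R x z} ⊆ c.points := fun x z hz => (hR.mem z x (hR.symm _ _ hz)).1
  have hsub' : ∀ x y, {z | R x z ∧ dist x z < dist x y} ⊆ {z | R x z} := fun x y z hz => hz.1
  have hfin : ∀ x, x ∈ c.points → {z | R x z}.Finite := by
    intro x hx
    have h1 := (hR.deg_le x hx).trans_lt (c.mk_lt_top (Bornology.isBounded_singleton (x := x)))
    rw [← Set.encard_ne_top_iff]
    intro h
    rw [h] at h1
    simp at h1
  -- An edge is itself not counted among the strictly shorter ones, so there is room for it.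
  have hlt : ∀ x y, R x y → c.pt {z | R x z ∧ dist x z < dist x y} < c.mk {x} := by
    intro x y h
    have hx := (hR.mem x y h).1
    refine lt_of_lt_of_le ?_ (hR.deg_le x hx)
    rw [pt_eq_encard_of_subset hc.simple ((hsub' x y).trans (hsub x)), ENat.toENNReal_lt]
    refine Set.Finite.encard_lt_encard ((hfin x hx).subset (hsub' x y)) ⟨hsub' x y, fun h' => ?_⟩
    exact lt_irrefl _ (h' (show y ∈ {z | R x z} from h)).2
  -- A saturated point without longer edges has all its edges strictly shorter, for want of ties.
  have hge : ∀ x ∈ c.points, ∀ y ∈ c.points, x ≠ y → ¬ R x y →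
      (({z | R x z}.encard : ℕ∞) : ℝ≥0∞) = c.mk {x} → (∀ z, R x z → dist x z ≤ dist x y) →
      ¬ c.pt {z | R x z ∧ dist x z < dist x y} < c.mk {x} := by
    intro x hx y hy hxy hn hsat hle
    have : {z | R x z ∧ dist x z < dist x y} = {z | R x z} := by
      refine (hsub' x y).antisymm fun z hz => ⟨hz, lt_of_le_of_ne (hle z hz) fun h => ?_⟩
      have := hc.noMid x hx z (hsub x hz) y hy (hR.mem x z hz).2 h
      exact hn (this ▸ hz)
    rw [this, pt_eq_encard_of_subset hc.simple (hsub x), hsat]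
    exact lt_irrefl _
  constructor
  · intro h
    refine ⟨hlt x y h, ?_⟩
    rw [dist_comm x y]
    exact hlt y x (hR.symm _ _ h)
  · rintro ⟨h1, h2⟩
    by_contra hn
    rcases hR.stable x hx y hy hxy with h | ⟨hs, hl⟩ | ⟨hs, hl⟩
    · exact hn h
    · exact hge x hx y hy hxy hn hs hl h1
    · rw [dist_comm x y] at hl h2
      exact hge y hy x hx hxy.symm (fun h => hn (hR.symm _ _ h)) hs hl h2

/-- Uniqueness: on a nondegenerate configuration, every partial stable matching is the limit of the
approximations. -/
theorem IsPartialStable.iff_link {c : Config} (hc : c.Nice) {R : ℝ → ℝ → Prop}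
    (hR : c.IsPartialStable R) (x y : ℝ) : R x y ↔ link c x y := by
  by_cases hxy : x ∈ c.points ∧ y ∈ c.points ∧ x ≠ y
  swap
  · refine ⟨fun h =>
        (hxy ⟨(hR.mem x y h).1, (hR.mem y x (hR.symm _ _ h)).1, (hR.mem x y h).2⟩).elim,
      fun h => (hxy (link_mem h)).elim⟩
  obtain ⟨hx, hy, hne⟩ := hxy
  obtain ⟨F, hF, hFc, hxF, hyF, hblock⟩ := hc.exists_block hx hy (dist x y)
  -- The rank of a pair is the number of pairs of the window at a smaller distance.
  let m : ℝ → ℝ → ℕ := fun p q => {s ∈ F ×ˢ F | dist s.1 s.2 < dist p q}.ncard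
  have hmlt : ∀ p ∈ F, ∀ q ∈ F, ∀ p' q', dist p q < dist p' q' → m p q < m p' q' := by
    intro p hp q hq p' q' h
    refine Set.ncard_lt_ncard ⟨fun s hs => ⟨hs.1, hs.2.trans h⟩, fun h' => ?_⟩
      ((hF.prod hF).subset fun s hs => hs.1)
    exact lt_irrefl _ (h' (show (p, q) ∈ _ from ⟨⟨hp, hq⟩, h⟩)).2
  have key : ∀ k, ∀ p ∈ F, ∀ q ∈ F, p ≠ q → dist p q ≤ dist x y → m p q < k →
      (approx k c p q ↔ R p q) := by
    intro k
    induction k with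
    | zero => intro p _ q _ _ _ h; exact absurd h (Nat.not_lt_zero _)
    | succ k ih =>
      intro p hp q hq hpq hd hm
      have hset : ∀ u ∈ F, {z | approx k c u z ∧ dist u z < dist p q} =
          {z | R u z ∧ dist u z < dist p q} := by
        intro u hu
        ext z
        refine and_congr_left fun hz => ?_
        by_cases hzp : z ∈ c.points ∧ u ≠ z
        · have hzF : z ∈ F := hblock u hu z hzp.1 (hz.le.trans hd)
          exact ih u hu z hzF hzp.2 (hz.le.trans hd)
            (lt_of_lt_of_le (hmlt u hu z hzF p q hz) (Nat.lt_succ_iff.1 hm))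
        · refine ⟨fun h => (hzp ⟨(approx_mem h).2.1, (approx_mem h).2.2⟩).elim,
            fun h => (hzp ⟨(hR.mem z u (hR.symm _ _ h)).1, (hR.mem u z h).2⟩).elim⟩
      rw [hR.iff_count hc (hFc hp) (hFc hq) hpq, approx, hset p hp, hset q hq]
      exact ⟨fun h => h.2.2.2, fun h => ⟨hpq, hFc hp, hFc hq, h⟩⟩
  constructor
  · intro h
    exact ⟨m x y + 1, fun k hk => (key k x hxF y hyF hne le_rfl (by omega)).2 h⟩
  · rintro ⟨K, hK⟩
    exact (key (max K (m x y + 1)) x hxF y hyF hne le_rfl (by omega)).1 (hK _ (le_max_left _ _))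

end Config

/-! ### Geometry of stable graphs on the line -/

/-- A graph on a locally finite subset of the line such that of two points that are not linked, at
least one has no edge longer than their distance. -/
structure IsStableGraph (V : Set ℝ) (R : ℝ → ℝ → Prop) : Prop where
  symm : ∀ x y, R x y → R y x
  mem : ∀ x y, R x y → x ∈ V ∧ x ≠ y
  locFin : ∀ A : Set ℝ, Bornology.IsBounded A → (A ∩ V).Finite
  stable : ∀ x ∈ V, ∀ y ∈ V, x ≠ y → R x y ∨ (∀ z, R x z → dist x z ≤ dist x y) ∨
    (∀ z, R y z → dist y z ≤ dist x y)

/-- Along a walk from a site with property `p` to a site without it, some step leaves `p`. -/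
lemma exists_step_of_reflTransGen {α : Type*} {R : α → α → Prop} {p : α → Prop} {x y : α}
    (h : Relation.ReflTransGen R x y) (hx : p x) (hy : ¬ p y) :
    ∃ u v, Relation.ReflTransGen R x u ∧ R u v ∧ p u ∧ ¬ p v := by
  induction h with
  | refl => exact absurd hx hy
  | @tail b c h1 h2 ih =>
    by_cases hb : p b
    · exact ⟨b, c, h1, h2, hb, hy⟩
    · exact ih hb

namespace IsStableGraph

variable {V : Set ℝ} {R : ℝ → ℝ → Prop}

lemma linked_of_desire (hG : IsStableGraph V R) {x y x' y' : ℝ} (hx : R x x') (hy : R y y')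
    (hne : x ≠ y) (h1 : dist x y < dist x x') (h2 : dist x y < dist y y') : R x y := by
  rcases hG.stable x (hG.mem _ _ hx).1 y (hG.mem _ _ hy).1 hne with h | h | h
  · exact h
  · exact absurd (h x' hx) (not_le.2 h1)
  · exact absurd (h y' hy) (not_le.2 h2)

/-- If two edges cross, then their inner endpoints are linked. -/
lemma linked_of_cross (hG : IsStableGraph V R) {a₁ a₂ b₁ b₂ : ℝ} (ha : R a₁ a₂) (hb : R b₁ b₂)
    (h1 : a₁ < b₁) (h2 : b₁ < a₂) (h3 : a₂ < b₂) : R a₂ b₁ := by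
  refine hG.linked_of_desire (hG.symm _ _ ha) hb h2.ne' ?_ ?_ <;>
    simp only [Real.dist_eq] <;> rw [abs_of_pos (by linarith)]
  · rw [abs_of_pos (by linarith)]; linarith
  · rw [abs_of_neg (by linarith)]; linarith

lemma symm_conn (hG : IsStableGraph V R) {x y : ℝ} (h : Relation.ReflTransGen R x y) :
    Relation.ReflTransGen R y x := by
  induction h with
  | refl => exact .refl
  | tail _ h2 ih => exact ih.head (hG.symm _ _ h2)

lemma mem_of_conn (hG : IsStableGraph V R) {x y : ℝ} (hx : x ∈ V)
    (h : Relation.ReflTransGen R x y) : y ∈ V := by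
  rcases Relation.ReflTransGen.cases_tail h with h | ⟨z, -, h⟩
  · rwa [h]
  · exact (hG.mem _ _ (hG.symm _ _ h)).1

/-- A component that is unbounded in both directions has an edge over every site outside it. -/
lemma exists_straddle (hG : IsStableGraph V R) {a b : ℝ}
    (hbelow : ¬ BddBelow {y | Relation.ReflTransGen R a y})
    (habove : ¬ BddAbove {y | Relation.ReflTransGen R a y})
    (hb : ¬ Relation.ReflTransGen R a b) :
    ∃ u v, Relation.ReflTransGen R a u ∧ R u v ∧ u < b ∧ b < v := by
  obtain ⟨x, hx, hxb⟩ := not_bddBelow_iff.1 hbelow b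
  obtain ⟨y, hy, hyb⟩ := not_bddAbove_iff.1 habove b
  obtain ⟨u, v, h1, h2, h3, h4⟩ := exists_step_of_reflTransGen (p := fun z => z < b)
    ((hG.symm_conn hx).trans hy) hxb (not_lt.2 hyb.le)
  refine ⟨u, v, Relation.ReflTransGen.trans hx h1, h2, h3, lt_of_le_of_ne (not_lt.1 h4) ?_⟩
  rintro rfl
  exact hb ((Relation.ReflTransGen.trans hx h1).tail h2)

/-- If one component is unbounded in both directions, then all the other ones are finite: they
are trapped below a single edge of the unbounded component. -/
lemma finite_of_not_conn (hG : IsStableGraph V R) {a b : ℝ} (hbV : b ∈ V)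
    (hbelow : ¬ BddBelow {y | Relation.ReflTransGen R a y})
    (habove : ¬ BddAbove {y | Relation.ReflTransGen R a y})
    (hb : ¬ Relation.ReflTransGen R a b) : {y | Relation.ReflTransGen R b y}.Finite := by
  obtain ⟨u, v, hu, huv, h1, h2⟩ := hG.exists_straddle hbelow habove hb
  have hv : Relation.ReflTransGen R a v := hu.tail huv
  have key : ∀ y, Relation.ReflTransGen R b y → y ∈ Ioo u v ∧ ¬ Relation.ReflTransGen R a y := by
    intro y hy
    induction hy with
    | refl => exact ⟨⟨h1, h2⟩, hb⟩
    | @tail y z _ hyz ih =>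
      obtain ⟨⟨hy1, hy2⟩, hy3⟩ := ih
      have hz3 : ¬ Relation.ReflTransGen R a z := fun h => hy3 (h.tail (hG.symm _ _ hyz))
      refine ⟨⟨?_, ?_⟩, hz3⟩
      · by_contra h
        have hzu : z ≠ u := fun h => hz3 (h ▸ hu)
        have hlt : z < u := lt_of_le_of_ne (not_lt.1 h) hzu
        exact hy3 (hu.tail (hG.symm _ _ (hG.linked_of_cross (hG.symm _ _ hyz) huv hlt hy1 hy2)))
      · by_contra h
        have hzv : z ≠ v := fun h => hz3 (h ▸ hv)
        have hlt : v < z := lt_of_le_of_ne (not_lt.1 h) hzv.symm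
        exact hy3 (hv.tail (hG.linked_of_cross huv hyz hy1 hy2 hlt))
  exact (hG.locFin (Ioo u v) (Metric.isBounded_Ioo _ _)).subset
    fun y hy => ⟨(key y hy).1, hG.mem_of_conn hbV hy⟩

end IsStableGraph

/-! ### Two-ended paths -/

/-- A bi-infinite enumeration without repetition of a component all of whose vertices have degree
two, along the path that it forms. -/
structure IsPathParam (R : ℝ → ℝ → Prop) (a : ℤ → ℝ) : Prop where
  inj : Function.Injective a
  adj : ∀ i, R (a i) (a (i + 1))
  nbr : ∀ i y, R (a i) y → y = a (i - 1) ∨ y = a (i + 1)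

lemma IsPathParam.rev {V : Set ℝ} {R : ℝ → ℝ → Prop} (hG : IsStableGraph V R) {a : ℤ → ℝ}
    (h : IsPathParam R a) : IsPathParam R (fun i => a (-i)) where
  inj i j hij := by simpa using h.inj hij
  adj i := by
    have := hG.symm _ _ (h.adj (-i - 1))
    simpa [show -(i + 1) = -i - 1 by ring] using this
  nbr i y hy := by
    rcases h.nbr (-i) y hy with h | h
    · right; rw [h]; congr 1; ring
    · left; rw [h]; congr 1; ring

/-- An infinite component all of whose vertices have degree two is a bi-infinite path. -/
lemma exists_isPathParam {V : Set ℝ} {R : ℝ → ℝ → Prop} (hG : IsStableGraph V R) {x₀ : ℝ}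
    (hinf : {y | Relation.ReflTransGen R x₀ y}.Infinite)
    (hdeg : ∀ x, Relation.ReflTransGen R x₀ x → {y | R x y}.encard = 2) :
    ∃ a : ℤ → ℝ, IsPathParam R a ∧ (∀ i, Relation.ReflTransGen R x₀ (a i)) ∧
      ∀ x, Relation.ReflTransGen R x₀ x → ∃ i, a i = x := by
  -- The permutation of the darts of the component that moves each dart one step forward.
  let S := {p : ℝ × ℝ // R p.1 p.2 ∧ Relation.ReflTransGen R x₀ p.1}
  have hother : ∀ y x, R y x → Relation.ReflTransGen R x₀ y →
      ∃ z, z ≠ x ∧ R y z ∧ ∀ w, R y w → w = x ∨ w = z := by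
    intro y x hyx hy
    obtain ⟨p, q, hpq, hset⟩ := Set.encard_eq_two.1 (hdeg y hy)
    have hp : R y p := by have : p ∈ {w | R y w} := by rw [hset]; simp
                          exact this
    have hq : R y q := by have : q ∈ {w | R y w} := by rw [hset]; simp
                          exact this
    have hall : ∀ w, R y w → w = p ∨ w = q := by
      intro w hw
      have : w ∈ {w | R y w} := hw
      rw [hset] at this
      simpa using this
    rcases hall x hyx with rfl | rfl
    · exact ⟨q, hpq.symm, hq, hall⟩
    · exact ⟨p, hpq, hp, fun w hw => (hall w hw).symm⟩
  choose! o ho1 ho2 ho3 using hother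
  have hoo : ∀ y x, R y x → Relation.ReflTransGen R x₀ y → o y (o y x) = x := by
    intro y x h1 h2
    have h3 := ho1 y (o y x) (ho2 y x h1 h2) h2
    rcases ho3 y x h1 h2 _ (ho2 y (o y x) (ho2 y x h1 h2) h2) with h | h
    · exact h
    · exact absurd h h3
  let σ : Equiv.Perm S :=
    { toFun := fun s => ⟨(s.1.2, o s.1.2 s.1.1),
        ho2 _ _ (hG.symm _ _ s.2.1) (s.2.2.tail s.2.1), s.2.2.tail s.2.1⟩
      invFun := fun s => ⟨(o s.1.1 s.1.2, s.1.1), hG.symm _ _ (ho2 _ _ s.2.1 s.2.2),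
        s.2.2.tail (ho2 _ _ s.2.1 s.2.2)⟩
      left_inv := fun s => by
        apply Subtype.ext
        exact Prod.ext (hoo _ _ (hG.symm _ _ s.2.1) (s.2.2.tail s.2.1)) rfl
      right_inv := fun s => by
        apply Subtype.ext
        exact Prod.ext rfl (hoo _ _ s.2.1 s.2.2) }
  obtain ⟨x₁, hx₁⟩ : ∃ y, R x₀ y := by
    have h := hdeg x₀ .refl
    have : {y | R x₀ y}.Nonempty := by
      rw [← Set.encard_pos, h]; norm_num
    exact this
  let s₀ : S := ⟨(x₀, x₁), hx₁, .refl⟩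
  let a : ℤ → ℝ := fun i => ((σ ^ i) s₀).1.1
  have hstep : ∀ i : ℤ, (σ ^ (i + 1)) s₀ = σ ((σ ^ i) s₀) := by
    intro i
    rw [add_comm, zpow_add, zpow_one, Equiv.Perm.mul_apply]
  have hsnd : ∀ i : ℤ, ((σ ^ i) s₀).1.2 = a (i + 1) := by
    intro i
    simp only [a, hstep]; rfl
  have hconn : ∀ i, Relation.ReflTransGen R x₀ (a i) := fun i => ((σ ^ i) s₀).2.2
  have hadj : ∀ i, R (a i) (a (i + 1)) := fun i => by
    rw [← hsnd]; exact ((σ ^ i) s₀).2.1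
  have hnext : ∀ i : ℤ, a (i + 1 + 1) = o (a (i + 1)) (a i) := by
    intro i
    rw [← hsnd (i + 1), hstep, ← hsnd i]; rfl
  have hback : ∀ i : ℤ, a (i + 1 + 1) ≠ a i := by
    intro i
    rw [hnext]
    exact ho1 _ _ (hG.symm _ _ (hadj i)) (hconn _)
  have hnbr : ∀ i y, R (a i) y → y = a (i - 1) ∨ y = a (i + 1) := by
    intro i y hy
    obtain ⟨j, rfl⟩ : ∃ j, i = j + 1 := ⟨i - 1, by ring⟩
    rw [hnext j, show j + 1 - 1 = j by ring]
    exact ho3 _ _ (hG.symm _ _ (hadj j)) (hconn _) y hy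
  have ha0 : a 0 = x₀ := by simp [a, s₀]
  have hsurj : ∀ x, Relation.ReflTransGen R x₀ x → ∃ i, a i = x := by
    intro x hx
    induction hx with
    | refl => exact ⟨0, ha0⟩
    | tail _ h2 ih =>
      obtain ⟨i, rfl⟩ := ih
      rcases hnbr i _ h2 with h | h
      · exact ⟨_, h.symm⟩
      · exact ⟨_, h.symm⟩
  refine ⟨a, ⟨?_, hadj, hnbr⟩, hconn, hsurj⟩
  -- A shortest repetition would close the path up into a finite cycle.
  by_contra hinj
  have hex : ∃ n : ℕ, 0 < n ∧ ∃ i : ℤ, a i = a (i + n) := by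
    simp only [Function.Injective, not_forall] at hinj
    obtain ⟨i, j, hij, hne⟩ := hinj
    rcases lt_or_gt_of_ne hne with h | h
    · exact ⟨(j - i).toNat, by omega, i, by rw [hij]; congr 1; omega⟩
    · exact ⟨(i - j).toNat, by omega, j, by rw [← hij]; congr 1; omega⟩
  classical
  obtain ⟨hn0, i, hi⟩ := Nat.find_spec hex
  have hmin := fun m (hm : m < Nat.find hex) => Nat.find_min hex hm
  set n := Nat.find hex
  have hn1 : n ≠ 1 := by
    intro h
    rw [h] at hi
    exact (hG.mem _ _ (hadj i)).2 (by exact_mod_cast hi)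
  have hn2 : n ≠ 2 := by
    intro h
    rw [h] at hi
    refine hback i ?_
    rw [hi]; congr 1; push_cast; ring
  have hR : R (a i) (a (i + n - 1)) := by
    rw [hi]
    have := hG.symm _ _ (hadj (i + n - 1))
    rwa [show i + (n : ℤ) - 1 + 1 = i + n by ring] at this
  have hne : a (i + n - 1) ≠ a (i + 1) := by
    intro h
    refine hmin (n - 2) (by omega) ⟨by omega, i + 1, ?_⟩
    rw [← h]; congr 1; omega
  have hlast : a (i - 1) = a (i + n - 1) := by
    rcases hnbr i _ hR with h | h
    · exact h.symm
    · exact absurd h hne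
  have hclosed : ∀ x, Relation.ReflTransGen R (a i) x → ∃ k : ℤ, i ≤ k ∧ k < i + n ∧ a k = x := by
    intro x hx
    induction hx with
    | refl => exact ⟨i, le_rfl, by omega, rfl⟩
    | tail _ h2 ih =>
      obtain ⟨k, hk1, hk2, rfl⟩ := ih
      rcases hnbr k _ h2 with h | h
      · rcases eq_or_lt_of_le hk1 with rfl | hk
        · exact ⟨i + n - 1, by omega, by omega, by rw [h, hlast]⟩
        · exact ⟨k - 1, by omega, by omega, h.symm⟩
      · by_cases hk : k + 1 = i + n
        · exact ⟨i, le_rfl, by omega, by rw [h, hk, hi]⟩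
        · exact ⟨k + 1, by omega, by omega, h.symm⟩
  refine hinf (((Set.finite_Ico i (i + n)).image a).subset fun y hy => ?_)
  obtain ⟨k, h1, h2, h3⟩ := hclosed y ((hG.symm_conn (hconn i)).trans hy)
  exact ⟨k, ⟨h1, h2⟩, h3⟩

section Straddle

variable {V : Set ℝ} {R : ℝ → ℝ → Prop} {a : ℤ → ℝ}

/-- Apart from the next three vertices, the path does not enter the interval below one of its
edges: it cannot cross the edge again, and it would be trapped below it. -/
lemma IsPathParam.notMem_Ioo (hG : IsStableGraph V R) (h : IsPathParam R a) {i n : ℤ}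
    (hn : i + 3 ≤ n) : a n ∉ Ioo (min (a i) (a (i + 1))) (max (a i) (a (i + 1))) := by
  intro hmem
  obtain ⟨lo, hi, hlohi, hRlh, hlo, hhi, heq⟩ : ∃ lo hi : ℝ, lo < hi ∧ R lo hi ∧
      (lo = a i ∨ lo = a (i + 1)) ∧ (hi = a i ∨ hi = a (i + 1)) ∧
      Ioo (min (a i) (a (i + 1))) (max (a i) (a (i + 1))) = Ioo lo hi := by
    rcases lt_or_gt_of_ne (hG.mem _ _ (h.adj i)).2 with hlt | hlt
    · exact ⟨_, _, hlt, h.adj i, .inl rfl, .inr rfl, by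
        rw [min_eq_left hlt.le, max_eq_right hlt.le]⟩
    · exact ⟨_, _, hlt, hG.symm _ _ (h.adj i), .inr rfl, .inl rfl, by
        rw [min_eq_right hlt.le, max_eq_left hlt.le]⟩
  rw [heq] at hmem
  have hnot : ∀ m, i + 3 ≤ m → ∀ e, (e = a i ∨ e = a (i + 1)) → ¬ R (a m) e := by
    intro m hm e he hR
    rcases h.nbr m e hR with h1 | h1 <;> rcases he with h2 | h2 <;>
      · have := h.inj (h1.symm.trans h2); omega
  have hne : ∀ m, i + 3 ≤ m → ∀ e, (e = a i ∨ e = a (i + 1)) → a m ≠ e := by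
    rintro m hm e (rfl | rfl) h'
    · have := h.inj h'; omega
    · have := h.inj h'; omega
  have key : ∀ k : ℕ, a (n + k) ∈ Ioo lo hi := by
    intro k
    induction k with
    | zero => simpa using hmem
    | succ k ih =>
      have hadj := h.adj (n + k)
      rw [show n + ((k + 1 : ℕ) : ℤ) = n + k + 1 by push_cast; ring]
      constructor
      · by_contra hcon
        have hlt := lt_of_le_of_ne (not_lt.1 hcon) (hne (n + k + 1) (by omega) lo hlo)
        exact hnot (n + k) (by omega) lo hlo
          (hG.linked_of_cross (hG.symm _ _ hadj) hRlh hlt ih.1 ih.2)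
      · by_contra hcon
        have hlt := lt_of_le_of_ne (not_lt.1 hcon) (hne (n + k + 1) (by omega) hi hhi).symm
        exact hnot (n + k) (by omega) hi hhi
          (hG.symm _ _ (hG.linked_of_cross hRlh hadj ih.1 ih.2 hlt))
  have hinj : Function.Injective fun k : ℕ => a (n + k) := by
    intro k l hkl
    have := h.inj hkl
    omega
  refine Set.infinite_range_of_injective hinj ((hG.locFin (Ioo lo hi)
    (Metric.isBounded_Ioo _ _)).subset ?_)
  rintro _ ⟨k, rfl⟩
  exact ⟨key k, (hG.mem _ _ (h.adj _)).1⟩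

/-- The analogue of `notMem_Ioo` for earlier vertices, by reversal of the path. -/
lemma IsPathParam.notMem_Ioo' (hG : IsStableGraph V R) (h : IsPathParam R a) {j n : ℤ}
    (hn : n + 2 ≤ j) : a n ∉ Ioo (min (a j) (a (j + 1))) (max (a j) (a (j + 1))) := by
  have := (h.rev hG).notMem_Ioo hG (i := -j - 1) (n := -n) (by omega)
  simp only [neg_neg, show -(-j - 1) = j + 1 by ring, show -(-j - 1 + 1) = j by ring] at this
  rwa [min_comm, max_comm]

/-- Edges of a two-ended path over the same site are close to each other along the path: otherwise
each of them would be nested in the other one. -/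
lemma IsPathParam.le_of_straddle (hG : IsStableGraph V R) (h : IsPathParam R a) {i j : ℤ} {t : ℝ}
    (hi : t ∈ Ioo (min (a i) (a (i + 1))) (max (a i) (a (i + 1))))
    (hj : t ∈ Ioo (min (a j) (a (j + 1))) (max (a j) (a (j + 1)))) : j ≤ i + 2 := by
  by_contra hcon
  have h1 := h.notMem_Ioo hG (i := i) (n := j) (by omega)
  have h2 := h.notMem_Ioo hG (i := i) (n := j + 1) (by omega)
  have h3 := h.notMem_Ioo' hG (j := j) (n := i) (by omega)
  have h4 := h.notMem_Ioo' hG (j := j) (n := i + 1) (by omega)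
  have hne : ∀ u v : ℤ, (u = i ∨ u = i + 1) → (v = j ∨ v = j + 1) → a u ≠ a v := by
    intro u v hu hv huv
    have := h.inj huv
    omega
  have n1 := hne i j (.inl rfl) (.inl rfl)
  have n2 := hne i (j + 1) (.inl rfl) (.inr rfl)
  have n3 := hne (i + 1) j (.inr rfl) (.inl rfl)
  have n4 := hne (i + 1) (j + 1) (.inr rfl) (.inr rfl)
  simp only [mem_Ioo, min_lt_iff, lt_max_iff, not_and_or, not_or, not_lt] at *
  rcases lt_or_gt_of_ne n1 with n1 | n1 <;> rcases lt_or_gt_of_ne n2 with n2 | n2 <;>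
  rcases lt_or_gt_of_ne n3 with n3 | n3 <;> rcases lt_or_gt_of_ne n4 with n4 | n4 <;> grind

/-- At most five edges of a two-ended path with pairwise distinct left endpoints straddle a given
site: by `le_of_straddle`, their indices along the path differ by at most two. -/
lemma IsPathParam.encard_le {ι : Type*} (hG : IsStableGraph V R) (h : IsPathParam R a) {t : ℝ}
    {K : Set ι} {l r : ι → ℝ} (hl : ∀ k ∈ K, l k < t) (hr : ∀ k ∈ K, t < r k)
    (hR : ∀ k ∈ K, R (l k) (r k)) (hmem : ∀ k ∈ K, ∃ i, a i = l k) (hinj : InjOn l K) :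
    K.encard ≤ 5 := by
  have hidx : ∀ k ∈ K, ∃ i : ℤ, t ∈ Ioo (min (a i) (a (i + 1))) (max (a i) (a (i + 1))) ∧
      l k = min (a i) (a (i + 1)) := by
    intro k hk
    obtain ⟨i, hi⟩ := hmem k hk
    have hlr := (hl k hk).trans (hr k hk)
    have hRk := hR k hk
    rw [← hi] at hRk
    rcases h.nbr i _ hRk with h1 | h1
    · refine ⟨i - 1, ?_⟩
      rw [show i - 1 + 1 = i by ring, hi, ← h1, max_eq_left hlr.le, min_eq_right hlr.le]
      exact ⟨⟨hl k hk, hr k hk⟩, rfl⟩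
    · refine ⟨i, ?_⟩
      rw [hi, ← h1, max_eq_right hlr.le, min_eq_left hlr.le]
      exact ⟨⟨hl k hk, hr k hk⟩, rfl⟩
  choose! f hf1 hf2 using hidx
  rcases K.eq_empty_or_nonempty with rfl | ⟨k₀, hk₀⟩
  · simp
  have hfinj : InjOn f K := by
    intro k hk k' hk' hkk
    refine hinj hk hk' ?_
    rw [hf2 k hk, hf2 k' hk', hkk]
  rw [← hfinj.encard_image]
  have hsub : f '' K ⊆ (Finset.Icc (f k₀ - 2) (f k₀ + 2) : Finset ℤ) := by
    rintro _ ⟨k, hk, rfl⟩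
    have h1 := h.le_of_straddle hG (hf1 k₀ hk₀) (hf1 k hk)
    have h2 := h.le_of_straddle hG (hf1 k hk) (hf1 k₀ hk₀)
    simp only [Finset.coe_Icc, mem_Icc]
    omega
  refine (Set.encard_le_encard hsub).trans ?_
  rw [Set.encard_coe_eq_coe_finsetCard, Int.card_Icc]
  have : (f k₀ + 2 + 1 - (f k₀ - 2)).toNat = 5 := by omega
  rw [this]
  rfl

/-- Let a component be unbounded in both directions, with finitely many edges over the origin and
finitely many vertices that desire the origin by an edge away from it. Then finitely many points
desire the origin: a point outside the component lies below some edge of the component, and an edge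
that does not pass over the origin as well would have an endpoint linked to this point. -/
lemma IsStableGraph.finite_desire (hG : IsStableGraph V R) {x₀ : ℝ}
    (hbelow : ¬ BddBelow {y | Relation.ReflTransGen R x₀ y})
    (habove : ¬ BddAbove {y | Relation.ReflTransGen R x₀ y})
    (h0 : {p : ℝ × ℝ | Relation.ReflTransGen R x₀ p.1 ∧ R p.1 p.2 ∧ p.1 < 0 ∧ 0 < p.2}.Finite)
    (hright : {x | Relation.ReflTransGen R x₀ x ∧ 0 < x ∧ ∃ z, R x z ∧ x < z - x}.Finite)
    (hleft : {x | Relation.ReflTransGen R x₀ x ∧ x < 0 ∧ ∃ z, R x z ∧ -x < x - z}.Finite) :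
    {x | ∃ z, R x z ∧ |x| < dist x z}.Finite := by
  have hS : (⋃ p ∈ {p : ℝ × ℝ | Relation.ReflTransGen R x₀ p.1 ∧ R p.1 p.2 ∧ p.1 < 0 ∧ 0 < p.2},
      (Icc p.1 p.2 ∩ V)).Finite :=
    h0.biUnion fun p _ => hG.locFin _ (Metric.isBounded_Icc _ _)
  refine (((hS.union hright).union hleft).union (Set.finite_singleton 0)).subset ?_
  rintro x ⟨z, hxz, hd⟩
  have hxV := (hG.mem _ _ hxz).1
  rcases eq_or_ne x 0 with rfl | hx0
  · exact Or.inr rfl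
  refine Or.inl ?_
  rw [Real.dist_eq, lt_abs] at hd
  by_cases hA : Relation.ReflTransGen R x₀ x
  · rcases lt_or_gt_of_ne hx0 with hneg | hpos
    · rw [abs_of_neg hneg] at hd
      rcases hd with hd | hd
      · exact Or.inr ⟨hA, hneg, z, hxz, hd⟩
      · refine Or.inl (Or.inl (mem_biUnion (x := (x, z)) ⟨hA, hxz, hneg, by linarith⟩ ?_))
        exact ⟨⟨le_rfl, by simp only; linarith⟩, hxV⟩
    · rw [abs_of_pos hpos] at hd
      rcases hd with hd | hd
      · refine Or.inl (Or.inl (mem_biUnion (x := (z, x))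
          ⟨hA.tail hxz, hG.symm _ _ hxz, by linarith, hpos⟩ ?_))
        exact ⟨⟨by simp only; linarith, le_rfl⟩, hxV⟩
      · exact Or.inl (Or.inr ⟨hA, hpos, z, hxz, by linarith⟩)
  · obtain ⟨u, v, hu, huv, h1, h2⟩ := hG.exists_straddle hbelow habove hA
    have hd' : |x| < dist x z := by rw [Real.dist_eq, lt_abs]; exact hd
    refine Or.inl (Or.inl (mem_biUnion (x := (u, v)) ⟨hu, huv, ?_, ?_⟩ ⟨⟨h1.le, h2.le⟩, hxV⟩))
    · -- Otherwise `x` and the left endpoint `u ∈ [0, x)` would desire each other.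
      simp only
      by_contra hcon
      refine hA (hu.tail (hG.symm _ _ (hG.linked_of_desire hxz huv h1.ne' ?_ ?_)))
      · refine lt_of_le_of_lt ?_ hd'
        rw [Real.dist_eq, abs_of_pos (by linarith), abs_of_pos (by linarith)]
        linarith
      · rw [Real.dist_eq, Real.dist_eq, abs_of_pos (by linarith), abs_of_neg (by linarith)]
        linarith
    · simp only
      by_contra hcon
      refine hA ((hu.tail huv).tail (hG.symm _ _ (hG.linked_of_desire hxz (hG.symm _ _ huv)
        h2.ne ?_ ?_)))
      · refine lt_of_le_of_lt ?_ hd'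
        rw [Real.dist_eq, abs_of_neg (by linarith), abs_of_neg (by linarith)]
        linarith
      · rw [Real.dist_eq, Real.dist_eq, abs_of_neg (by linarith), abs_of_pos (by linarith)]
        linarith

end Straddle

/-- A component all of whose vertices have at most two neighbours and which contains two vertices
of degree one is finite. -/
lemma finite_of_two_leaves {V : Set ℝ} {R : ℝ → ℝ → Prop} (hG : IsStableGraph V R) {x y : ℝ}
    (hdeg : ∀ z, Relation.ReflTransGen R x z → {w | R z w}.encard ≤ 2)
    (hx : {w | R x w}.encard ≤ 1) (hy : {w | R y w}.encard ≤ 1) (hxy : x ≠ y)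
    (hconn : Relation.ReflTransGen R x y) : {z | Relation.ReflTransGen R x z}.Finite := by
  have hex : ∃ n : ℕ, ∃ p : ℕ → ℝ, p 0 = x ∧ p n = y ∧ ∀ i < n, R (p i) (p (i + 1)) := by
    clear hdeg hx hy hxy
    induction hconn with
    | refl => exact ⟨0, fun _ => x, rfl, rfl, fun i hi => absurd hi (Nat.not_lt_zero _)⟩
    | @tail b c _ h2 ih =>
      obtain ⟨n, p, h0, hn, hp⟩ := ih
      refine ⟨n + 1, fun i => if i ≤ n then p i else c, by simp [h0], by simp, fun i hi => ?_⟩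
      rcases Nat.lt_succ_iff_lt_or_eq.1 hi with h | rfl
      · simpa [h.le, Nat.succ_le_of_lt h] using hp i h
      · simpa [hn] using h2
  classical
  -- A shortest walk between the two leaves does not backtrack, so that it exhausts the component.
  obtain ⟨p, h0, hn, hp⟩ := Nat.find_spec hex
  have hmin := fun m (hm : m < Nat.find hex) => Nat.find_min hex hm
  set n := Nat.find hex
  have hn0 : n ≠ 0 := by
    intro h
    rw [h, h0] at hn
    exact hxy hn
  have hback : ∀ i, i + 1 < n → p i ≠ p (i + 2) := by
    intro i hi heq
    refine hmin (n - 2) (by omega) ⟨fun j => if j ≤ i then p j else p (j + 2), by simp [h0], ?_, ?_⟩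
    · by_cases h : n - 2 ≤ i
      · have : n - 2 = i := by omega
        simp only [this, le_refl, if_true]
        rw [heq, show i + 2 = n by omega, hn]
      · simp only [h, if_false]
        rw [show n - 2 + 2 = n by omega, hn]
    · intro j hj
      by_cases h : j + 1 ≤ i
      · simpa [h, (Nat.le_succ j).trans h] using hp j (by omega)
      · by_cases h' : j ≤ i
        · have : j = i := by omega
          subst this
          simpa [heq] using hp (j + 2) (by omega)
        · simpa [h, h'] using hp (j + 2) (by omega)
  have hone : ∀ u v w : ℝ, {w | R u w}.encard ≤ 1 → R u v → R u w → w = v := by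
    intro u v w h hv hw
    exact Set.encard_le_one_iff.1 h w v hw hv
  have hpx : ∀ i ≤ n, Relation.ReflTransGen R x (p i) := by
    intro i
    induction i with
    | zero => intro _; rw [h0]
    | succ i ih => intro hi; exact (ih (by omega)).tail (hp i (by omega))
  have hclosed : ∀ z, Relation.ReflTransGen R x z → ∃ i ≤ n, p i = z := by
    intro z hz
    induction hz with
    | refl => exact ⟨0, Nat.zero_le _, h0⟩
    | @tail b c _ h2 ih =>
      obtain ⟨i, hi, rfl⟩ := ih
      rcases Nat.eq_zero_or_pos i with rfl | hi0
      · rw [h0] at h2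
        exact ⟨1, by omega, (hone x (p 1) c hx (h0 ▸ hp 0 (by omega)) h2).symm⟩
      · obtain ⟨j, rfl⟩ : ∃ j, i = j + 1 := ⟨i - 1, by omega⟩
        have hprev := hG.symm _ _ (hp j (by omega))
        by_cases hin : j + 1 = n
        · rw [hin, hn] at h2 hprev
          exact ⟨j, by omega, (hone y (p j) c hy hprev h2).symm⟩
        · have hnext := hp (j + 1) (by omega)
          by_contra hcon
          have h3 : ({c, p j, p (j + 2)} : Set ℝ).encard = 3 := by
            refine Set.encard_eq_three.2 ⟨c, p j, p (j + 2), ?_, ?_, hback j (by omega), rfl⟩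
            · rintro rfl; exact hcon ⟨j, by omega, rfl⟩
            · rintro rfl; exact hcon ⟨j + 2, by omega, rfl⟩
          have h4 : ({c, p j, p (j + 2)} : Set ℝ) ⊆ {w | R (p (j + 1)) w} := by
            rintro w (rfl | rfl | rfl)
            exacts [h2, hprev, hnext]
          have h5 := (Set.encard_le_encard h4).trans (hdeg _ (hpx _ hi))
          rw [h3] at h5
          exact absurd h5 (by norm_num)
  exact ((Set.finite_Iic n).image p).subset fun z hz => by
    obtain ⟨i, hi, h⟩ := hclosed z hz
    exact ⟨i, hi, h⟩

/-! ### Sums of independent marks over finite sets of indices -/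

/-- The law of the sum of `n` independent marks. -/
def sumLaw (μ : Measure ℕ) : ℕ → Measure ℕ
  | 0 => Measure.dirac 0
  | n + 1 => (sumLaw μ n).conv μ

section Marks

variable (μ : Measure ℕ) [IsProbabilityMeasure μ]

lemma iIndepFun_coord :
    iIndepFun (fun (j : ℕ) (k : ℕ → ℕ) => k j) (Measure.infinitePi fun _ : ℕ => μ) :=
  iIndepFun_infinitePi (P := fun _ : ℕ => μ) (X := fun _ x => x) fun _ => measurable_id

lemma map_sum_eq_sumLaw (I : Finset ℕ) :
    (Measure.infinitePi fun _ : ℕ => μ).map (fun k => ∑ j ∈ I, k j) = sumLaw μ I.card := by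
  induction I using Finset.induction_on with
  | empty =>
    simp only [Finset.sum_empty, Finset.card_empty, sumLaw]
    rw [Measure.map_const]; simp
  | insert i s hi ih =>
    have h1 := (iIndepFun_coord μ).indepFun_finsetSum_of_notMem (fun j => measurable_pi_apply j) hi
    have h4 : (fun k : ℕ → ℕ => ∑ j ∈ s, k j) = ∑ j ∈ s, fun k : ℕ → ℕ => k j := by
      funext k; simp
    have hm : Measurable (∑ j ∈ s, fun k : ℕ → ℕ => k j) := by
      rw [← h4]
      exact Finset.measurable_fun_sum s fun j _ => measurable_pi_apply j
    have h2 := h1.map_add_eq_map_conv_map hm (measurable_pi_apply i)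
    rw [Finset.card_insert_of_notMem hi, sumLaw, ← ih]
    have h3 : (fun k : ℕ → ℕ => ∑ j ∈ insert i s, k j) =
        (∑ j ∈ s, fun k : ℕ → ℕ => k j) + fun k => k i := by
      funext k
      simp [Finset.sum_insert hi, add_comm]
    rw [h3, h2, h4, Measure.infinitePi_map_eval]

/-- The sums of independent marks over disjoint blocks of indices are independent. -/
lemma measure_block_sums {ι : Type*} (s : Finset ι) (I : ι → Finset ℕ)
    (hI : (s : Set ι).PairwiseDisjoint I) (m : ι → ℕ) :
    (Measure.infinitePi fun _ : ℕ => μ) {k | ∀ i ∈ s, ∑ j ∈ I i, k j = m i} =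
      ∏ i ∈ s, sumLaw μ (I i).card {m i} := by
  classical
  induction s using Finset.induction_on with
  | empty => simp
  | insert i₀ s hi₀ ih =>
    rw [Finset.prod_insert hi₀, ← ih (hI.subset (by simp)), ← map_sum_eq_sumLaw]
    have hsum : ∀ J : Finset ℕ, Measurable fun k : ℕ → ℕ => ∑ j ∈ J, k j := fun J =>
      Finset.measurable_fun_sum J fun j _ => measurable_pi_apply j
    rw [Measure.map_apply (hsum _) (measurableSet_singleton _)]
    set U : Finset ℕ := s.biUnion I
    have hdisj : Disjoint (I i₀) U := by
      rw [Finset.disjoint_biUnion_right]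
      intro i hi
      exact hI (by simp) (by simp [hi]) (by rintro rfl; exact hi₀ hi)
    have hind := (iIndepFun_coord μ).indepFun_finset (I i₀) U hdisj fun j => measurable_pi_apply j
    have hA : MeasurableSet {k : I i₀ → ℕ | ∑ j, k j = m i₀} :=
      measurableSet_eq_fun (Finset.measurable_fun_sum _ fun j _ => measurable_pi_apply j)
        measurable_const
    have hB : MeasurableSet
        {k : U → ℕ | ∀ i : s, ∑ j : I i, k ⟨j, Finset.mem_biUnion.2 ⟨i, i.2, j.2⟩⟩ = m i} := by
      rw [ofPred_forall]
      exact .iInter fun i => measurableSet_eq_fun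
        (Finset.measurable_fun_sum _ fun j _ => measurable_pi_apply _) measurable_const
    have h := hind.measure_inter_preimage_eq_mul _ _ hA hB
    have e1 : (fun (a : ℕ → ℕ) (i : I i₀) => a i) ⁻¹' {k : I i₀ → ℕ | ∑ j, k j = m i₀} =
        (fun k => ∑ j ∈ I i₀, k j) ⁻¹' {m i₀} := by
      ext k
      simp only [mem_preimage, mem_ofPred_eq, mem_singleton_iff]
      rw [Finset.sum_coe_sort (I i₀) k]
    have e2 : (fun (a : ℕ → ℕ) (i : U) => a i) ⁻¹'
        {k : U → ℕ | ∀ i : s, ∑ j : I i, k ⟨j, Finset.mem_biUnion.2 ⟨i, i.2, j.2⟩⟩ = m i} =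
        {k | ∀ i ∈ s, ∑ j ∈ I i, k j = m i} := by
      ext k
      simp only [mem_preimage, mem_ofPred_eq, Subtype.forall]
      refine forall₂_congr fun i hi => ?_
      rw [Finset.sum_coe_sort (I i) k]
    rw [e1, e2] at h
    rw [← h]
    congr 1
    ext k
    simp

end Marks

/-! ### Counting measures -/

/-- A measure which takes integer values on bounded sets is carried by its atoms. -/
lemma ae_singleton_ne_zero {ν : Measure ℝ}
    (hν : ∀ B : Set ℝ, MeasurableSet B → Bornology.IsBounded B → ∃ n : ℕ, ν B = (n : ℝ≥0∞)) :
    ∀ᵐ x ∂ν, ν {x} ≠ 0 := by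
  refine measure_null_of_locally_null _ fun x hx => ?_
  have hx0 : ν {x} = 0 := by simpa using hx
  have hanti : Antitone fun n : ℕ => Metric.closedBall x (1 / ((n : ℝ) + 1)) := by
    intro m n hmn
    exact Metric.closedBall_subset_closedBall (by gcongr)
  have hinter : ⋂ n : ℕ, Metric.closedBall x (1 / ((n : ℝ) + 1)) = {x} := by
    ext y
    simp only [mem_iInter, Metric.mem_closedBall, mem_singleton_iff]
    constructor
    · intro h
      have := ge_of_tendsto' tendsto_one_div_add_atTop_nhds_zero_nat h
      exact dist_le_zero.1 this
    · rintro rfl n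
      simp only [dist_self]; positivity
  have hlim := tendsto_measure_iInter_atTop (μ := ν)
    (s := fun n : ℕ => Metric.closedBall x (1 / ((n : ℝ) + 1)))
    (fun n => Metric.isClosed_closedBall.measurableSet.nullMeasurableSet) hanti
    ⟨0, by obtain ⟨k, hk⟩ := hν _ Metric.isClosed_closedBall.measurableSet
             Metric.isBounded_closedBall; rw [hk]; exact ENNReal.natCast_ne_top k⟩
  rw [hinter, hx0] at hlim
  obtain ⟨n, hn⟩ := ((tendsto_order.1 hlim).2 1 one_pos).exists
  refine ⟨_, mem_nhdsWithin_of_mem_nhds (Metric.closedBall_mem_nhds x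
    (show (0 : ℝ) < 1 / ((n : ℝ) + 1) by positivity)), ?_⟩
  obtain ⟨k, hk⟩ := hν _
    (Metric.isClosed_closedBall (x := x) (ε := 1 / ((n : ℝ) + 1))).measurableSet
    Metric.isBounded_closedBall
  rw [Function.comp_apply, hk] at hn
  rw [hk]
  have : k < 1 := by exact_mod_cast hn
  simp [Nat.lt_one_iff.1 this]

/-- A measure carried by its atoms is the sum of the masses along an enumeration of them. -/
lemma apply_eq_tsum_of_range_eq {ν : Measure ℝ} (hν : ∀ᵐ x ∂ν, ν {x} ≠ 0) {x : ℕ → ℝ}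
    (hinj : Function.Injective x) (hx : range x = pts ν) {B : Set ℝ} (hB : MeasurableSet B) :
    ν B = ∑' n, B.indicator (fun y => ν {y}) (x n) := by
  have h1 : ν B = ν (⋃ n, B ∩ {x n}) := by
    rw [← inter_iUnion]
    refine measure_congr ?_
    filter_upwards [hν] with y hy
    have : y ∈ ⋃ n, {x n} := by
      have : y ∈ range x := by rw [hx]; exact pos_iff_ne_zero.2 hy
      obtain ⟨n, rfl⟩ := this
      exact mem_iUnion.2 ⟨n, rfl⟩
    exact propext ⟨fun h => ⟨h, this⟩, fun h => h.1⟩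
  rw [h1, measure_iUnion]
  · refine tsum_congr fun n => ?_
    by_cases h : x n ∈ B
    · rw [indicator_of_mem h, inter_eq_right.2 (singleton_subset_iff.2 h)]
    · rw [indicator_of_notMem h, (disjoint_singleton_right.2 h).inter_eq, measure_empty]
  · intro i j hij
    exact Disjoint.mono inter_subset_right inter_subset_right
      (disjoint_singleton.2 fun h => hij (hinj h))
  · exact fun n => hB.inter (measurableSet_singleton _)

/-- The natural number underlying an integer mass. -/
def toCount (x : ℝ≥0∞) : ℕ := ⌊x.toReal⌋₊

@[simp] lemma toCount_natCast (n : ℕ) : toCount n = n := by simp [toCount]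

lemma measurable_toCount : Measurable toCount :=
  Nat.measurable_floor.comp ENNReal.measurable_toReal

lemma map_cast_map_toCount (μ : Measure ℕ) :
    (μ.map (fun k : ℕ => (k : ℝ≥0∞))).map toCount = μ := by
  rw [Measure.map_map measurable_toCount (measurable_of_countable _)]
  have : toCount ∘ (fun k : ℕ => (k : ℝ≥0∞)) = id := by funext k; simp
  rw [this, Measure.map_id]

/-! ### Almost sure properties of the Poisson process -/

/-- The dyadic interval of level `n` with index `a`. -/
def cell (n : ℕ) (a : ℤ) : Set ℝ := {x | ⌊x * 2 ^ n⌋ = a}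

lemma cell_eq (n : ℕ) (a : ℤ) : cell n a = Ico ((a : ℝ) / 2 ^ n) ((a + 1) / 2 ^ n) := by
  ext x
  have : (0 : ℝ) < 2 ^ n := by positivity
  rw [cell, mem_ofPred_eq, Int.floor_eq_iff, mem_Ico, div_le_iff₀ this, lt_div_iff₀ this]

lemma measurableSet_cell (n : ℕ) (a : ℤ) : MeasurableSet (cell n a) := by
  rw [cell_eq]; exact measurableSet_Ico

lemma volume_cell (n : ℕ) (a : ℤ) : volume (cell n a) = (2⁻¹ : ℝ≥0∞) ^ n := by
  rw [cell_eq, Real.volume_Ico, ← sub_div, add_sub_cancel_left, one_div, ENNReal.ofReal_inv_of_pos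
    (by positivity), ENNReal.ofReal_pow (by norm_num), ENNReal.inv_pow]
  norm_num

lemma disjoint_cell (n : ℕ) {a b : ℤ} (h : a ≠ b) : Disjoint (cell n a) (cell n b) := by
  rw [Set.disjoint_left]
  intro x hx hy
  exact h (hx.symm.trans hy)

lemma mem_cell (n : ℕ) (x : ℝ) : x ∈ cell n ⌊x * 2 ^ n⌋ := rfl

lemma floor_mem_Ico {L : ℕ} {x : ℝ} (hx : x ∈ Ico (-L : ℝ) L) (n : ℕ) :
    ⌊x * 2 ^ n⌋ ∈ Finset.Ico (-(L * 2 ^ n : ℤ)) (L * 2 ^ n) := by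
  have : (0 : ℝ) < 2 ^ n := by positivity
  rw [Finset.mem_Ico, Int.le_floor, Int.floor_lt]
  push_cast
  constructor
  · nlinarith [hx.1]
  · nlinarith [hx.2]

lemma eventually_floor_ne {x y : ℝ} (h : x ≠ y) :
    ∀ᶠ n : ℕ in atTop, ⌊x * 2 ^ n⌋ ≠ ⌊y * 2 ^ n⌋ := by
  have hpos : 0 < |x - y| := abs_pos.2 (sub_ne_zero.2 h)
  have h1 := (tendsto_pow_atTop_atTop_of_one_lt (one_lt_two (α := ℝ))).eventually_ge_atTop
    (1 / |x - y|)
  filter_upwards [h1] with n hn heq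
  have h2 := Int.abs_sub_lt_one_of_floor_eq_floor heq
  rw [← sub_mul, abs_mul, abs_of_pos (by positivity : (0 : ℝ) < 2 ^ n)] at h2
  rw [div_le_iff₀ hpos] at hn
  linarith

/-- Independence of the counts, for an arbitrary family of disjoint sets. -/
lemma IsPoissonProcess.iIndepFun {Ω : Type*} [MeasurableSpace Ω] {P : Measure Ω}
    {η : Ω → Measure ℝ} (hη : IsPoissonProcess P η) {ι : Type*} {B : ι → Set ℝ}
    (hB : ∀ i, MeasurableSet (B i)) (hd : Pairwise fun i j => Disjoint (B i) (B j)) :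
    iIndepFun (fun i ω => η ω (B i)) P := by
  rw [iIndepFun_iff_finset]
  intro s
  let e := s.equivFin
  have h := hη.indep_count s.card (fun k => B (e.symm k)) (fun k => hB _) fun i j hij =>
    hd fun h => hij (e.symm.injective (Subtype.ext h))
  have h2 := h.precomp (g := e) e.injective
  simp only [Equiv.symm_apply_apply] at h2
  exact h2

section Poisson

variable {Ω : Type*} [MeasurableSpace Ω] {P : Measure Ω} {η : Ω → Measure ℝ}
  (hη : IsPoissonProcess P η)
include hη

lemma measurable_count {B : Set ℝ} (hB : MeasurableSet B) : Measurable fun ω => η ω B :=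
  (Measure.measurable_coe hB).comp hη.measurable

lemma prob_count {B : Set ℝ} (hB : MeasurableSet B) (hv : volume B < ⊤) (p : ℝ≥0∞ → Prop)
    (hp : MeasurableSet {x | p x}) :
    P {ω | p (η ω B)} = poissonMeasure (volume B).toNNReal {n : ℕ | p n} := by
  rw [(hη.law_count B hB hv).measure_eq hp, Measure.map_apply (measurable_of_countable _) hp]
  rfl

lemma prob_count_eq {B : Set ℝ} (hB : MeasurableSet B) (hv : volume B < ⊤) (n : ℕ) :
    P {ω | η ω B = n} = poissonMeasure (volume B).toNNReal {n} := by
  rw [prob_count hη hB hv (fun x => x = n) (measurableSet_singleton _)]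
  congr 1
  ext k
  simp

lemma prob_void {B : Set ℝ} (hB : MeasurableSet B) (hv : volume B < ⊤) :
    P {ω | η ω B = 0} = ENNReal.ofReal (Real.exp (-(volume B).toReal)) := by
  have := prob_count_eq hη hB hv 0
  rw [poissonMeasure_singleton] at this
  simp only [Nat.cast_zero, pow_zero, mul_one, Nat.factorial_zero, Nat.cast_one, div_one] at this
  exact this

lemma lintegral_count_lt_top {B : Set ℝ} (hB : MeasurableSet B) (hv : volume B < ⊤) :
    ∫⁻ ω, η ω B ∂P < ⊤ := by
  have h1 : ∫⁻ ω, η ω B ∂P = ∫⁻ x, x ∂(P.map fun ω => η ω B) := by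
    rw [lintegral_map (f := fun x => x) measurable_id (measurable_count hη hB)]
  rw [h1, (hη.law_count B hB hv).map_eq,
    lintegral_map (f := fun x => x) measurable_id (measurable_of_countable _),
    lintegral_countable']
  set r : ℝ := ((volume B).toNNReal : ℝ) with hr
  have hr0 : 0 ≤ r := NNReal.coe_nonneg _
  have h2 : ∀ n : ℕ, (n : ℝ≥0∞) * poissonMeasure (volume B).toNNReal {n} ≤
      ENNReal.ofReal ((2 * r) ^ n / n.factorial) := by
    intro n
    rw [poissonMeasure_singleton, ← ENNReal.ofReal_natCast, ← ENNReal.ofReal_mul (by positivity)]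
    refine ENNReal.ofReal_le_ofReal ?_
    have h3 : (n : ℝ) ≤ 2 ^ n := by exact_mod_cast Nat.lt_two_pow_self.le
    have h4 : Real.exp (-r) ≤ 1 := Real.exp_le_one_iff.2 (by linarith)
    have h5 : 0 ≤ r ^ n / n.factorial := by positivity
    calc (n : ℝ) * (Real.exp (-r) * r ^ n / n.factorial)
        = (n * Real.exp (-r)) * (r ^ n / n.factorial) := by ring
      _ ≤ (2 ^ n * 1) * (r ^ n / n.factorial) := by
          gcongr
      _ = (2 * r) ^ n / n.factorial := by rw [mul_pow]; ring
  refine (ENNReal.tsum_le_tsum h2).trans_lt ?_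
  rw [← ENNReal.ofReal_tsum_of_nonneg (fun n => by positivity)
    (Real.summable_pow_div_factorial (2 * r))]
  exact ENNReal.ofReal_lt_top

variable [IsProbabilityMeasure P]

lemma prob_count_ne_zero_le {B : Set ℝ} (hB : MeasurableSet B) (hv : volume B < ⊤) :
    P {ω | η ω B ≠ 0} ≤ volume B := by
  have hm : MeasurableSet {ω | η ω B = 0} := measurable_count hη hB (measurableSet_singleton 0)
  have h1 := prob_compl_eq_one_sub (μ := P) hm
  have h2 : {ω | η ω B ≠ 0} = {ω | η ω B = 0}ᶜ := rfl
  rw [h2, h1, prob_void hη hB hv]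
  rw [← ENNReal.ofReal_one, ← ENNReal.ofReal_sub _ (Real.exp_pos _).le]
  refine (ENNReal.ofReal_le_ofReal ?_).trans (ENNReal.ofReal_toReal hv.ne).le
  linarith [Real.add_one_le_exp (-(volume B).toReal)]

lemma prob_two_le_count_le {B : Set ℝ} (hB : MeasurableSet B) (hv : volume B < ⊤) :
    P {ω | η ω B ≠ 0 ∧ η ω B ≠ 1} ≤ volume B ^ 2 := by
  have hm0 : MeasurableSet {ω | η ω B = 0} := measurable_count hη hB (measurableSet_singleton 0)
  have hm1 : MeasurableSet {ω | η ω B = 1} := measurable_count hη hB (measurableSet_singleton 1)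
  have h1 := prob_compl_eq_one_sub (μ := P) (hm0.union hm1)
  have h2 : {ω | η ω B ≠ 0 ∧ η ω B ≠ 1} = ({ω | η ω B = 0} ∪ {ω | η ω B = 1})ᶜ := by
    ext ω; simp
  have hdisj : Disjoint {ω | η ω B = 0} {ω | η ω B = 1} := by
    rw [Set.disjoint_left]
    intro ω h h'
    simp only [mem_ofPred_eq] at h h'
    rw [h] at h'
    exact zero_ne_one h'
  have h3 := prob_count_eq hη hB hv 1
  rw [Nat.cast_one, poissonMeasure_singleton] at h3
  rw [h2, h1, measure_union hdisj hm1, prob_void hη hB hv, h3]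
  set r := (volume B).toReal with hr
  have hr0 : 0 ≤ r := ENNReal.toReal_nonneg
  have hr' : ((volume B).toNNReal : ℝ) = r := rfl
  rw [hr', ← ENNReal.ofReal_add (Real.exp_pos _).le (by positivity), ← ENNReal.ofReal_one,
    ← ENNReal.ofReal_sub _ (by positivity)]
  have h5 : volume B ^ 2 = ENNReal.ofReal (r ^ 2) := by
    rw [ENNReal.ofReal_pow hr0, hr, ENNReal.ofReal_toReal hv.ne]
  rw [h5]
  refine ENNReal.ofReal_le_ofReal ?_
  simp only [pow_one, Nat.factorial_one, Nat.cast_one, div_one]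
  nlinarith [Real.add_one_le_exp (-r), Real.exp_pos (-r)]

/-- The expected number of dyadic intervals of level `n` in a bounded window that contain two points
is of order `2⁻ⁿ`, hence by Borel–Cantelli there is none for large `n`. -/
lemma ae_simple : ∀ᵐ ω ∂P, ∀ᵐ x ∂η ω, η ω {x} = 1 := by
  have key : ∀ L : ℕ, ∀ᵐ ω ∂P, ∀ᶠ n : ℕ in atTop, ω ∉
      ⋃ a ∈ Finset.Ico (-(L * 2 ^ n : ℤ)) (L * 2 ^ n),
        {ω | η ω (cell n a) ≠ 0 ∧ η ω (cell n a) ≠ 1} := by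
    intro L
    refine ae_eventually_notMem (ne_top_of_le_ne_top ?_ (ENNReal.tsum_le_tsum fun n => ?_)
      (b := ∑' n : ℕ, (2 * L : ℝ≥0∞) * (2⁻¹) ^ n))
    · rw [ENNReal.tsum_mul_left, ENNReal.tsum_geometric]
      refine ENNReal.mul_ne_top (ENNReal.mul_ne_top (by simp) (by simp)) ?_
      simp
    · refine (measure_biUnion_finset_le _ _).trans ?_
      refine (Finset.sum_le_card_nsmul _ _ ((2⁻¹ : ℝ≥0∞) ^ n * (2⁻¹) ^ n) fun a _ => ?_).trans ?_
      · refine (prob_two_le_count_le hη (measurableSet_cell n a) ?_).trans ?_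
        · rw [volume_cell]; exact ENNReal.pow_lt_top (by simp)
        · rw [volume_cell, sq]
      · rw [Int.card_Ico, nsmul_eq_mul, ← mul_assoc]
        refine mul_le_mul_left ?_ _
        have : ((L * 2 ^ n - -(L * 2 ^ n) : ℤ).toNat : ℝ≥0∞) = 2 * L * 2 ^ n := by
          have : (L * 2 ^ n - -(L * 2 ^ n) : ℤ).toNat = 2 * L * 2 ^ n := by
            have : (L * 2 ^ n - -(L * 2 ^ n) : ℤ) = ((2 * L * 2 ^ n : ℕ) : ℤ) := by push_cast; ring
            rw [this, Int.toNat_natCast]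
          rw [this]; push_cast; ring
        rw [this, mul_assoc, ← mul_pow, ENNReal.mul_inv_cancel (by simp) (by simp)]
        simp
  filter_upwards [ae_all_iff.2 key, hη.integer_valued] with ω hω hint
  filter_upwards [ae_singleton_ne_zero hint] with x hx
  obtain ⟨L, hL⟩ := exists_nat_gt |x|
  have hxL : x ∈ Ico (-L : ℝ) L := ⟨(abs_lt.1 hL).1.le, (abs_lt.1 hL).2⟩
  obtain ⟨n, hn⟩ := (hω L).exists
  simp only [mem_iUnion, mem_ofPred_eq, not_exists, not_and, not_not] at hn
  have hle : η ω {x} ≤ η ω (cell n ⌊x * 2 ^ n⌋) :=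
    measure_mono (singleton_subset_iff.2 (mem_cell n x))
  have h1 := hn _ (floor_mem_Ico hxL n) (fun h => hx (le_antisymm (h ▸ hle) (zero_le)))
  rw [h1] at hle
  obtain ⟨k, hk⟩ := hint {x} (measurableSet_singleton x) Bornology.isBounded_singleton
  rw [hk] at hle hx ⊢
  have h2 : k ≤ 1 := by exact_mod_cast hle
  have h3 : k ≠ 0 := by rintro rfl; exact hx (by simp)
  have : k = 1 := by omega
  simp [this]

/-- If `x` is the midpoint of `y` and `z`, then the indices of their dyadic intervals satisfy the
same relation up to an error `j` with `|j| ≤ 2`. The expected number of such triples of distinct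
nonempty intervals in a bounded window is of order `2⁻ⁿ`, and Borel–Cantelli applies. -/
lemma ae_noMid : ∀ᵐ ω ∂P, ∀ x ∈ pts (η ω), ∀ y ∈ pts (η ω), ∀ z ∈ pts (η ω), x ≠ y →
    dist x y = dist x z → y = z := by
  let T : ℕ → ℕ → Finset (ℤ × ℤ × ℤ) := fun L n =>
    Finset.Ico (-(L * 2 ^ n : ℤ)) (L * 2 ^ n) ×ˢ Finset.Ico (-(L * 2 ^ n : ℤ)) (L * 2 ^ n) ×ˢ
      Finset.Icc (-2) 2
  let ev : ℕ → ℤ × ℤ × ℤ → Set Ω := fun n t =>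
    {ω | (t.1 ≠ t.2.1 ∧ t.1 ≠ 2 * t.1 - t.2.1 - t.2.2 ∧ t.2.1 ≠ 2 * t.1 - t.2.1 - t.2.2) ∧
      η ω (cell n t.1) ≠ 0 ∧ η ω (cell n t.2.1) ≠ 0 ∧ η ω (cell n (2 * t.1 - t.2.1 - t.2.2)) ≠ 0}
  have hev : ∀ n t, P (ev n t) ≤ (2⁻¹ : ℝ≥0∞) ^ n * (2⁻¹) ^ n * (2⁻¹) ^ n := by
    rintro n ⟨a, b, j⟩
    by_cases hne : a ≠ b ∧ a ≠ 2 * a - b - j ∧ b ≠ 2 * a - b - j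
    swap
    · have : ev n (a, b, j) = ∅ := by
        ext ω
        simp only [ev, mem_ofPred_eq, mem_empty_iff_false, iff_false]
        exact fun h => hne h.1
      rw [this]; simp
    let f : Fin 3 → ℤ := ![a, b, 2 * a - b - j]
    have hf : Function.Injective f := by
      intro i k hik
      fin_cases i <;> fin_cases k <;> simp [f] at hik ⊢ <;> omega
    have hind := hη.indep_count 3 (fun i => cell n (f i)) (fun i => measurableSet_cell _ _)
      fun i k hik => disjoint_cell n (hf.ne hik)
    have h := hind.measure_inter_preimage_eq_mul Finset.univ (sets := fun _ => {0}ᶜ)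
      fun _ _ => (measurableSet_singleton _).compl
    have hsub : ev n (a, b, j) ⊆
        ⋂ i ∈ Finset.univ, (fun ω => η ω (cell n (f i))) ⁻¹' {0}ᶜ := by
      intro ω hω
      simp only [mem_iInter]
      intro i _
      fin_cases i
      · exact hω.2.1
      · exact hω.2.2.1
      · exact hω.2.2.2
    refine (measure_mono hsub).trans ?_
    rw [h, Fin.prod_univ_three]
    have hle : ∀ i, P ((fun ω => η ω (cell n (f i))) ⁻¹' {0}ᶜ) ≤ (2⁻¹ : ℝ≥0∞) ^ n := fun i => by
      rw [← volume_cell n (f i)]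
      exact prob_count_ne_zero_le hη (measurableSet_cell _ _)
        (by rw [volume_cell]; exact ENNReal.pow_lt_top (by simp))
    gcongr <;> exact hle _
  have key : ∀ L : ℕ, ∀ᵐ ω ∂P, ∀ᶠ n : ℕ in atTop, ω ∉ ⋃ t ∈ T L n, ev n t := by
    intro L
    refine ae_eventually_notMem (ne_top_of_le_ne_top ?_ (ENNReal.tsum_le_tsum fun n => ?_)
      (b := ∑' n : ℕ, (2 * L * (2 * L) * 5 : ℝ≥0∞) * (2⁻¹) ^ n))
    · rw [ENNReal.tsum_mul_left, ENNReal.tsum_geometric]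
      have : (2 * L : ℝ≥0∞) ≠ ⊤ := ENNReal.mul_ne_top (by simp) (by simp)
      refine ENNReal.mul_ne_top (ENNReal.mul_ne_top (ENNReal.mul_ne_top this this) (by simp)) ?_
      simp
    · refine (measure_biUnion_finset_le _ _).trans ?_
      refine (Finset.sum_le_card_nsmul _ _ _ fun t _ => hev n t).trans ?_
      have hcard : (T L n).card = (2 * L * 2 ^ n) * ((2 * L * 2 ^ n) * 5) := by
        have : (L * 2 ^ n - -(L * 2 ^ n) : ℤ).toNat = 2 * L * 2 ^ n := by
          have : (L * 2 ^ n - -(L * 2 ^ n) : ℤ) = ((2 * L * 2 ^ n : ℕ) : ℤ) := by push_cast; ring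
          rw [this, Int.toNat_natCast]
        simp only [T, Finset.card_product, Int.card_Ico, this]
        rfl
      rw [hcard, nsmul_eq_mul]
      push_cast
      have h1 : (2 : ℝ≥0∞) ^ n * 2⁻¹ ^ n = 1 := by
        rw [← mul_pow, ENNReal.mul_inv_cancel (by simp) (by simp), one_pow]
      calc (2 * L * 2 ^ n * (2 * L * 2 ^ n * 5) * (2⁻¹ ^ n * 2⁻¹ ^ n * 2⁻¹ ^ n) : ℝ≥0∞)
          = 2 * L * (2 * L) * 5 * 2⁻¹ ^ n * (2 ^ n * 2⁻¹ ^ n) * (2 ^ n * 2⁻¹ ^ n) := by ring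
        _ ≤ _ := by rw [h1, mul_one, mul_one]
  filter_upwards [ae_all_iff.2 key] with ω hω x hx y hy z hz hxy hd
  by_contra hyz
  have hxz : x ≠ z := by
    rintro rfl
    rw [dist_self] at hd
    exact hxy (dist_eq_zero.1 hd)
  have hmid : 2 * x = y + z := by
    rw [Real.dist_eq, Real.dist_eq] at hd
    rcases abs_eq_abs.1 hd with h | h
    · exact absurd (by linarith) hyz
    · linarith
  obtain ⟨L, hL⟩ := exists_nat_gt (max |x| |y|)
  have hxL : x ∈ Ico (-L : ℝ) L :=
    ⟨(abs_lt.1 ((le_max_left _ _).trans_lt hL)).1.le, (abs_lt.1 ((le_max_left _ _).trans_lt hL)).2⟩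
  have hyL : y ∈ Ico (-L : ℝ) L :=
    ⟨(abs_lt.1 ((le_max_right _ _).trans_lt hL)).1.le,
      (abs_lt.1 ((le_max_right _ _).trans_lt hL)).2⟩
  obtain ⟨n, ⟨⟨hn, h1⟩, h2⟩, h3⟩ := ((((hω L).and (eventually_floor_ne hxy)).and
    (eventually_floor_ne hxz)).and (eventually_floor_ne hyz)).exists
  refine hn ?_
  set a := ⌊x * 2 ^ n⌋ with ha
  set b := ⌊y * 2 ^ n⌋ with hb
  set c := ⌊z * 2 ^ n⌋ with hc
  have hc' : c = 2 * a - b - (2 * a - b - c) := by ring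
  have hmul : 2 * (x * 2 ^ n) = y * 2 ^ n + z * 2 ^ n := by rw [← mul_assoc, hmid, add_mul]
  have hj : 2 * a - b - c ∈ Finset.Icc (-2 : ℤ) 2 := by
    have a1 := Int.floor_le (x * 2 ^ n)
    have a2 := Int.lt_floor_add_one (x * 2 ^ n)
    have b1 := Int.floor_le (y * 2 ^ n)
    have b2 := Int.lt_floor_add_one (y * 2 ^ n)
    have c1 := Int.floor_le (z * 2 ^ n)
    have c2 := Int.lt_floor_add_one (z * 2 ^ n)
    rw [Finset.mem_Icc]
    constructor
    · have : (-3 : ℝ) < ((2 * a - b - c : ℤ) : ℝ) := by push_cast; linarith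
      have : (-3 : ℤ) < 2 * a - b - c := by exact_mod_cast this
      omega
    · have : ((2 * a - b - c : ℤ) : ℝ) < 3 := by push_cast; linarith
      have : 2 * a - b - c < 3 := by exact_mod_cast this
      omega
  have hpos : ∀ w ∈ pts (η ω), η ω (cell n ⌊w * 2 ^ n⌋) ≠ 0 := by
    intro w hw h0
    have hw' : 0 < η ω {w} := hw
    exact hw'.ne' (measure_mono_null (singleton_subset_iff.2 (mem_cell n w)) h0)
  refine mem_iUnion₂.2 ⟨(a, b, 2 * a - b - c), ?_, ?_⟩
  · exact Finset.mem_product.2 ⟨floor_mem_Ico hxL n, Finset.mem_product.2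
      ⟨floor_mem_Ico hyL n, hj⟩⟩
  · simp only [ev, mem_ofPred_eq]
    rw [← hc']
    exact ⟨⟨h1, h2, h3⟩, hpos x hx, hpos y hy, hpos z hz⟩

/-- Among infinitely many disjoint intervals of the same length, infinitely many are empty. -/
lemma ae_frequently_void {B : ℕ → Set ℝ} (hB : ∀ j, MeasurableSet (B j))
    (hd : Pairwise fun i j => Disjoint (B i) (B j)) {v : ℝ≥0∞} (hv : v < ⊤)
    (hvol : ∀ j, volume (B j) = v) : ∀ᵐ ω ∂P, ∃ᶠ j in atTop, η ω (B j) = 0 := by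
  have hm : ∀ j, MeasurableSet {ω | η ω (B j) = 0} := fun j =>
    measurable_count hη (hB j) (measurableSet_singleton 0)
  have hind := hη.iIndepFun hB hd
  have hset : iIndepSet (fun j => {ω | η ω (B j) = 0}) P := by
    rw [iIndepSet_iff_meas_biInter hm]
    intro s
    exact hind.measure_inter_preimage_eq_mul s (sets := fun _ => {0})
      fun _ _ => measurableSet_singleton _
  have h1 := measure_limsup_eq_one hm hset (by
    simp only [prob_void hη (hB _) ((hvol _).trans_lt hv), hvol]
    refine ENNReal.tsum_const_eq_top_of_ne_zero ?_
    simp [Real.exp_pos])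
  have h2 : ∀ᵐ ω ∂P, ω ∈ limsup (fun j => {ω | η ω (B j) = 0}) atTop := by
    rw [← measure_univ (μ := P)] at h1
    exact (ae_iff_measure_eq (MeasurableSet.measurableSet_limsup hm).nullMeasurableSet).2 h1
  filter_upwards [h2] with ω hω
  exact (mem_limsup_iff_frequently_mem (s := fun j => {ω | η ω (B j) = 0}) (a := ω)).1 hω

lemma ae_gapR : ∀ᵐ ω ∂P, ∀ r a : ℝ, ∃ b ≥ a, ∀ x ∈ pts (η ω), ¬ (b ≤ x ∧ x ≤ b + r) := by
  have key : ∀ m : ℕ, ∀ᵐ ω ∂P, ∃ᶠ j : ℕ in atTop,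
      η ω (Ico ((j : ℝ) * (m + 1)) ((j + 1 : ℝ) * (m + 1))) = 0 := by
    intro m
    refine ae_frequently_void hη (fun j => measurableSet_Ico) ?_ (v := ENNReal.ofReal (m + 1))
      ENNReal.ofReal_lt_top (fun j => by rw [Real.volume_Ico]; congr 1; ring)
    intro i j hij
    have hm0 : (0 : ℝ) < m + 1 := by positivity
    rcases lt_or_gt_of_ne hij with h | h
    · have h' : ((i : ℝ) + 1) ≤ j := by exact_mod_cast h
      refine Set.disjoint_left.2 fun x hx hy => ?_
      have := mul_le_mul_of_nonneg_right h' hm0.le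
      exact absurd hx.2 (not_lt.2 (this.trans hy.1))
    · have h' : ((j : ℝ) + 1) ≤ i := by exact_mod_cast h
      refine Set.disjoint_left.2 fun x hx hy => ?_
      have := mul_le_mul_of_nonneg_right h' hm0.le
      exact absurd hy.2 (not_lt.2 (this.trans hx.1))
  filter_upwards [ae_all_iff.2 key] with ω hω r a
  obtain ⟨m, hm⟩ := exists_nat_ge r
  obtain ⟨j₀, hj₀⟩ := exists_nat_ge |a|
  obtain ⟨j, hj0, hj⟩ := ((hω m).and_eventually (eventually_ge_atTop j₀)).exists
  have hj' : (j₀ : ℝ) ≤ j := by exact_mod_cast hj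
  have hm1 : (1 : ℝ) ≤ m + 1 := by linarith [Nat.cast_nonneg (α := ℝ) m]
  have hjm : (j : ℝ) ≤ j * (m + 1) := le_mul_of_one_le_right (Nat.cast_nonneg _) hm1
  refine ⟨j * (m + 1), by linarith [le_abs_self a], fun x hx hb => ?_⟩
  have hx' : 0 < η ω {x} := hx
  refine hx'.ne' (measure_mono_null (singleton_subset_iff.2 (mem_Ico.2 ⟨hb.1, ?_⟩)) hj0)
  linarith [hb.2]

lemma ae_gapL : ∀ᵐ ω ∂P, ∀ r a : ℝ, ∃ b ≤ a, ∀ x ∈ pts (η ω), ¬ (b - r ≤ x ∧ x ≤ b) := by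
  have key : ∀ m : ℕ, ∀ᵐ ω ∂P, ∃ᶠ j : ℕ in atTop,
      η ω (Ioc (-((j + 1 : ℝ) * (m + 1))) (-((j : ℝ) * (m + 1)))) = 0 := by
    intro m
    refine ae_frequently_void hη (fun j => measurableSet_Ioc) ?_ (v := ENNReal.ofReal (m + 1))
      ENNReal.ofReal_lt_top (fun j => by rw [Real.volume_Ioc]; congr 1; ring)
    intro i j hij
    have hm0 : (0 : ℝ) < m + 1 := by positivity
    rcases lt_or_gt_of_ne hij with h | h
    · have h' : ((i : ℝ) + 1) ≤ j := by exact_mod_cast h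
      refine Set.disjoint_left.2 fun x hx hy => ?_
      have := mul_le_mul_of_nonneg_right h' hm0.le
      linarith [hx.1, hy.2]
    · have h' : ((j : ℝ) + 1) ≤ i := by exact_mod_cast h
      refine Set.disjoint_left.2 fun x hx hy => ?_
      have := mul_le_mul_of_nonneg_right h' hm0.le
      linarith [hy.1, hx.2]
  filter_upwards [ae_all_iff.2 key] with ω hω r a
  obtain ⟨m, hm⟩ := exists_nat_ge r
  obtain ⟨j₀, hj₀⟩ := exists_nat_ge |a|
  obtain ⟨j, hj0, hj⟩ := ((hω m).and_eventually (eventually_ge_atTop j₀)).exists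
  have hj' : (j₀ : ℝ) ≤ j := by exact_mod_cast hj
  have hm1 : (1 : ℝ) ≤ m + 1 := by linarith [Nat.cast_nonneg (α := ℝ) m]
  have hjm : (j : ℝ) ≤ j * (m + 1) := le_mul_of_one_le_right (Nat.cast_nonneg _) hm1
  refine ⟨-(j * (m + 1)), by linarith [neg_abs_le a], fun x hx hb => ?_⟩
  have hx' : 0 < η ω {x} := hx
  refine hx'.ne' (measure_mono_null (singleton_subset_iff.2 (mem_Ioc.2 ⟨?_, hb.2⟩)) hj0)
  linarith [hb.1]

end Poisson

/-! ### Joint law of the numbers of points and of the total degrees in disjoint sets -/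

section Marked

variable {Ω : Type*} [MeasurableSpace Ω] {P : Measure Ω} [IsProbabilityMeasure P]
  {μ : Measure ℕ} [IsProbabilityMeasure μ] {η ξ : Ω → Measure ℝ}
  (hη : IsPoissonProcess P η) (hξ : IsIIDMarking P μ η ξ)
include hη hξ

/-- Given the points, the total degrees in disjoint sets are independent sums of i.i.d. degrees, as
many as there are points in the set. -/
lemma prob_counts_eq {ι : Type*} [Fintype ι] {B : ι → Set ℝ} (hB : ∀ i, MeasurableSet (B i))
    (hd : Pairwise fun i j => Disjoint (B i) (B j)) (n m : ι → ℕ) :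
    P {ω | ∀ i, η ω (B i) = n i ∧ ξ ω (B i) = m i} =
      P {ω | ∀ i, η ω (B i) = n i} * ∏ i, sumLaw μ (n i) {m i} := by
  obtain ⟨X, hXm, hXe, hlaw, hiid, hind⟩ := hξ.iid_marks
  set κ := Measure.infinitePi fun _ : ℕ => μ with hκ
  -- The degrees along the enumeration, as natural numbers.
  let K : Ω → ℕ → ℕ := fun ω j => toCount (ξ ω {X j (η ω)})
  have hKm : ∀ j, AEMeasurable (fun ω => K ω j) P := fun j =>
    measurable_toCount.comp_aemeasurable (hlaw j).aemeasurable
  have hKlaw : ∀ j, P.map (fun ω => K ω j) = μ := by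
    intro j
    have h1 := AEMeasurable.map_map_of_aemeasurable (measurable_toCount.aemeasurable)
      (hlaw j).aemeasurable
    rw [(hlaw j).map_eq, map_cast_map_toCount] at h1
    exact h1.symm
  have hKiid : iIndepFun (fun j ω => K ω j) P :=
    hiid.comp (fun _ => toCount) fun _ => measurable_toCount
  have hKκ : P.map K = κ := by
    have := (iIndepFun_iff_map_fun_eq_infinitePi_map₀' hKm).1 hKiid
    simp only [hKlaw] at this
    exact this
  have hKη : IndepFun K η P :=
    hind.comp (φ := fun (x : ℕ → ℝ≥0∞) j => toCount (x j)) (ψ := id)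
      (measurable_pi_lambda _ fun j => measurable_toCount.comp (measurable_pi_apply j))
      measurable_id
  have hKae : AEMeasurable K P := aemeasurable_pi_lambda _ hKm
  have hprod := (indepFun_iff_map_prod_eq_prod_map_map hKae hη.measurable.aemeasurable).1 hKη
  rw [hKκ] at hprod
  have hsim := ae_simple hη
  -- The numbers of points and the total degrees, computed along the enumeration so that they are
  -- measurable functions of the points and of the sequence of degrees.
  let cnt : ι → Measure ℝ → ℝ≥0∞ := fun i ν => ∑' j, (B i).indicator 1 (X j ν)
  have hcntm : ∀ i, Measurable (cnt i) := fun i =>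
    Measurable.tsum fun j => (measurable_one.indicator (hB i)).comp (hXm j)
  let tot : ι → (ℕ → ℕ) × Measure ℝ → ℝ≥0∞ := fun i q =>
    ∑' j, (B i).indicator (fun _ => (q.1 j : ℝ≥0∞)) (X j q.2)
  have htotm : ∀ i, Measurable (tot i) := by
    intro i
    refine Measurable.tsum fun j => ?_
    have : (fun q : (ℕ → ℕ) × Measure ℝ => (B i).indicator (fun _ => (q.1 j : ℝ≥0∞)) (X j q.2)) =
        {q : (ℕ → ℕ) × Measure ℝ | X j q.2 ∈ B i}.indicator fun q => (q.1 j : ℝ≥0∞) := by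
      funext q
      by_cases h : X j q.2 ∈ B i
      · rw [indicator_of_mem h, indicator_of_mem (by exact h)]
      · rw [indicator_of_notMem h, indicator_of_notMem (by exact h)]
    rw [this]
    refine Measurable.indicator ?_ (((hXm j).comp measurable_snd) (hB i))
    exact (measurable_of_countable (fun k : ℕ => (k : ℝ≥0∞))).comp
      ((measurable_pi_apply j).comp measurable_fst)
  have hcnt : ∀ᵐ ω ∂P, ∀ i, cnt i (η ω) = η ω (B i) := by
    filter_upwards [hXe, hsim] with ω hω hs i
    have hne : ∀ᵐ x ∂η ω, η ω {x} ≠ 0 := hs.mono fun x hx => by rw [hx]; exact one_ne_zero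
    rw [apply_eq_tsum_of_range_eq hne hω.1 hω.2 (hB i)]
    refine tsum_congr fun j => ?_
    by_cases h : X j (η ω) ∈ B i
    · rw [indicator_of_mem h, indicator_of_mem h]
      have hj : η ω {X j (η ω)} ≠ 0 := by
        have : X j (η ω) ∈ pts (η ω) := hω.2 ▸ mem_range_self j
        exact (show 0 < η ω {X j (η ω)} from this).ne'
      by_contra hcon
      refine hj (measure_mono_null (singleton_subset_iff.2 ?_) hs)
      exact fun h => hcon (Eq.symm h)
    · rw [indicator_of_notMem h, indicator_of_notMem h]
  have htot : ∀ᵐ ω ∂P, ∀ i, tot i (K ω, η ω) = ξ ω (B i) := by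
    filter_upwards [hXe, hξ.same_support, hξ.isPointProcess.integer_valued] with ω hω hsup hint i
    rw [apply_eq_tsum_of_range_eq (ae_singleton_ne_zero hint) hω.1 (hω.2.trans hsup.symm) (hB i)]
    refine tsum_congr fun j => ?_
    by_cases h : X j (η ω) ∈ B i
    · rw [indicator_of_mem h, indicator_of_mem h]
      obtain ⟨k, hk⟩ := hint {X j (η ω)} (measurableSet_singleton _)
        Bornology.isBounded_singleton
      simp [K, hk]
    · rw [indicator_of_notMem h, indicator_of_notMem h]
  let S : Set ((ℕ → ℕ) × Measure ℝ) := {q | ∀ i, q.2 (B i) = n i ∧ tot i q = m i}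
  have hSm : MeasurableSet S := by
    have : S = ⋂ i, ({q | q.2 (B i) = (n i : ℝ≥0∞)} ∩ {q | tot i q = (m i : ℝ≥0∞)}) := by
      ext q; simp [S]
    rw [this]
    refine .iInter fun i => .inter ?_ (htotm i (measurableSet_singleton _))
    exact ((Measure.measurable_coe (hB i)).comp measurable_snd) (measurableSet_singleton _)
  have hS : P {ω | ∀ i, η ω (B i) = n i ∧ ξ ω (B i) = m i} = (κ.prod (P.map η)) S := by
    rw [← hprod, Measure.map_apply_of_aemeasurable
      (hKae.prodMk hη.measurable.aemeasurable) hSm]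
    refine measure_congr ?_
    filter_upwards [htot] with ω hω
    refine propext (forall_congr' fun i => ?_)
    simp only [hω i]
  have hT : MeasurableSet {ν : Measure ℝ | ∀ i, ν (B i) = n i} := by
    rw [ofPred_forall]
    exact .iInter fun i => Measure.measurable_coe (hB i) (measurableSet_singleton _)
  have hgood : ∀ᵐ ν ∂P.map η, ∀ i, cnt i ν = ν (B i) := by
    rw [ae_map_iff hη.measurable.aemeasurable]
    · exact hcnt
    · rw [ofPred_forall]
      exact .iInter fun i => measurableSet_eq_fun (hcntm i) (Measure.measurable_coe (hB i))
  rw [hS, Measure.prod_apply_symm hSm]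
  have hint : ∀ᵐ ν ∂P.map η, κ ((fun k => (k, ν)) ⁻¹' S) =
      {ν : Measure ℝ | ∀ i, ν (B i) = n i}.indicator
        (fun _ => ∏ i, sumLaw μ (n i) {m i}) ν := by
    filter_upwards [hgood] with ν hν
    by_cases hn : ∀ i, ν (B i) = n i
    swap
    · rw [indicator_of_notMem (by exact hn)]
      have : (fun k => (k, ν)) ⁻¹' S = ∅ := by
        ext k
        simp only [mem_preimage, mem_empty_iff_false, iff_false]
        exact fun h => hn fun i => (h i).1
      rw [this, measure_empty]
    rw [indicator_of_mem (by exact hn)]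
    have henc : ∀ i, {j | X j ν ∈ B i}.encard = n i := by
      intro i
      have h1 : cnt i ν = ({j | X j ν ∈ B i}.encard : ℝ≥0∞) := by
        have : cnt i ν = ∑' j, {j | X j ν ∈ B i}.indicator (fun _ => (1 : ℝ≥0∞)) j :=
          tsum_congr fun j => by
            by_cases h : X j ν ∈ B i
            · rw [indicator_of_mem h, indicator_of_mem (by exact h)]; rfl
            · rw [indicator_of_notMem h, indicator_of_notMem (by exact h)]
        rw [this, ← tsum_subtype, ENNReal.tsum_set_one]
      rw [hν i, hn i] at h1
      have h2 : (({j | X j ν ∈ B i}.encard : ℕ∞) : ℝ≥0∞) = ((n i : ℕ∞) : ℝ≥0∞) := by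
        rw [← h1]; simp
      exact ENat.toENNReal_inj.1 h2
    have hfin : ∀ i, {j | X j ν ∈ B i}.Finite := fun i =>
      Set.finite_of_encard_eq_coe (henc i)
    let I : ι → Finset ℕ := fun i => (hfin i).toFinset
    have hcard : ∀ i, (I i).card = n i := by
      intro i
      have h := henc i
      rw [(hfin i).encard_eq_coe_toFinset_card] at h
      exact_mod_cast h
    have hI : ((Finset.univ : Finset ι) : Set ι).PairwiseDisjoint I := by
      intro i _ j _ hij
      rw [Function.onFun, Finset.disjoint_left]
      intro l hl hl'
      simp only [I, Finite.mem_toFinset, mem_ofPred_eq] at hl hl'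
      exact Set.disjoint_left.1 (hd hij) hl hl'
    have := measure_block_sums μ Finset.univ I hI m
    simp only [hcard] at this
    rw [← this, ← hκ]
    congr 1
    ext k
    simp only [mem_preimage, S, mem_ofPred_eq, Finset.mem_univ, true_imp_iff]
    refine forall_congr' fun i => ?_
    have h1 : tot i (k, ν) = ((∑ j ∈ I i, k j : ℕ) : ℝ≥0∞) := by
      push_cast
      simp only [tot]
      rw [tsum_eq_sum (s := I i)]
      · refine Finset.sum_congr rfl fun j hj => ?_
        simp only [I, Finite.mem_toFinset, mem_ofPred_eq] at hj
        rw [indicator_of_mem hj]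
      · intro j hj
        simp only [I, Finite.mem_toFinset, mem_ofPred_eq] at hj
        rw [indicator_of_notMem hj]
    rw [h1]
    exact ⟨fun h => by exact_mod_cast h.2, fun h => ⟨hn i, by exact_mod_cast h⟩⟩
  rw [lintegral_congr_ae hint, lintegral_indicator hT, setLIntegral_const,
    Measure.map_apply hη.measurable hT, mul_comm]
  rfl

/-- The number of points and the total degree in a set. -/
def evalPair (η ξ : Ω → Measure ℝ) (B : Set ℝ) (ω : Ω) : ℝ≥0∞ × ℝ≥0∞ := (η ω B, ξ ω B)

omit [IsProbabilityMeasure P] [IsProbabilityMeasure μ] in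
lemma measurable_evalPair {B : Set ℝ} (hB : MeasurableSet B) : Measurable (evalPair η ξ B) :=
  ((Measure.measurable_coe hB).comp hη.measurable).prodMk
    ((Measure.measurable_coe hB).comp hξ.isPointProcess.measurable)

/-- The integer version of the pair of the number of points and the total degree. -/
def evalNat (η ξ : Ω → Measure ℝ) (B : Set ℝ) (ω : Ω) : ℕ × ℕ :=
  (toCount (η ω B), toCount (ξ ω B))

omit [IsProbabilityMeasure P] [IsProbabilityMeasure μ] in
lemma measurable_evalNat {B : Set ℝ} (hB : MeasurableSet B) : Measurable (evalNat η ξ B) :=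
  (measurable_toCount.comp (measurable_evalPair hη hξ hB).fst).prodMk
    (measurable_toCount.comp (measurable_evalPair hη hξ hB).snd)

omit [IsProbabilityMeasure P] [IsProbabilityMeasure μ] in
lemma evalPair_ae_eq {B : Set ℝ} (hB : MeasurableSet B) (hbd : Bornology.IsBounded B) :
    (fun ω => (((evalNat η ξ B ω).1 : ℝ≥0∞), ((evalNat η ξ B ω).2 : ℝ≥0∞))) =ᵐ[P]
      evalPair η ξ B := by
  filter_upwards [hη.integer_valued, hξ.isPointProcess.integer_valued] with ω h1 h2
  obtain ⟨n, hn⟩ := h1 B hB hbd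
  obtain ⟨m, hm⟩ := h2 B hB hbd
  simp [evalNat, evalPair, hn, hm]

lemma map_evalNat_singleton {B : Set ℝ} (hB : MeasurableSet B) (hbd : Bornology.IsBounded B)
    (v : ℕ × ℕ) : P.map (evalNat η ξ B) {v} =
      poissonMeasure (volume B).toNNReal {v.1} * sumLaw μ v.1 {v.2} := by
  rw [Measure.map_apply (measurable_evalNat hη hξ hB) (measurableSet_singleton _)]
  have h := prob_counts_eq hη hξ (ι := Unit) (B := fun _ => B) (fun _ => hB)
    (fun i j hij => absurd (Subsingleton.elim i j) hij) (fun _ => v.1) (fun _ => v.2)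
  simp only [forall_const, Finset.univ_unique, Finset.prod_const, Finset.card_singleton,
    pow_one] at h
  rw [prob_count_eq hη hB hbd.measure_lt_top] at h
  rw [← h]
  refine measure_congr ?_
  filter_upwards [evalPair_ae_eq hη hξ hB hbd] with ω hω
  have h1 : η ω B = ((evalNat η ξ B ω).1 : ℝ≥0∞) := (congrArg Prod.fst hω).symm
  have h2 : ξ ω B = ((evalNat η ξ B ω).2 : ℝ≥0∞) := (congrArg Prod.snd hω).symm
  refine propext ?_
  change evalNat η ξ B ω = v ↔ η ω B = v.1 ∧ ξ ω B = v.2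
  rw [h1, h2, Prod.ext_iff]
  simp

lemma map_evalNat_pi {ι : Type*} [Fintype ι] {B : ι → Set ℝ} (hB : ∀ i, MeasurableSet (B i))
    (hbd : ∀ i, Bornology.IsBounded (B i)) (hd : Pairwise fun i j => Disjoint (B i) (B j)) :
    P.map (fun ω i => evalNat η ξ (B i) ω) = Measure.pi fun i => P.map (evalNat η ξ (B i)) := by
  have hp : ∀ i, IsProbabilityMeasure (P.map (evalNat η ξ (B i))) := fun i =>
    Measure.isProbabilityMeasure_map (measurable_evalNat hη hξ (hB i)).aemeasurable
  refine Measure.ext_of_singleton fun v => ?_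
  rw [Measure.pi_singleton, Measure.map_apply
    (measurable_pi_lambda _ fun i => measurable_evalNat hη hξ (hB i)) (measurableSet_singleton _)]
  have h := prob_counts_eq hη hξ hB hd (fun i => (v i).1) (fun i => (v i).2)
  have h0 : P {ω | ∀ i, η ω (B i) = (v i).1} =
      ∏ i, poissonMeasure (volume (B i)).toNNReal {(v i).1} := by
    have hind := (hη.iIndepFun hB hd).measure_inter_preimage_eq_mul Finset.univ
      (sets := fun i => {((v i).1 : ℝ≥0∞)}) fun _ _ => measurableSet_singleton _
    have e : (⋂ i ∈ Finset.univ, (fun ω => η ω (B i)) ⁻¹' {((v i).1 : ℝ≥0∞)}) =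
        {ω | ∀ i, η ω (B i) = (v i).1} := by
      ext ω; simp
    rw [e] at hind
    rw [hind]
    refine Finset.prod_congr rfl fun i _ => ?_
    exact prob_count_eq hη (hB i) (hbd i).measure_lt_top _
  rw [h0, ← Finset.prod_mul_distrib] at h
  simp only [map_evalNat_singleton hη hξ (hB _) (hbd _)]
  rw [← h]
  refine measure_congr ?_
  filter_upwards [ae_all_iff.2 fun i => evalPair_ae_eq hη hξ (hB i) (hbd i)] with ω hω
  refine propext ?_
  change (fun i => evalNat η ξ (B i) ω) = v ↔ ∀ i, η ω (B i) = (v i).1 ∧ ξ ω (B i) = (v i).2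
  rw [funext_iff]
  refine forall_congr' fun i => ?_
  have h1 : η ω (B i) = ((evalNat η ξ (B i) ω).1 : ℝ≥0∞) := (congrArg Prod.fst (hω i)).symm
  have h2 : ξ ω (B i) = ((evalNat η ξ (B i) ω).2 : ℝ≥0∞) := (congrArg Prod.snd (hω i)).symm
  rw [h1, h2, Prod.ext_iff]
  simp

/-- The numbers of points and total degrees in disjoint bounded sets are independent. -/
lemma iIndepFun_evalPair {ι : Type*} [Fintype ι] {B : ι → Set ℝ} (hB : ∀ i, MeasurableSet (B i))
    (hbd : ∀ i, Bornology.IsBounded (B i)) (hd : Pairwise fun i j => Disjoint (B i) (B j)) :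
    iIndepFun (fun i => evalPair η ξ (B i)) P := by
  have h := (iIndepFun_iff_map_fun_eq_pi_map
    fun i => (measurable_evalNat hη hξ (hB i)).aemeasurable).2 (map_evalNat_pi hη hξ hB hbd hd)
  have h2 := h.comp (fun _ v => ((v.1 : ℝ≥0∞), (v.2 : ℝ≥0∞)))
    fun _ => measurable_of_countable _
  exact h2.congr fun i => evalPair_ae_eq hη hξ (hB i) (hbd i)

/-- The joint law of the numbers of points and total degrees in disjoint bounded sets only depends
on their lengths. -/
lemma map_evalPair_congr {ι : Type*} [Fintype ι] {B B' : ι → Set ℝ}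
    (hB : ∀ i, MeasurableSet (B i)) (hbd : ∀ i, Bornology.IsBounded (B i))
    (hd : Pairwise fun i j => Disjoint (B i) (B j))
    (hB' : ∀ i, MeasurableSet (B' i)) (hbd' : ∀ i, Bornology.IsBounded (B' i))
    (hd' : Pairwise fun i j => Disjoint (B' i) (B' j))
    (hvol : ∀ i, volume (B i) = volume (B' i)) :
    P.map (fun ω i => evalPair η ξ (B i) ω) = P.map (fun ω i => evalPair η ξ (B' i) ω) := by
  have h1 := (iIndepFun_iff_map_fun_eq_pi_map fun i =>
    (measurable_evalPair hη hξ (hB i)).aemeasurable).1 (iIndepFun_evalPair hη hξ hB hbd hd)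
  have h2 := (iIndepFun_iff_map_fun_eq_pi_map fun i =>
    (measurable_evalPair hη hξ (hB' i)).aemeasurable).1 (iIndepFun_evalPair hη hξ hB' hbd' hd')
  rw [h1, h2]
  congr 1
  funext i
  have hcast : Measurable fun v : ℕ × ℕ => ((v.1 : ℝ≥0∞), (v.2 : ℝ≥0∞)) :=
    measurable_of_countable _
  rw [← Measure.map_congr (evalPair_ae_eq hη hξ (hB i) (hbd i)),
    ← Measure.map_congr (evalPair_ae_eq hη hξ (hB' i) (hbd' i))]
  have e : ∀ B : Set ℝ, (fun ω => (((evalNat η ξ B ω).1 : ℝ≥0∞), ((evalNat η ξ B ω).2 : ℝ≥0∞))) =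
      (fun v : ℕ × ℕ => ((v.1 : ℝ≥0∞), (v.2 : ℝ≥0∞))) ∘ evalNat η ξ B := fun _ => rfl
  rw [e, e, ← Measure.map_map hcast (measurable_evalNat hη hξ (hB i)),
    ← Measure.map_map hcast (measurable_evalNat hη hξ (hB' i))]
  congr 1
  refine Measure.ext_of_singleton fun v => ?_
  rw [map_evalNat_singleton hη hξ (hB i) (hbd i), map_evalNat_singleton hη hξ (hB' i) (hbd' i),
    hvol i]

end Marked

/-! ### The law of the marked configuration: invariance and independence -/

namespace Config

/-- The number of points and the total degree in a set. -/
def eval (B : Set ℝ) (c : Config) : ℝ≥0∞ × ℝ≥0∞ := (c.pt B, c.mk B)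

lemma measurable_eval {B : Set ℝ} (hB : MeasurableSet B) : Measurable (eval B) :=
  ((Measure.measurable_coe hB).comp measurable_pt).prodMk
    ((Measure.measurable_coe hB).comp measurable_mk)

/-- The bounded Borel sets. -/
abbrev Window : Type := {B : Set ℝ // MeasurableSet B ∧ Bornology.IsBounded B}

/-- The evaluations on all bounded Borel sets. -/
def evalAll (c : Config) (B : Window) : ℝ≥0∞ × ℝ≥0∞ := c.eval B

lemma measurable_evalAll : Measurable evalAll :=
  measurable_pi_lambda _ fun B => measurable_eval B.2.1

lemma measure_eq_iSup (ν : Measure ℝ) (B : Set ℝ) : ν B = ⨆ n : ℕ, ν (B ∩ Icc (-n : ℝ) n) := by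
  have hU : (⋃ n : ℕ, Icc (-n : ℝ) n) = univ := by
    refine eq_univ_of_forall fun x => ?_
    obtain ⟨n, hn⟩ := exists_nat_ge |x|
    exact mem_iUnion.2 ⟨n, abs_le.1 hn⟩
  have hmono : Monotone fun n : ℕ => B ∩ Icc (-n : ℝ) n := by
    intro i j hij
    have : (i : ℝ) ≤ j := by exact_mod_cast hij
    exact inter_subset_inter_right _ (Icc_subset_Icc (by linarith) this)
  rw [← hmono.measure_iUnion, ← inter_iUnion, hU, inter_univ]

lemma measurable_of_eval {β : Type*} [MeasurableSpace β] {f : β → Config}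
    (h : ∀ B : Window, Measurable fun b => (f b).eval B) : Measurable f := by
  have hw : ∀ B : Set ℝ, MeasurableSet B → ∀ n : ℕ,
      Measurable fun b => (f b).eval (B ∩ Icc (-n : ℝ) n) := fun B hB n =>
    h ⟨B ∩ Icc (-n : ℝ) n, hB.inter measurableSet_Icc,
      (Metric.isBounded_Icc _ _).subset inter_subset_right⟩
  have h1 : Measurable fun b => (f b).1 := by
    refine Measurable.prodMk (f := fun b => (f b).pt) (g := fun b => (f b).mk) ?_ ?_
    · refine Measure.measurable_of_measurable_coe _ fun B hB => ?_
      have e : (fun b => (f b).pt B) = fun b => ⨆ n : ℕ, (f b).pt (B ∩ Icc (-n : ℝ) n) :=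
        funext fun b => measure_eq_iSup _ _
      rw [e]
      exact .iSup fun n => (hw B hB n).fst
    · refine Measure.measurable_of_measurable_coe _ fun B hB => ?_
      have e : (fun b => (f b).mk B) = fun b => ⨆ n : ℕ, (f b).mk (B ∩ Icc (-n : ℝ) n) :=
        funext fun b => measure_eq_iSup _ _
      rw [e]
      exact .iSup fun n => (hw B hB n).snd
  exact h1.subtype_mk

lemma le_comap_evalAll :
    (inferInstance : MeasurableSpace Config) ≤ MeasurableSpace.comap evalAll inferInstance := by
  have h := @measurable_of_eval Config (MeasurableSpace.comap evalAll inferInstance) id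
    fun B => (measurable_pi_apply B).comp (comap_measurable evalAll)
  intro s hs
  exact h hs

/-- The evaluations on bounded Borel sets generate all the information on a configuration. -/
lemma comap_evalAll_comp {β : Type*} (f : β → Config) :
    MeasurableSpace.comap f inferInstance = MeasurableSpace.comap (evalAll ∘ f) inferInstance := by
  rw [← MeasurableSpace.comap_comp]
  congr 1
  exact le_antisymm le_comap_evalAll measurable_evalAll.comap_le

/-- Two laws of configurations agree as soon as their finite-dimensional evaluations do. -/
lemma ext_of_eval {Q Q' : Measure Config} [IsProbabilityMeasure Q] [IsProbabilityMeasure Q']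
    (h : ∀ I : Finset Window, Q.map (fun c (i : I) => c.eval (i : Window)) =
      Q'.map (fun c (i : I) => c.eval (i : Window))) : Q = Q' := by
  have h1 : Q.map evalAll = Q'.map evalAll := by
    have h2 := isProjectiveLimit_map (P := Q) (X := fun (B : Window) c => eval (B : Set ℝ) c)
      measurable_evalAll.aemeasurable
    have h3 := isProjectiveLimit_map (P := Q') (X := fun (B : Window) c => eval (B : Set ℝ) c)
      measurable_evalAll.aemeasurable
    have e : (fun I : Finset Window => Q.map fun c => I.restrict fun B => eval (B : Set ℝ) c) =
        fun I => Q'.map fun c => I.restrict fun B => eval (B : Set ℝ) c := funext h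
    rw [e] at h2
    exact h2.unique h3
  ext s hs
  obtain ⟨t, ht, rfl⟩ := le_comap_evalAll s hs
  rw [← Measure.map_apply measurable_evalAll ht, h1, Measure.map_apply measurable_evalAll ht]

/-- The cells cut out by finitely many sets. -/
def atom {I : Type*} (B : I → Set ℝ) (t : I → Bool) : Set ℝ :=
  {x | (∃ i, x ∈ B i) ∧ ∀ i, x ∈ B i ↔ t i = true}

lemma atom_subset {I : Type*} {B : I → Set ℝ} {t : I → Bool} : atom B t ⊆ ⋃ i, B i :=
  fun _ hx => mem_iUnion.2 hx.1

lemma measurableSet_atom {I : Type*} [Countable I] {B : I → Set ℝ}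
    (hB : ∀ i, MeasurableSet (B i)) (t : I → Bool) : MeasurableSet (atom B t) := by
  have : atom B t = (⋃ i, B i) ∩ ⋂ i, {x | x ∈ B i ↔ t i = true} := by
    ext x; simp [atom]
  rw [this]
  refine (MeasurableSet.iUnion hB).inter (.iInter fun i => ?_)
  cases t i
  · simp only [Bool.false_eq_true, iff_false]
    exact (hB i).compl
  · simp only [iff_true]
    exact hB i

lemma isBounded_atom {I : Type*} [Finite I] {B : I → Set ℝ}
    (hB : ∀ i, Bornology.IsBounded (B i)) (t : I → Bool) : Bornology.IsBounded (atom B t) :=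
  ((Bornology.isBounded_iUnion).2 hB).subset atom_subset

lemma disjoint_atom {I : Type*} (B : I → Set ℝ) :
    Pairwise fun t t' => Disjoint (atom B t) (atom B t') := by
  intro t t' hne
  refine Set.disjoint_left.2 fun x hx hx' => hne (funext fun i => ?_)
  have := (hx.2 i).symm.trans (hx'.2 i)
  cases h : t i <;> cases h' : t' i <;> simp_all

lemma measure_eq_sum_atom {I : Type*} [Fintype I] [DecidableEq I] {B : I → Set ℝ}
    (hB : ∀ i, MeasurableSet (B i)) (ν : Measure ℝ) {J : Set ℝ} (hJ : MeasurableSet J) (i : I) :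
    ν (B i ∩ J) = ∑ t : I → Bool, if t i = true then ν (atom B t ∩ J) else 0 := by
  classical
  have e : B i ∩ J = ⋃ t ∈ Finset.univ.filter fun t : I → Bool => t i = true, atom B t ∩ J := by
    ext x
    simp only [mem_inter_iff, mem_iUnion, Finset.mem_filter, Finset.mem_univ, true_and,
      exists_prop]
    constructor
    · rintro ⟨hx, hxJ⟩
      exact ⟨fun j => decide (x ∈ B j), by simpa using hx, ⟨⟨i, hx⟩, by simp⟩, hxJ⟩
    · rintro ⟨t, ht, hx, hxJ⟩
      exact ⟨(hx.2 i).2 ht, hxJ⟩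
  rw [e, measure_biUnion_finset, Finset.sum_filter]
  · intro t _ t' _ hne
    exact (disjoint_atom B hne).mono inter_subset_left inter_subset_left
  · exact fun t _ => (measurableSet_atom hB t).inter hJ

/-- The configuration formed by two measures, when they are locally finite. -/
def ofPair (p : Measure ℝ × Measure ℝ) : Config :=
  open Classical in
  ⟨if ∀ n : ℕ, p.1 (Icc (-n : ℝ) n) < ⊤ ∧ p.2 (Icc (-n : ℝ) n) < ⊤ then p else 0, by
    split_ifs with h
    · exact h
    · simp⟩

lemma measurable_ofPair : Measurable ofPair := by
  classical
  refine Measurable.subtype_mk (Measurable.ite ?_ measurable_id measurable_const)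
  rw [ofPred_forall]
  refine .iInter fun n => MeasurableSet.inter ?_ ?_
  · exact measurableSet_lt ((Measure.measurable_coe measurableSet_Icc).comp measurable_fst)
      measurable_const
  · exact measurableSet_lt ((Measure.measurable_coe measurableSet_Icc).comp measurable_snd)
      measurable_const

end Config

open Config

section Law

variable {Ω : Type*} [MeasurableSpace Ω] {P : Measure Ω} [IsProbabilityMeasure P]
  {μ : Measure ℕ} [IsProbabilityMeasure μ] {η ξ : Ω → Measure ℝ}

/-- The random marked configuration. -/
def cfg (η ξ : Ω → Measure ℝ) (ω : Ω) : Config := ofPair (η ω, ξ ω)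

variable (hη : IsPoissonProcess P η) (hξ : IsIIDMarking P μ η ξ)
include hη hξ

omit [IsProbabilityMeasure P] [IsProbabilityMeasure μ] in
lemma measurable_cfg : Measurable (cfg η ξ) :=
  measurable_ofPair.comp (hη.measurable.prodMk hξ.isPointProcess.measurable)

omit [IsProbabilityMeasure P] [IsProbabilityMeasure μ] in
lemma cfg_ae_eq : ∀ᵐ ω ∂P, (cfg η ξ ω).pt = η ω ∧ (cfg η ξ ω).mk = ξ ω := by
  filter_upwards [hη.integer_valued, hξ.isPointProcess.integer_valued] with ω h1 h2
  have h : ∀ n : ℕ, η ω (Icc (-n : ℝ) n) < ⊤ ∧ ξ ω (Icc (-n : ℝ) n) < ⊤ := by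
    intro n
    obtain ⟨a, ha⟩ := h1 _ (measurableSet_Icc (a := (-n : ℝ)) (b := n)) (Metric.isBounded_Icc _ _)
    obtain ⟨b, hb⟩ := h2 _ (measurableSet_Icc (a := (-n : ℝ)) (b := n)) (Metric.isBounded_Icc _ _)
    rw [ha, hb]
    exact ⟨ENNReal.natCast_lt_top _, ENNReal.natCast_lt_top _⟩
  simp only [cfg, ofPair, Config.pt, Config.mk]
  rw [if_pos h]
  exact ⟨rfl, rfl⟩

omit [IsProbabilityMeasure P] [IsProbabilityMeasure μ] in
lemma eval_cfg_ae_eq (B : Set ℝ) : (fun ω => (cfg η ξ ω).eval B) =ᵐ[P] evalPair η ξ B := by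
  filter_upwards [cfg_ae_eq hη hξ] with ω hω
  simp [Config.eval, evalPair, hω]

/-- The law of the marked configuration is invariant under isometries of the line. -/
lemma map_map_cfg (φ : ℝ ≃ᵢ ℝ) (hφ : MeasurePreserving φ volume volume) :
    (P.map (cfg η ξ)).map (Config.map φ) = P.map (cfg η ξ) := by
  classical
  have hcm := measurable_cfg hη hξ
  have := Measure.isProbabilityMeasure_map (μ := P) hcm.aemeasurable
  have := Measure.isProbabilityMeasure_map (μ := P.map (cfg η ξ))
    (Config.measurable_map φ).aemeasurable
  have hφm : Measurable φ := φ.continuous.measurable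
  refine ext_of_eval fun I => ?_
  have hm : Measurable fun (c : Config) (i : I) => c.eval (i : Window) :=
    measurable_pi_lambda _ fun i => measurable_eval i.1.2.1
  rw [Measure.map_map hm (Config.measurable_map φ), Measure.map_map
    (hm.comp (Config.measurable_map φ)) hcm, Measure.map_map hm hcm]
  let B : I → Set ℝ := fun i => i.1.1
  have hB : ∀ i, MeasurableSet (B i) := fun i => i.1.2.1
  have hbd : ∀ i, Bornology.IsBounded (B i) := fun i => i.1.2.2
  have hB' : ∀ i, MeasurableSet (φ ⁻¹' B i) := fun i => hφm (hB i)
  have hbd' : ∀ i, Bornology.IsBounded (φ ⁻¹' B i) := fun i =>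
    φ.isometry.antilipschitz.isBounded_preimage (hbd i)
  -- The evaluations on the windows are sums over their atoms, which are disjoint.
  let G : ((I → Bool) → ℝ≥0∞ × ℝ≥0∞) → I → ℝ≥0∞ × ℝ≥0∞ := fun v i =>
    ∑ t : I → Bool, if t i = true then v t else 0
  have hG : Measurable G := by
    refine measurable_pi_lambda _ fun i => Finset.measurable_sum _ fun t _ => ?_
    split_ifs
    · exact measurable_pi_apply t
    · exact measurable_const
  have hsum : ∀ (B : I → Set ℝ), (∀ i, MeasurableSet (B i)) → ∀ ω,
      (fun i => evalPair η ξ (B i) ω) = G fun t => evalPair η ξ (atom B t) ω := by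
    intro B hB ω
    funext i
    have h1 := measure_eq_sum_atom hB (η ω) MeasurableSet.univ i
    have h2 := measure_eq_sum_atom hB (ξ ω) MeasurableSet.univ i
    simp only [inter_univ] at h1 h2
    simp only [G, evalPair]
    refine Prod.ext ?_ ?_
    · rw [h1, Prod.fst_sum]
      refine Finset.sum_congr rfl fun t _ => ?_
      split_ifs <;> rfl
    · rw [h2, Prod.snd_sum]
      refine Finset.sum_congr rfl fun t _ => ?_
      split_ifs <;> rfl
  have e1 : ((fun (c : Config) (i : I) => c.eval (i : Window)) ∘ cfg η ξ) =ᵐ[P]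
      fun ω i => evalPair η ξ (B i) ω := by
    filter_upwards [ae_all_iff.2 fun i : I => eval_cfg_ae_eq hη hξ (B i)] with ω hω
    funext i
    exact hω i
  have e2 : (((fun (c : Config) (i : I) => c.eval (i : Window)) ∘ Config.map φ) ∘ cfg η ξ) =ᵐ[P]
      fun ω i => evalPair η ξ (φ ⁻¹' B i) ω := by
    filter_upwards [ae_all_iff.2 fun i : I => eval_cfg_ae_eq hη hξ (φ ⁻¹' B i)] with ω hω
    funext i
    rw [← hω i]
    exact Prod.ext (pt_map φ _ _) (mk_map φ _ _)
  have f1 : (fun ω i => evalPair η ξ (B i) ω) = G ∘ fun ω t => evalPair η ξ (atom B t) ω :=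
    funext (hsum B hB)
  have f2 : (fun ω i => evalPair η ξ (φ ⁻¹' B i) ω) =
      G ∘ fun ω t => evalPair η ξ (atom (fun i => φ ⁻¹' B i) t) ω := funext (hsum _ hB')
  rw [Measure.map_congr e1, Measure.map_congr e2, f1, f2]
  have hma : ∀ (B : I → Set ℝ), (∀ i, MeasurableSet (B i)) →
      Measurable fun ω t => evalPair η ξ (atom B t) ω := fun B hB =>
    measurable_pi_lambda _ fun t => measurable_evalPair hη hξ (measurableSet_atom hB t)
  have := map_evalPair_congr hη hξ (fun t => measurableSet_atom hB' t) (isBounded_atom hbd')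
    (disjoint_atom _) (fun t => measurableSet_atom hB t) (isBounded_atom hbd) (disjoint_atom _)
    (fun t => by
      have : atom (fun i => φ ⁻¹' B i) t = φ ⁻¹' atom B t := rfl
      rw [this, hφ.measure_preimage (measurableSet_atom hB t).nullMeasurableSet])
  have h3 := congrArg (Measure.map G) this
  rw [Measure.map_map hG (hma _ hB'), Measure.map_map hG (hma _ hB)] at h3
  exact h3

lemma iIndepFun_eval {ι : Type*} [Fintype ι] {B : ι → Set ℝ} (hB : ∀ i, MeasurableSet (B i))
    (hbd : ∀ i, Bornology.IsBounded (B i)) (hd : Pairwise fun i j => Disjoint (B i) (B j)) :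
    iIndepFun (fun i => Config.eval (B i)) (P.map (cfg η ξ)) := by
  have hcm := measurable_cfg hη hξ
  have := Measure.isProbabilityMeasure_map (μ := P) hcm.aemeasurable
  have h := (iIndepFun_iff_map_fun_eq_pi_map
    fun i => (measurable_evalPair hη hξ (hB i)).aemeasurable).1
      (iIndepFun_evalPair hη hξ hB hbd hd)
  rw [iIndepFun_iff_map_fun_eq_pi_map fun i => (measurable_eval (hB i)).aemeasurable]
  have h1 : (P.map (cfg η ξ)).map (fun c i => Config.eval (B i) c) =
      P.map (fun ω i => evalPair η ξ (B i) ω) := by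
    rw [Measure.map_map (measurable_pi_lambda _ fun i => measurable_eval (hB i)) hcm]
    refine Measure.map_congr ?_
    filter_upwards [ae_all_iff.2 fun i => eval_cfg_ae_eq hη hξ (B i)] with ω hω
    funext i
    exact hω i
  have h2 : ∀ i, (P.map (cfg η ξ)).map (Config.eval (B i)) = P.map (evalPair η ξ (B i)) := by
    intro i
    rw [Measure.map_map (measurable_eval (hB i)) hcm]
    exact Measure.map_congr (eval_cfg_ae_eq hη hξ (B i))
  rw [h1, h]
  simp only [h2]

/-- The restrictions of the configuration to a set and to its complement are independent. -/
lemma indepFun_restrict {J : Set ℝ} (hJ : MeasurableSet J) :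
    IndepFun (Config.restrict J) (Config.restrict Jᶜ) (P.map (cfg η ξ)) := by
  classical
  have hcm := measurable_cfg hη hξ
  have := Measure.isProbabilityMeasure_map (μ := P) hcm.aemeasurable
  have key : IndepFun (fun c (B : Window) => eval (B : Set ℝ) (restrict J c))
      (fun c (B : Window) => eval (B : Set ℝ) (restrict Jᶜ c)) (P.map (cfg η ξ)) := by
    refine IndepFun.process_indepFun_process
      (fun B => (measurable_eval B.2.1).comp (measurable_restrict hJ))
      (fun B => (measurable_eval B.2.1).comp (measurable_restrict hJ.compl)) fun I I' => ?_
    -- Cut the atoms of all the windows along `J`: the pieces inside and outside `J` are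
    -- independent, and the two tuples of evaluations are functions of these two groups.
    let K := I ∪ I'
    let B : K → Set ℝ := fun i => i.1.1
    have hB : ∀ i, MeasurableSet (B i) := fun i => i.1.2.1
    have hbd : ∀ i, Bornology.IsBounded (B i) := fun i => i.1.2.2
    let side : Bool → Set ℝ := fun b => if b then J else Jᶜ
    have hside : ∀ b, MeasurableSet (side b) := by
      intro b
      cases b
      · simpa [side] using hJ.compl
      · simpa [side] using hJ
    let A : (K → Bool) × Bool → Set ℝ := fun p => atom B p.1 ∩ side p.2
    have hind := iIndepFun_eval hη hξ (B := A)
      (fun p => (measurableSet_atom hB p.1).inter (hside p.2))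
      (fun p => (isBounded_atom hbd p.1).subset inter_subset_left) (by
        rintro ⟨t, b⟩ ⟨t', b'⟩ hne
        by_cases ht : t = t'
        · subst ht
          have hb : b ≠ b' := fun h => hne (by rw [h])
          refine Disjoint.mono inter_subset_right inter_subset_right ?_
          cases b <;> cases b' <;> simp_all [side, disjoint_compl_left, disjoint_compl_right]
        · exact (disjoint_atom B ht).mono inter_subset_left inter_subset_left)
    have hfin := hind.indepFun_finset (Finset.univ.filter fun p => p.2 = true)
      (Finset.univ.filter fun p => p.2 = false)
      (by
        rw [Finset.disjoint_left]
        intro p hp hp'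
        simp only [Finset.mem_filter, Finset.mem_univ, true_and] at hp hp'
        rw [hp] at hp'
        exact absurd hp' (by decide))
      (fun p => measurable_eval ((measurableSet_atom hB p.1).inter (hside p.2)))
    let G : ∀ b : Bool, ({p // p ∈ Finset.univ.filter fun p : (K → Bool) × Bool => p.2 = b} →
        ℝ≥0∞ × ℝ≥0∞) → K → ℝ≥0∞ × ℝ≥0∞ := fun b v i =>
      ∑ t : K → Bool, if t i = true then v ⟨(t, b), by simp⟩ else 0
    have hG : ∀ b, Measurable (G b) := by
      refine fun b => measurable_pi_lambda _ fun i => Finset.measurable_sum _ fun t _ => ?_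
      split_ifs
      · exact measurable_pi_apply _
      · exact measurable_const
    have hsum : ∀ b (i : K) c, eval (B i ∩ side b) c =
        G b (fun p => eval (A p.1) c) i := by
      intro b i c
      simp only [G]
      refine Prod.ext ?_ ?_
      · rw [Prod.fst_sum]
        refine (measure_eq_sum_atom hB c.pt (hside b) i).trans ?_
        refine Finset.sum_congr rfl fun t _ => ?_
        split_ifs <;> rfl
      · rw [Prod.snd_sum]
        refine (measure_eq_sum_atom hB c.mk (hside b) i).trans ?_
        refine Finset.sum_congr rfl fun t _ => ?_
        split_ifs <;> rfl
    have hr : ∀ b (i : K) c, eval (B i) (restrict (side b) c) = eval (B i ∩ side b) c :=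
      fun b i c => Prod.ext (Measure.restrict_apply (hB i)) (Measure.restrict_apply (hB i))
    let pr : (K → ℝ≥0∞ × ℝ≥0∞) → I → ℝ≥0∞ × ℝ≥0∞ := fun v i =>
      v ⟨i.1, Finset.mem_union_left _ i.2⟩
    let pr' : (K → ℝ≥0∞ × ℝ≥0∞) → I' → ℝ≥0∞ × ℝ≥0∞ := fun v i =>
      v ⟨i.1, Finset.mem_union_right _ i.2⟩
    have hpr : Measurable pr := measurable_pi_lambda _ fun i => measurable_pi_apply _
    have hpr' : Measurable pr' := measurable_pi_lambda _ fun i => measurable_pi_apply _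
    have h := hfin.comp (hpr.comp (hG true)) (hpr'.comp (hG false))
    have e1 : (fun c (i : I) => eval ((i : Window) : Set ℝ) (restrict J c)) =
        (pr ∘ G true) ∘ fun c p => eval (A p.1) c := by
      funext c i
      have := (hr true ⟨i.1, Finset.mem_union_left _ i.2⟩ c).trans (hsum true _ c)
      simpa [side, B] using this
    have e2 : (fun c (i : I') => eval ((i : Window) : Set ℝ) (restrict Jᶜ c)) =
        (pr' ∘ G false) ∘ fun c p => eval (A p.1) c := by
      funext c i
      have := (hr false ⟨i.1, Finset.mem_union_right _ i.2⟩ c).trans (hsum false _ c)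
      simpa [side, B] using this
    rw [e1, e2]
    exact h
  rw [IndepFun_iff_Indep] at key ⊢
  rw [comap_evalAll_comp, comap_evalAll_comp (restrict Jᶜ)]
  exact key

omit [IsProbabilityMeasure P] [IsProbabilityMeasure μ] in
/-- A bounded window contains no point with positive probability. -/
lemma void_ne_zero {J : Set ℝ} (hJ : MeasurableSet J) (hbd : Bornology.IsBounded J) :
    P.map (cfg η ξ) {c | c.eval J = 0} ≠ 0 := by
  have hm : MeasurableSet {c : Config | c.eval J = 0} :=
    measurable_eval hJ (measurableSet_singleton _)
  rw [Measure.map_apply (measurable_cfg hη hξ) hm]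
  have : P (cfg η ξ ⁻¹' {c | c.eval J = 0}) = P {ω | η ω J = 0} := by
    refine measure_congr ?_
    filter_upwards [cfg_ae_eq hη hξ, hξ.same_support, hξ.isPointProcess.integer_valued]
      with ω hω hsup hint
    refine propext ?_
    change ((cfg η ξ ω).pt J, (cfg η ξ ω).mk J) = (0, 0) ↔ η ω J = 0
    rw [hω.1, hω.2, Prod.mk.injEq, and_iff_left_iff_imp]
    -- The measure of the degrees is carried by its atoms, which are points of the process.
    intro h0
    refine measure_mono_null ?_ (ae_singleton_ne_zero hint)
    intro x hx hne
    have hx' : x ∈ pts (η ω) := hsup ▸ pos_iff_ne_zero.2 hne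
    exact (show 0 < η ω {x} from hx').ne' (measure_mono_null (singleton_subset_iff.2 hx) h0)
  rw [this, prob_void hη hJ hbd.measure_lt_top]
  simp [Real.exp_pos]

omit [IsProbabilityMeasure P] [IsProbabilityMeasure μ] in
lemma lintegral_pt_lt_top {J : Set ℝ} (hJ : MeasurableSet J) (hbd : Bornology.IsBounded J) :
    ∫⁻ c, c.pt J ∂(P.map (cfg η ξ)) < ⊤ := by
  rw [lintegral_map (f := fun c => c.pt J)
    ((Measure.measurable_coe hJ).comp Config.measurable_pt) (measurable_cfg hη hξ)]
  rw [lintegral_congr_ae ((cfg_ae_eq hη hξ).mono fun ω hω => by rw [hω.1])]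
  exact lintegral_count_lt_top hη hJ hbd.measure_lt_top

end Law

/-! ### The stable multi-matching as a function of the configuration -/

namespace Config

section Measurability

variable {β : Type*} [MeasurableSpace β] {f : β → Config} (hf : Measurable f)
include hf

lemma measurableSet_mem_points {g : β → ℝ} (hg : Measurable g) :
    MeasurableSet {b | g b ∈ (f b).points} :=
  (measurableSet_eq_fun (measurable_pt_singleton hf hg) measurable_const).compl

lemma measurableSet_exists_points {p : β → ℝ → Prop}
    (hp : MeasurableSet {q : β × ℝ | p q.1 q.2}) :
    MeasurableSet {b | ∃ z ∈ (f b).points, p b z} := by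
  have : {b | ∃ z ∈ (f b).points, p b z} =
      {b | (f b).pt {z | z ∈ (f b).points ∧ p b z} = 0}ᶜ := by
    ext b
    exact exists_iff_pt_ne_zero fun z hz => hz.1
  rw [this]
  refine (measurableSet_eq_fun (measurable_pt_section hf (.inter ?_ hp)) measurable_const).compl
  exact measurableSet_mem_points (hf.comp measurable_fst) measurable_snd

lemma measurableSet_forall_points {p : β → ℝ → Prop}
    (hp : MeasurableSet {q : β × ℝ | p q.1 q.2}) :
    MeasurableSet {b | ∀ z ∈ (f b).points, p b z} := by
  have : {b | ∀ z ∈ (f b).points, p b z} = {b | ∃ z ∈ (f b).points, ¬ p b z}ᶜ := by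
    ext b; simp
  rw [this]
  exact (measurableSet_exists_points hf hp.compl).compl

end Measurability

/-- The almost sure properties of a configuration: it is nondegenerate, every point has a positive
prescribed degree, and the construction `link` yields a stable multi-matching with these
degrees. -/
structure Good (c : Config) : Prop extends Nice c where
  nonempty : ∃ x ∈ c.points, True
  mk_ne_zero : ∀ x ∈ c.points, c.mk {x} ≠ 0
  degree : ∀ x ∈ c.points, c.pt {z | link c x z} = c.mk {x}
  stable : ∀ x ∈ c.points, ∀ y ∈ c.points, x ≠ y → link c x y ∨
    (∀ z ∈ c.points, link c x z → dist x z ≤ dist x y) ∨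
      (∀ z ∈ c.points, link c y z → dist y z ≤ dist x y)

lemma gapR_iff (c : Config) : (∀ r a : ℝ, ∃ b ≥ a, ∀ x ∈ c.points, ¬ (b ≤ x ∧ x ≤ b + r)) ↔
    ∀ n m : ℕ, ∃ k : ℕ, m ≤ k ∧ ∀ x ∈ c.points, ¬ ((k : ℝ) ≤ x ∧ x ≤ k + n) := by
  constructor
  · intro h n m
    obtain ⟨b, hb, hg⟩ := h (n + 1) m
    have hb0 : (0 : ℝ) ≤ b := le_trans (Nat.cast_nonneg m) hb
    have h1 := Nat.le_ceil b
    have h2 := Nat.ceil_lt_add_one hb0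
    refine ⟨⌈b⌉₊, by exact_mod_cast hb.le.trans h1, fun x hx hx' => hg x hx ⟨?_, ?_⟩⟩ <;> linarith
  · intro h r a
    obtain ⟨n, hn⟩ := exists_nat_ge r
    obtain ⟨m, hm⟩ := exists_nat_ge a
    obtain ⟨k, hk, hg⟩ := h n m
    have : (m : ℝ) ≤ k := by exact_mod_cast hk
    exact ⟨k, hm.trans this, fun x hx hx' => hg x hx ⟨hx'.1, by linarith⟩⟩

lemma gapL_iff (c : Config) : (∀ r a : ℝ, ∃ b ≤ a, ∀ x ∈ c.points, ¬ (b - r ≤ x ∧ x ≤ b)) ↔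
    ∀ n m : ℕ, ∃ k : ℕ, m ≤ k ∧ ∀ x ∈ c.points, ¬ (-(k : ℝ) - n ≤ x ∧ x ≤ -k) := by
  constructor
  · intro h n m
    obtain ⟨b, hb, hg⟩ := h (n + 1) (-m)
    have hb0 : (0 : ℝ) ≤ -b := by
      have := Nat.cast_nonneg (α := ℝ) m
      linarith
    have h1 := Nat.le_ceil (-b)
    have h2 := Nat.ceil_lt_add_one hb0
    have h3 : (m : ℝ) ≤ ⌈-b⌉₊ := by linarith
    refine ⟨⌈-b⌉₊, by exact_mod_cast h3, fun x hx hx' => hg x hx ⟨?_, ?_⟩⟩ <;> linarith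
  · intro h r a
    obtain ⟨n, hn⟩ := exists_nat_ge r
    obtain ⟨m, hm⟩ := exists_nat_ge (-a)
    obtain ⟨k, hk, hg⟩ := h n m
    have : (m : ℝ) ≤ k := by exact_mod_cast hk
    exact ⟨-k, by linarith, fun x hx hx' => hg x hx ⟨by linarith, hx'.2⟩⟩

lemma measurableSet_gap (g h : ℝ) :
    MeasurableSet {c : Config | ∀ x ∈ c.points, ¬ (g ≤ x ∧ x ≤ h)} := by
  refine measurableSet_forall_points measurable_id (p := fun _ x => ¬ (g ≤ x ∧ x ≤ h)) ?_
  exact ((measurableSet_le measurable_const measurable_snd).inter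
    (measurableSet_le measurable_snd measurable_const)).compl

lemma measurableSet_good : MeasurableSet {c : Config | Good c} := by
  have e : {c : Config | Good c} =
      {c | c.pt {x | ¬ c.pt {x} = 1} = 0} ∩
      ({c | ∀ x ∈ c.points, ∀ y ∈ c.points, ∀ z ∈ c.points, x ≠ y → dist x y = dist x z → y = z} ∩
      ({c | ∀ n m : ℕ, ∃ k : ℕ, m ≤ k ∧ ∀ x ∈ c.points, ¬ ((k : ℝ) ≤ x ∧ x ≤ k + n)} ∩
      ({c | ∀ n m : ℕ, ∃ k : ℕ, m ≤ k ∧ ∀ x ∈ c.points, ¬ (-(k : ℝ) - n ≤ x ∧ x ≤ -k)} ∩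
      ({c | ∃ x ∈ c.points, True} ∩ ({c | ∀ x ∈ c.points, c.mk {x} ≠ 0} ∩
      ({c | ∀ x ∈ c.points, c.pt {z | link c x z} = c.mk {x}} ∩
      {c | ∀ x ∈ c.points, ∀ y ∈ c.points, x ≠ y → link c x y ∨
        (∀ z ∈ c.points, link c x z → dist x z ≤ dist x y) ∨
          (∀ z ∈ c.points, link c y z → dist y z ≤ dist x y)})))))) := by
    ext c
    simp only [mem_inter_iff, mem_ofPred_eq]
    rw [← gapR_iff, ← gapL_iff]
    constructor
    · rintro ⟨⟨h1, h2, h3, h4⟩, h5, h6, h7, h8⟩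
      exact ⟨h1, h2, h3, h4, h5, h6, h7, h8⟩
    · rintro ⟨h1, h2, h3, h4, h5, h6, h7, h8⟩
      exact ⟨⟨h1, h2, h3, h4⟩, h5, h6, h7, h8⟩
  rw [e]
  refine .inter ?_ (.inter ?_ (.inter ?_ (.inter ?_ (.inter ?_ (.inter ?_ (.inter ?_ ?_))))))
  · refine measurableSet_eq_fun (measurable_pt_section measurable_id ?_) measurable_const
    exact (measurableSet_eq_fun (measurable_pt_singleton measurable_fst measurable_snd)
      measurable_const).compl
  · refine measurableSet_forall_points measurable_id (measurableSet_forall_points measurable_fst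
      (measurableSet_forall_points measurable_fst.fst ?_))
    refine MeasurableSet.imp ?_ (MeasurableSet.imp ?_ ?_)
    · exact (measurableSet_eq_fun (f := fun r : ((Config × ℝ) × ℝ) × ℝ => r.1.1.2)
        (g := fun r => r.1.2) (by fun_prop) (by fun_prop)).compl
    · exact measurableSet_eq_fun (f := fun r : ((Config × ℝ) × ℝ) × ℝ => dist r.1.1.2 r.1.2)
        (g := fun r => dist r.1.1.2 r.2) (by fun_prop) (by fun_prop)
    · exact measurableSet_eq_fun (f := fun r : ((Config × ℝ) × ℝ) × ℝ => r.1.2)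
        (g := fun r => r.2) (by fun_prop) (by fun_prop)
  · simp only [ofPred_forall, ofPred_exists]
    refine .iInter fun n => .iInter fun m => .iUnion fun k => ?_
    exact (MeasurableSet.const _).inter (measurableSet_gap _ _)
  · simp only [ofPred_forall, ofPred_exists]
    refine .iInter fun n => .iInter fun m => .iUnion fun k => ?_
    exact (MeasurableSet.const _).inter (measurableSet_gap _ _)
  · exact measurableSet_exists_points measurable_id (p := fun _ _ => True) (MeasurableSet.const _)
  · refine measurableSet_forall_points measurable_id ?_
    exact (measurableSet_eq_fun (measurable_mk_singleton measurable_fst measurable_snd)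
      measurable_const).compl
  · refine measurableSet_forall_points measurable_id ?_
    refine measurableSet_eq_fun (measurable_pt_section measurable_fst ?_)
      (measurable_mk_singleton measurable_fst measurable_snd)
    exact measurableSet_link_comp (by fun_prop) (by fun_prop) (by fun_prop)
  · refine measurableSet_forall_points measurable_id (measurableSet_forall_points measurable_fst ?_)
    refine MeasurableSet.imp ?_ (.union ?_ (.union ?_ ?_))
    · exact (measurableSet_eq_fun (f := fun r : (Config × ℝ) × ℝ => r.1.2)
        (g := fun r => r.2) (by fun_prop) (by fun_prop)).compl
    · exact measurableSet_link_comp (by fun_prop) (by fun_prop) (by fun_prop)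
    · refine measurableSet_forall_points measurable_fst.fst (.imp ?_ ?_)
      · exact measurableSet_link_comp (by fun_prop) (by fun_prop) (by fun_prop)
      · exact measurableSet_le (f := fun r : ((Config × ℝ) × ℝ) × ℝ => dist r.1.1.2 r.2)
          (g := fun r => dist r.1.1.2 r.1.2) (by fun_prop) (by fun_prop)
    · refine measurableSet_forall_points measurable_fst.fst (.imp ?_ ?_)
      · exact measurableSet_link_comp (by fun_prop) (by fun_prop) (by fun_prop)
      · exact measurableSet_le (f := fun r : ((Config × ℝ) × ℝ) × ℝ => dist r.1.2 r.2)
          (g := fun r => dist r.1.1.2 r.1.2) (by fun_prop) (by fun_prop)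

lemma Good.encard_eq {c : Config} (hc : Good c) {x : ℝ} (hx : x ∈ c.points) :
    (({z | link c x z}.encard : ℕ∞) : ℝ≥0∞) = c.mk {x} := by
  have hsub : {z | link c x z} ⊆ c.points := fun z hz => (link_mem hz).2.1
  rw [← hc.degree x hx, pt_eq_encard_of_subset hc.simple hsub]

lemma Good.finite_link {c : Config} (hc : Good c) (x : ℝ) : {z | link c x z}.Finite := by
  by_cases hx : x ∈ c.points
  · rw [← Set.encard_lt_top_iff]
    have h := hc.encard_eq hx
    by_contra htop
    rw [not_lt, top_le_iff] at htop
    rw [htop] at h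
    exact (c.mk_lt_top Bornology.isBounded_singleton).ne h.symm
  · have : {z | link c x z} = ∅ := by
      ext z
      simp only [mem_ofPred_eq, mem_empty_iff_false, iff_false]
      exact fun h => hx (link_mem h).1
    rw [this]
    exact finite_empty

lemma Good.exists_link {c : Config} (hc : Good c) {x : ℝ} (hx : x ∈ c.points) :
    ∃ z, link c x z := by
  by_contra! hne
  refine hc.mk_ne_zero x hx ?_
  rw [← hc.degree x hx]
  simp [hne]

lemma Good.isStableGraph {c : Config} (hc : Good c) : IsStableGraph c.points (link c) where
  symm _ _ h := link_symm h
  mem x y h := ⟨(link_mem h).1, (link_mem h).2.2⟩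
  locFin _ hA := finite_points_inter hc.simple hA
  stable x hx y hy hxy := by
    rcases hc.stable x hx y hy hxy with h | h | h
    · exact Or.inl h
    · exact Or.inr (Or.inl fun z hz => h z (link_mem hz).2.1 hz)
    · exact Or.inr (Or.inr fun z hz => h z (link_mem hz).2.1 hz)

end Config

open Config

/-- The law of a marked configuration on which `link` is a stable multi-matching: it is invariant
under isometries, its restrictions to complementary sets are independent, and bounded windows have
finite mean numbers of points and may be empty. -/
structure IsMatchingLaw (Q : Measure Config) : Prop where
  invariant : ∀ φ : ℝ ≃ᵢ ℝ, MeasurePreserving φ volume volume → Q.map (Config.map φ) = Q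
  indep : ∀ J : Set ℝ, MeasurableSet J → IndepFun (Config.restrict J) (Config.restrict Jᶜ) Q
  void : ∀ J : Set ℝ, MeasurableSet J → Bornology.IsBounded J → Q {c | c.eval J = 0} ≠ 0
  mean : ∀ J : Set ℝ, MeasurableSet J → Bornology.IsBounded J → ∫⁻ c, c.pt J ∂Q < ⊤
  good : ∀ᵐ c ∂Q, Good c

lemma IsStableMultiMatching.isPartialStable {c : Config} {E : Set (Sym2 ℝ)}
    (h : IsStableMultiMatching c.pt c.mk E) : c.IsPartialStable fun x y => s(x, y) ∈ E where
  symm x y hxy := by rwa [Sym2.eq_swap]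
  mem x y hxy := ⟨by rw [points_eq]; exact (h.mem_pts x y hxy).1, h.ne x y hxy⟩
  deg_le x hx := by
    rw [points_eq] at hx
    exact (h.degree x hx).le
  stable x hx y hy hxy := by
    rw [points_eq] at hx hy
    rcases h.stable x hx y hy hxy with h1 | h1 | h1
    · exact Or.inl h1
    · exact Or.inr (Or.inl ⟨h.degree x hx, h1⟩)
    · exact Or.inr (Or.inr ⟨h.degree y hy, h1⟩)

section Law

variable {Ω : Type*} [MeasurableSpace Ω] {P : Measure Ω} [IsProbabilityMeasure P]
  {μ : Measure ℕ} [IsProbabilityMeasure μ] {η ξ : Ω → Measure ℝ} {E : Ω → Set (Sym2 ℝ)}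
  (hη : IsPoissonProcess P η) (hξ : IsIIDMarking P μ η ξ)
  (hE : ∀ᵐ ω ∂P, IsStableMultiMatching (η ω) (ξ ω) (E ω))
include hη hξ hE

omit [IsProbabilityMeasure μ] in
/-- Any stable multi-matching is given by `link`. -/
lemma ae_good_cfg : ∀ᵐ ω ∂P, Good (cfg η ξ ω) ∧
    ∀ x y, s(x, y) ∈ E ω ↔ link (cfg η ξ ω) x y := by
  obtain ⟨X, -, hX, -⟩ := hξ.iid_marks
  filter_upwards [cfg_ae_eq hη hξ, hE, ae_simple hη, ae_noMid hη, ae_gapR hη, ae_gapL hη,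
    hξ.same_support, hX] with ω hω hEω h1 h2 h3 h4 h5 hXω
  obtain ⟨hp, hm⟩ := hω
  rw [← hp] at h1 h2 h3 h4 h5 hEω
  rw [← hm] at h5 hEω
  rw [← points_eq] at h2 h3 h4 h5
  have hnice : Nice (cfg η ξ ω) := ⟨h1, h2, h3, h4⟩
  have hps := hEω.isPartialStable
  have hiff := hps.iff_link hnice
  have hmem : ∀ x, {z | link (cfg η ξ ω) x z} ⊆ (cfg η ξ ω).points :=
    fun x z hz => (link_mem hz).2.1
  refine ⟨⟨hnice, ⟨X 0 (η ω), ?_, trivial⟩, ?_, ?_, ?_⟩, hiff⟩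
  · rw [points_eq, hp, ← hXω.2]
    exact mem_range_self 0
  · intro x hx
    rw [← h5] at hx
    exact (show 0 < (cfg η ξ ω).mk {x} from hx).ne'
  · intro x hx
    rw [pt_eq_encard_of_subset h1 (hmem x)]
    rw [points_eq] at hx
    simp only [← hiff]
    exact hEω.degree x hx
  · intro x hx y hy hxy
    rw [points_eq] at hx hy
    simp only [← hiff]
    rcases hEω.stable x hx y hy hxy with h | h | h
    · exact Or.inl h
    · exact Or.inr (Or.inl fun z _ => h z)
    · exact Or.inr (Or.inr fun z _ => h z)

lemma isMatchingLaw_map_cfg : IsMatchingLaw (P.map (cfg η ξ)) where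
  invariant := map_map_cfg hη hξ
  indep _ hJ := indepFun_restrict hη hξ hJ
  void _ hJ hbd := void_ne_zero hη hξ hJ hbd
  mean _ hJ hbd := lintegral_pt_lt_top hη hξ hJ hbd
  good := by
    rw [ae_map_iff (measurable_cfg hη hξ).aemeasurable measurableSet_good]
    exact (ae_good_cfg hη hξ hE).mono fun ω hω => hω.1

omit hE [IsProbabilityMeasure P] in
lemma ae_mk_le_two (hμ : μ {1, 2} = 1) :
    ∀ᵐ c ∂P.map (cfg η ξ), ∀ x ∈ c.points, c.mk {x} ≤ 2 := by
  rw [ae_map_iff (measurable_cfg hη hξ).aemeasurable]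
  · obtain ⟨X, hXm, hXe, hlaw, -, -⟩ := hξ.iid_marks
    have h1 : ∀ᵐ k ∂μ, k ∈ ({1, 2} : Set ℕ) := (prob_compl_eq_zero_iff (by measurability)).2 hμ
    have h2 : ∀ᵐ ω ∂P, ∀ n, ξ ω {X n (η ω)} ≤ 2 := by
      refine ae_all_iff.2 fun n => ?_
      have h3 : ∀ᵐ v ∂(μ.map fun k : ℕ => (k : ℝ≥0∞)), v ≤ 2 := by
        rw [ae_map_iff (measurable_of_countable _).aemeasurable measurableSet_Iic]
        filter_upwards [h1] with k hk
        rcases hk with rfl | rfl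
        · simp
        · simp
      rw [← (hlaw n).map_eq, ae_map_iff (hlaw n).aemeasurable measurableSet_Iic] at h3
      exact h3
    filter_upwards [cfg_ae_eq hη hξ, hXe, h2] with ω hω hX h2 x hx
    rw [points_eq, hω.1, ← hX.2] at hx
    obtain ⟨n, rfl⟩ := hx
    rw [hω.2]
    exact h2 n
  · refine measurableSet_forall_points measurable_id ?_
    exact measurableSet_le (measurable_mk_singleton measurable_fst measurable_snd)
      measurable_const

end Law

/-! ### Deleting points -/

namespace Config

/-- A finite union of compact intervals with rational endpoints. -/
def boxes (L : Finset (ℚ × ℚ)) : Set ℝ := ⋃ p ∈ L, Icc (p.1 : ℝ) p.2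

lemma measurableSet_boxes (L : Finset (ℚ × ℚ)) : MeasurableSet (boxes L) :=
  L.measurableSet_biUnion fun _ _ => measurableSet_Icc

lemma isBounded_boxes (L : Finset (ℚ × ℚ)) : Bornology.IsBounded (boxes L) :=
  (Bornology.isBounded_biUnion_finset L).2 fun _ _ => Metric.isBounded_Icc _ _

/-- Any finite set of points is isolated from the others by a finite union of rational intervals. -/
lemma exists_boxes {c : Config} (hs : ∀ᵐ x ∂c.pt, c.pt {x} = 1) {F : Set ℝ} (hF : F.Finite)
    (hFc : F ⊆ c.points) : ∃ L, boxes L ∩ c.points = F := by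
  have h1 : ∀ x ∈ F, ∃ p : ℚ × ℚ, Icc (p.1 : ℝ) p.2 ∩ c.points = {x} := by
    intro x hx
    have hfin : ((Icc (x - 1) (x + 1) ∩ c.points) \ {x}).Finite :=
      (finite_points_inter hs (Metric.isBounded_Icc _ _)).sdiff
    have hopen : IsOpen ((Icc (x - 1) (x + 1) ∩ c.points) \ {x})ᶜ := hfin.isClosed.isOpen_compl
    obtain ⟨ε, hε, hball⟩ := Metric.isOpen_iff.1 hopen x (by simp)
    have hδ : 0 < min ε 1 := lt_min hε one_pos
    obtain ⟨p, hp, hp'⟩ := exists_rat_btwn (sub_lt_self x hδ)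
    obtain ⟨q, hq, hq'⟩ := exists_rat_btwn (lt_add_of_pos_right x hδ)
    have hm1 := min_le_left ε 1
    have hm2 := min_le_right ε 1
    refine ⟨(p, q), Subset.antisymm ?_ ?_⟩
    · rintro z ⟨⟨hz1, hz2⟩, hzc⟩
      by_contra hne
      have hzb : z ∈ Metric.ball x ε := by
        rw [Metric.mem_ball, Real.dist_eq, abs_lt]
        simp only at hz1 hz2
        constructor <;> linarith
      refine hball hzb ⟨⟨⟨?_, ?_⟩, hzc⟩, hne⟩ <;> simp only at hz1 hz2 <;> linarith
    · rintro z rfl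
      exact ⟨⟨hp'.le, hq.le⟩, hFc hx⟩
  choose! p hp using h1
  refine ⟨hF.toFinset.image p, ?_⟩
  ext z
  simp only [boxes, mem_inter_iff, mem_iUnion, Finset.mem_image, Finite.mem_toFinset, exists_prop]
  constructor
  · rintro ⟨⟨_, ⟨x, hx, rfl⟩, hz⟩, hzc⟩
    have : z ∈ ({x} : Set ℝ) := hp x hx ▸ ⟨hz, hzc⟩
    rw [mem_singleton_iff.1 this]
    exact hx
  · intro hz
    have : z ∈ Icc ((p z).1 : ℝ) (p z).2 ∩ c.points := by rw [hp z hz]; rfl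
    exact ⟨⟨p z, ⟨z, hz, rfl⟩, this.1⟩, this.2⟩

lemma pt_restrict_singleton {J : Set ℝ} {c : Config} {x : ℝ} (hx : x ∈ J) :
    (c.restrict J).pt {x} = c.pt {x} := by
  rw [pt_restrict, Measure.restrict_apply (measurableSet_singleton _),
    inter_eq_left.2 (singleton_subset_iff.2 hx)]

lemma mk_restrict_singleton {J : Set ℝ} {c : Config} {x : ℝ} (hx : x ∈ J) :
    (c.restrict J).mk {x} = c.mk {x} := by
  rw [mk_restrict, Measure.restrict_apply (measurableSet_singleton _),
    inter_eq_left.2 (singleton_subset_iff.2 hx)]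

lemma points_restrict (J : Set ℝ) (c : Config) : (c.restrict J).points = c.points ∩ J := by
  ext x
  by_cases hx : x ∈ J
  · simp [points, pt_restrict_singleton hx, hx]
  · have h0 : (c.restrict J).pt {x} = 0 := by
      rw [pt_restrict, Measure.restrict_apply (measurableSet_singleton _)]
      have : ({x} : Set ℝ) ∩ J = ∅ := by
        rw [singleton_inter_eq_empty]; exact hx
      rw [this, measure_empty]
    simp [points, h0, hx]

lemma restrict_compl_eq_self {J : Set ℝ} {c : Config} (h : c.eval J = 0) :
    c.restrict Jᶜ = c := by
  have h1 : c.pt J = 0 := congrArg Prod.fst h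
  have h2 : c.mk J = 0 := congrArg Prod.snd h
  refine Subtype.ext (Prod.ext ?_ ?_)
  · refine Measure.restrict_eq_self_of_ae_mem ?_
    exact compl_mem_ae_iff.2 h1
  · refine Measure.restrict_eq_self_of_ae_mem ?_
    exact compl_mem_ae_iff.2 h2

end Config

open Config

section Deletion

variable {Q : Measure Config} [IsProbabilityMeasure Q] (hQ : IsMatchingLaw Q)
include hQ

omit [IsProbabilityMeasure Q] in
/-- Deletion tolerance: an almost sure property is almost surely kept when the points of a bounded
window are erased. -/
lemma IsMatchingLaw.ae_restrict_compl {p : Config → Prop} (hpm : MeasurableSet {c | p c})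
    (hp : ∀ᵐ c ∂Q, p c) {J : Set ℝ} (hJ : MeasurableSet J) (hbd : Bornology.IsBounded J) :
    ∀ᵐ c ∂Q, p (c.restrict Jᶜ) := by
  have hv : MeasurableSet {c : Config | c.eval J = 0} :=
    measurable_eval hJ (measurableSet_singleton _)
  have h := (hQ.indep J hJ).measure_inter_preimage_eq_mul {c | c.eval J = 0} {c | p c}ᶜ hv hpm.compl
  have e : Config.restrict J ⁻¹' {c | c.eval J = 0} = {c | c.eval J = 0} := by
    ext c
    change ((c.pt.restrict J) J, (c.mk.restrict J) J) = 0 ↔ _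
    rw [Measure.restrict_apply hJ, Measure.restrict_apply hJ, inter_self]
    rfl
  have h0 : Q (Config.restrict J ⁻¹' {c | c.eval J = 0} ∩
      Config.restrict Jᶜ ⁻¹' {c | p c}ᶜ) = 0 := by
    refine measure_mono_null ?_ (ae_iff.1 hp)
    rintro c ⟨h1, h2⟩
    rw [e] at h1
    have h3 : ¬ p (c.restrict Jᶜ) := h2
    rwa [restrict_compl_eq_self h1] at h3
  rw [h0, e] at h
  rcases mul_eq_zero.1 h.symm with h | h
  · exact absurd h (hQ.void J hJ hbd)
  · exact h

omit [IsProbabilityMeasure Q] in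
/-- Almost surely, erasing any finite set of points leads to a good configuration. -/
lemma IsMatchingLaw.ae_delete : ∀ᵐ c ∂Q, ∀ F : Set ℝ, F.Finite → F ⊆ c.points →
    ∃ c', Good c' ∧ c'.points = c.points \ F ∧ ∀ x ∈ c'.points, c'.mk {x} = c.mk {x} := by
  have h : ∀ᵐ c ∂Q, ∀ L, Good (c.restrict (boxes L)ᶜ) := ae_all_iff.2 fun L =>
    hQ.ae_restrict_compl measurableSet_good hQ.good (measurableSet_boxes L) (isBounded_boxes L)
  filter_upwards [h, hQ.good] with c hc hg F hF hFc
  obtain ⟨L, hL⟩ := exists_boxes hg.simple hF hFc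
  have hp : (c.restrict (boxes L)ᶜ).points = c.points \ F := by
    rw [points_restrict, ← hL]
    ext x
    simp only [mem_inter_iff, mem_compl_iff, Set.mem_sdiff]
    tauto
  refine ⟨_, hc L, hp, fun x hx => mk_restrict_singleton ?_⟩
  rw [points_restrict] at hx
  exact hx.2

end Deletion

/-! ### Without infinite components, every point is desired by infinitely many points -/

namespace Config

/-- If only finitely many points desire the point `y`, and their components and that of `y` are
finite, erase all these components except for `y` itself. The other edges form a partial stable
matching of what remains, hence the whole matching, in which `y` is isolated. -/
lemma infinite_desire_point {c : Config} (hg : Good c)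
    (hdel : ∀ F : Set ℝ, F.Finite → F ⊆ c.points →
      ∃ c', Good c' ∧ c'.points = c.points \ F ∧ ∀ x ∈ c'.points, c'.mk {x} = c.mk {x})
    (hfin : ∀ x ∈ c.points, {z | Conn c x z}.Finite) {y : ℝ} (hy : y ∈ c.points) :
    {x | ∃ z, link c x z ∧ dist x y < dist x z}.Infinite := by
  intro hD
  set D := {x | ∃ z, link c x z ∧ dist x y < dist x z} with hDdef
  have hsymm : ∀ {u v}, Conn c u v → Conn c v u := fun h =>
    hg.isStableGraph.symm_conn h
  have hpts : ∀ {x z}, x ∈ c.points → Conn c x z → z ∈ c.points := by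
    intro x z hx hz
    rcases Relation.ReflTransGen.cases_tail hz with h | ⟨w, -, h⟩
    · rwa [h]
    · exact (link_mem h).2.1
  have hDy : ∀ d ∈ insert y D, d ∈ c.points := by
    rintro d (rfl | ⟨z, hz, -⟩)
    · exact hy
    · exact (link_mem hz).1
  let F := (⋃ d ∈ insert y D, {z | Conn c d z}) \ {y}
  have hFfin : F.Finite := ((hD.insert y).biUnion fun d hd => hfin d (hDy d hd)).sdiff
  have hFc : F ⊆ c.points := by
    rintro z ⟨hz, -⟩
    simp only [mem_iUnion, exists_prop] at hz
    obtain ⟨d, hd, hz⟩ := hz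
    exact hpts (hDy d hd) hz
  -- The erased set, together with `y`, is a union of components.
  have hstep : ∀ {u v}, u ∉ F → u ≠ y → link c u v → v ∉ F ∧ v ≠ y := by
    intro u v hu huy huv
    by_contra hcon
    have hv : v ∈ ⋃ d ∈ insert y D, {z | Conn c d z} := by
      by_cases hvy : v = y
      · rw [hvy]
        exact mem_iUnion₂.2 ⟨y, mem_insert _ _, Relation.ReflTransGen.refl⟩
      · by_contra h
        exact hcon ⟨fun h' => h h'.1, hvy⟩
    obtain ⟨d, hd, hdv⟩ := mem_iUnion₂.1 hv
    exact hu ⟨mem_iUnion₂.2 ⟨d, hd, Relation.ReflTransGen.tail hdv (link_symm huv)⟩, huy⟩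
  obtain ⟨c', hg', hp', hm'⟩ := hdel F hFfin hFc
  have hyF : y ∉ F := fun h => h.2 rfl
  have hy' : y ∈ c'.points := by rw [hp']; exact ⟨hy, hyF⟩
  let R : ℝ → ℝ → Prop := fun u v => link c u v ∧ u ∉ F ∧ u ≠ y ∧ v ∉ F ∧ v ≠ y
  have hRset : ∀ {u}, u ∉ F → u ≠ y → {v | R u v} = {v | link c u v} := by
    intro u hu huy
    ext v
    exact ⟨fun h => h.1, fun h => ⟨h, hu, huy, hstep hu huy h⟩⟩
  have hRsat : ∀ {u}, u ∈ c'.points → u ≠ y →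
      (({v | R u v}.encard : ℕ∞) : ℝ≥0∞) = c'.mk {u} := by
    intro u hu huy
    rw [hm' u hu]
    rw [hp'] at hu
    rw [hRset hu.2 huy, hg.encard_eq hu.1]
  have hRy : {v | R y v} = ∅ := by
    ext v
    simp [R]
  -- The remaining points do not desire `y`.
  have hnot : ∀ {u}, u ∈ c'.points → u ≠ y → ∀ z, R u z → dist u z ≤ dist u y := by
    intro u hu huy z hz
    by_contra! hlt
    rw [hp'] at hu
    exact hu.2 ⟨mem_iUnion₂.2 ⟨u, mem_insert_of_mem _ ⟨z, hz.1, hlt⟩, Relation.ReflTransGen.refl⟩,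
      huy⟩
  have hR : c'.IsPartialStable R := by
    refine ⟨fun u v h => ⟨link_symm h.1, h.2.2.2.1, h.2.2.2.2, h.2.1, h.2.2.1⟩, fun u v h => ?_,
      fun u hu => ?_, fun u hu v hv huv => ?_⟩
    · rw [hp']
      exact ⟨⟨(link_mem h.1).1, h.2.1⟩, (link_mem h.1).2.2⟩
    · by_cases huy : u = y
      · rw [huy, hRy]; simp
      · exact (hRsat hu huy).le
    · by_cases huy : u = y
      · have hvy : v ≠ y := fun h => huv (huy.trans h.symm)
        refine Or.inr (Or.inr ⟨hRsat hv hvy, fun z hz => ?_⟩)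
        rw [huy, dist_comm y v]
        exact hnot hv hvy z hz
      by_cases hvy : v = y
      · refine Or.inr (Or.inl ⟨hRsat hu huy, fun z hz => ?_⟩)
        rw [hvy]
        exact hnot hu huy z hz
      have hu' := hu
      have hv' := hv
      rw [hp'] at hu hv
      rcases hg.isStableGraph.stable u hu.1 v hv.1 huv with h | h | h
      · exact Or.inl ⟨h, hu.2, huy, hv.2, hvy⟩
      · exact Or.inr (Or.inl ⟨hRsat hu' huy, fun z hz => h z hz.1⟩)
      · exact Or.inr (Or.inr ⟨hRsat hv' hvy, fun z hz => h z hz.1⟩)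
  obtain ⟨z, hz⟩ := hg'.exists_link hy'
  have : z ∈ {v | R y v} := (hR.iff_link hg'.toNice y z).2 hz
  rw [hRy] at this
  exact this

/-- The number of points to the right of `t` that desire `t`. -/
def desireRight (c : Config) (t : ℝ) : ℝ≥0∞ :=
  c.pt {x | t ≤ x ∧ ∃ z ∈ c.points, link c x z ∧ x - t < dist x z}

lemma measurable_desireRight (t : ℝ) : Measurable fun c => desireRight c t := by
  refine measurable_pt_section measurable_id (.inter ?_ ?_)
  · exact measurableSet_le measurable_const measurable_snd
  · refine measurableSet_exists_points measurable_fst (.inter ?_ ?_)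
    · exact measurableSet_link_comp (by fun_prop) (by fun_prop) (by fun_prop)
    · exact measurableSet_lt (f := fun r : (Config × ℝ) × ℝ => r.1.2 - t)
        (g := fun r => dist r.1.2 r.2) (by fun_prop) (by fun_prop)

lemma desireRight_map_add (c : Config) (a t : ℝ) :
    desireRight (c.map (IsometryEquiv.addRight a)) (t + a) = desireRight c t := by
  rw [desireRight, pt_map, desireRight]
  congr 1
  ext x
  simp only [mem_preimage, mem_ofPred_eq, IsometryEquiv.addRight_apply, add_le_add_iff_right,
    add_sub_add_right_eq_sub]
  refine and_congr_right fun _ => ⟨?_, ?_⟩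
  · rintro ⟨z, -, h1, h2⟩
    obtain ⟨w, rfl⟩ := (IsometryEquiv.addRight a).surjective z
    have h3 := (link_map (IsometryEquiv.addRight a) c x w).1 h1
    exact ⟨w, (link_mem h3).2.1, h3, by simpa using h2⟩
  · rintro ⟨z, -, h1, h2⟩
    have h3 := (link_map (IsometryEquiv.addRight a) c x z).2 h1
    exact ⟨z + a, (link_mem h3).2.1, h3, by simpa using h2⟩

lemma Good.desireRight_eq_top_iff {c : Config} (hg : Good c) (t : ℝ) :
    desireRight c t = ⊤ ↔ {x | t ≤ x ∧ ∃ z, link c x z ∧ dist x t < dist x z}.Infinite := by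
  have e : {x | t ≤ x ∧ ∃ z ∈ c.points, link c x z ∧ x - t < dist x z} =
      {x | t ≤ x ∧ ∃ z, link c x z ∧ dist x t < dist x z} := by
    ext x
    refine and_congr_right fun hx => exists_congr fun z => ?_
    rw [Real.dist_eq x t, abs_of_nonneg (sub_nonneg.2 hx)]
    exact ⟨fun h => h.2, fun h => ⟨(link_mem h.1).2.1, h⟩⟩
  rw [desireRight, e, pt_eq_encard_of_subset hg.simple fun x hx => ?_, ← Set.encard_eq_top_iff,
    ENat.toENNReal_eq_top]
  obtain ⟨-, z, hz, -⟩ := hx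
  exact (link_mem hz).1

lemma Good.desireRight_succ {c : Config} (hg : Good c) {t s : ℝ} (hts : t ≤ s)
    (h : desireRight c t = ⊤) : desireRight c s = ⊤ := by
  rw [hg.desireRight_eq_top_iff] at h ⊢
  intro hfin
  refine h ((hfin.union (finite_points_inter hg.simple (Metric.isBounded_Icc t s))).subset ?_)
  rintro x ⟨hx, z, hz, hlt⟩
  rcases le_total s x with h1 | h1
  · refine Or.inl ⟨h1, z, hz, lt_of_le_of_lt ?_ hlt⟩
    rw [Real.dist_eq, Real.dist_eq, abs_of_nonneg (by linarith), abs_of_nonneg (by linarith)]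
    linarith
  · exact Or.inr ⟨⟨hx, h1⟩, (link_mem hz).1⟩

lemma link_map_neg (c : Config) (x y : ℝ) :
    link (c.map (IsometryEquiv.neg ℝ)) x y ↔ link c (-x) (-y) := by
  have := link_map (IsometryEquiv.neg ℝ) c (-x) (-y)
  simpa using this

lemma points_map_neg (c : Config) (x : ℝ) :
    x ∈ (c.map (IsometryEquiv.neg ℝ)).points ↔ -x ∈ c.points := by
  have := mem_points_map (φ := IsometryEquiv.neg ℝ) (c := c) (x := -x)
  simpa using this

end Config

section Invariance

variable {Q : Measure Config} [IsProbabilityMeasure Q] (hQ : IsMatchingLaw Q)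
include hQ

omit [IsProbabilityMeasure Q]

lemma IsMatchingLaw.map_add (a : ℝ) : Q.map (Config.map (IsometryEquiv.addRight a)) = Q :=
  hQ.invariant _ (measurePreserving_add_right volume a)

lemma IsMatchingLaw.map_neg : Q.map (Config.map (IsometryEquiv.neg ℝ)) = Q :=
  hQ.invariant _ (Measure.measurePreserving_neg volume)

lemma IsMatchingLaw.ae_map_neg {p : Config → Prop} (hp : ∀ᵐ c ∂Q, p c) :
    ∀ᵐ c ∂Q, p (c.map (IsometryEquiv.neg ℝ)) := by
  rw [← hQ.map_neg] at hp
  exact ae_of_ae_map (Config.measurable_map _).aemeasurable hp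

end Invariance

section NoInfinite

variable {Q : Measure Config} [IsProbabilityMeasure Q] (hQ : IsMatchingLaw Q)
include hQ

/-- Sites are monotone with respect to being desired by infinitely many points to their right, so by
stationarity this holds either everywhere or nowhere. -/
lemma IsMatchingLaw.ae_desireRight : ∀ᵐ c ∂Q, (∀ m : ℤ, desireRight c m = ⊤) ∨
    ∀ m : ℤ, desireRight c m ≠ ⊤ := by
  -- At most one integer `m` is not desired infinitely often while `m + 1` is.
  let e : ℤ → Set Config := fun m =>
    {c | Good c} ∩ {c | desireRight c m ≠ ⊤ ∧ desireRight c (m + 1) = ⊤}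
  have he : ∀ m, MeasurableSet (e m) := fun m => measurableSet_good.inter <|
    (measurable_desireRight _ (measurableSet_singleton ⊤)).compl.inter
      (measurable_desireRight _ (measurableSet_singleton ⊤))
  have hdisj : Pairwise fun m n => Disjoint (e m) (e n) := by
    have h1 : ∀ m n : ℤ, m < n → Disjoint (e m) (e n) := by
      intro m n hmn
      refine Set.disjoint_left.2 fun c hc hc' => ?_
      have : (m : ℝ) + 1 ≤ n := by exact_mod_cast hmn
      exact hc'.2.1 (hc.1.desireRight_succ this hc.2.2)
    intro m n hmn
    rcases lt_or_gt_of_ne hmn with h | h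
    · exact h1 m n h
    · exact (h1 n m h).symm
  have hconst : ∀ m, Q (e m) = Q (e 0) := by
    intro m
    have hg := hQ.good
    have e1 : ∀ m, Q (e m) = Q {c | desireRight c m ≠ ⊤ ∧ desireRight c (m + 1) = ⊤} := by
      intro m
      refine measure_congr ?_
      filter_upwards [hg] with c hc
      exact propext ⟨fun h => h.2, fun h => ⟨hc, h⟩⟩
    have hm : ∀ m : ℤ, MeasurableSet
        {c : Config | desireRight c m ≠ ⊤ ∧ desireRight c (m + 1) = ⊤} := fun m =>
      (measurable_desireRight _ (measurableSet_singleton ⊤)).compl.inter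
        (measurable_desireRight _ (measurableSet_singleton ⊤))
    rw [e1, e1]
    conv_lhs => rw [← hQ.map_add m]
    rw [Measure.map_apply (Config.measurable_map _) (hm m)]
    congr 1
    ext c
    have h1 := desireRight_map_add c m 0
    have h2 := desireRight_map_add c m (0 + 1)
    simp only [mem_preimage, mem_ofPred_eq]
    rw [show ((m : ℝ) + 1) = 0 + 1 + m by ring, show desireRight
      (c.map (IsometryEquiv.addRight (m : ℝ))) m = desireRight c 0 by rw [← h1, zero_add], h2]
    simp
  have hzero : Q (e 0) = 0 := by
    by_contra h0
    have h1 := tsum_measure_le_measure_univ (μ := Q) (fun m => (he m).nullMeasurableSet)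
      (fun m n hmn => (hdisj hmn).aedisjoint)
    simp only [hconst] at h1
    rw [ENNReal.tsum_const_eq_top_of_ne_zero h0, measure_univ] at h1
    exact absurd h1 (by simp)
  have hall : ∀ᵐ c ∂Q, ∀ m, c ∉ e m := ae_all_iff.2 fun m => by
    rw [ae_iff]
    simpa using (hconst m).trans hzero
  filter_upwards [hall, hQ.good] with c hc hg
  by_contra! hcon
  obtain ⟨⟨m, hm⟩, ⟨n, hn⟩⟩ := hcon
  have hstep : ∀ k : ℕ, desireRight c ((m + k : ℤ) : ℝ) ≠ ⊤ := by
    intro k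
    induction k with
    | zero => simpa using hm
    | succ k ih =>
      intro h
      refine hc (m + k) ⟨hg, ih, ?_⟩
      push_cast at h ⊢
      rw [← h]
      ring_nf
  have hmn : (n : ℝ) ≤ ((m + (n - m).toNat : ℤ) : ℝ) := by
    exact_mod_cast (by omega : n ≤ m + (n - m).toNat)
  exact hstep _ (hg.desireRight_succ hmn hn)

/-- Without infinite components, infinitely many points desire the origin. -/
lemma IsMatchingLaw.ae_infinite_desire : ∀ᵐ c ∂Q, (∀ x ∈ c.points, ¬ InfAt c x) →
    {x | ∃ z, link c x z ∧ |x| < dist x z}.Infinite := by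
  filter_upwards [hQ.good, hQ.ae_delete, hQ.ae_desireRight, hQ.ae_map_neg hQ.good,
    hQ.ae_map_neg hQ.ae_desireRight] with c hg hdel hR hg' hL hno hN
  have hfin : ∀ x ∈ c.points, {z | Conn c x z}.Finite := by
    intro x hx
    have := hno x hx
    rwa [infAt_iff hg.simple hx, Set.not_infinite] at this
  obtain ⟨y, hy, -⟩ := hg.nonempty
  have hinf := infinite_desire_point hg hdel hfin hy
  have hR0 : ∀ m : ℤ, desireRight c m ≠ ⊤ := by
    rcases hR with h | h
    · exfalso
      have := h 0
      rw [hg.desireRight_eq_top_iff] at this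
      refine this (hN.subset ?_)
      rintro x ⟨-, z, hz, hlt⟩
      exact ⟨z, hz, by simpa using hlt⟩
    · exact h
  have hL0 : ∀ m : ℤ, desireRight (c.map (IsometryEquiv.neg ℝ)) m ≠ ⊤ := by
    rcases hL with h | h
    · exfalso
      have := h 0
      rw [hg'.desireRight_eq_top_iff] at this
      refine this ((hN.preimage (f := fun x => -x) neg_injective.injOn).subset ?_)
      rintro x ⟨-, z, hz, hlt⟩
      rw [link_map_neg] at hz
      refine ⟨-z, hz, ?_⟩
      rw [dist_neg_neg, abs_neg]
      simpa using hlt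
    · exact h
  have h1 := hR0 ⌈y⌉
  have h2 := hL0 ⌈-y⌉
  rw [Ne, hg.desireRight_eq_top_iff, Set.not_infinite] at h1
  rw [Ne, hg'.desireRight_eq_top_iff, Set.not_infinite] at h2
  have hy1 := Int.le_ceil y
  have hy2 := Int.le_ceil (-y)
  refine hinf ((h1.union ((h2.preimage (f := fun x => -x) neg_injective.injOn).union
    (finite_points_inter hg.simple (Metric.isBounded_Icc (-(⌈-y⌉ : ℝ)) ⌈y⌉)))).subset ?_)
  rintro x ⟨z, hz, hlt⟩
  rcases le_total (⌈y⌉ : ℝ) x with h | h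
  · refine Or.inl ⟨h, z, hz, lt_of_le_of_lt ?_ hlt⟩
    rw [Real.dist_eq, Real.dist_eq, abs_of_nonneg (by linarith), abs_of_nonneg (by linarith)]
    linarith
  rcases le_total x (-(⌈-y⌉ : ℝ)) with h' | h'
  · refine Or.inr (Or.inl ⟨by linarith, -z, ?_, ?_⟩)
    · rw [link_map_neg]
      simpa using hz
    · rw [dist_neg_neg]
      refine lt_of_le_of_lt ?_ hlt
      rw [Real.dist_eq, Real.dist_eq, abs_of_nonneg (by linarith), abs_of_nonpos (by linarith)]
      linarith
  · exact Or.inr (Or.inr ⟨⟨h', h⟩, (link_mem hz).1⟩)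

end NoInfinite

/-! ### Mass transport -/

/-- Mass transport in Borel–Cantelli form: the events `e k` say that some mass is received from
distance `k`, the events `e' k` of the same probabilities that mass is sent to distance `k`. If the
mass received has finite mean, mass is sent to finitely many distances only. -/
lemma ae_finite_of_transport {Q : Measure Config} {ι : Type*} [Countable ι]
    {e e' : ι → Set Config} (he : ∀ k, MeasurableSet (e k)) (hee' : ∀ k, Q (e' k) = Q (e k))
    {F : Config → ℝ≥0∞} (hF : ∫⁻ c, F c ∂Q < ⊤)
    (hle : ∀ᵐ c ∂Q, (({k | c ∈ e k}.encard : ℕ∞) : ℝ≥0∞) ≤ F c) :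
    ∀ᵐ c ∂Q, {k | c ∈ e' k}.Finite := by
  refine ae_finite_setOfPred_mem (ne_top_of_le_ne_top hF.ne ?_)
  calc ∑' k, Q (e' k) = ∑' k, ∫⁻ c, (e k).indicator 1 c ∂Q := by
        refine tsum_congr fun k => ?_
        rw [hee', lintegral_indicator_one (he k)]
    _ = ∫⁻ c, ∑' k, (e k).indicator 1 c ∂Q :=
        (lintegral_tsum fun k => (measurable_one.indicator (he k)).aemeasurable).symm
    _ ≤ ∫⁻ c, F c ∂Q := by
        refine lintegral_mono_ae (hle.mono fun c hc => le_trans (le_of_eq ?_) hc)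
        have : ∑' k, (e k).indicator (1 : Config → ℝ≥0∞) c =
            ∑' k, {k | c ∈ e k}.indicator (fun _ => (1 : ℝ≥0∞)) k :=
          tsum_congr fun k => by
            by_cases h : c ∈ e k
            · rw [indicator_of_mem h, indicator_of_mem (by exact h)]; rfl
            · rw [indicator_of_notMem h, indicator_of_notMem (by exact h)]
        rw [this, ← tsum_subtype, ENNReal.tsum_set_one]

namespace Config

lemma conn_symm {c : Config} {x y : ℝ} (h : Conn c x y) : Conn c y x := by
  induction h with
  | refl => exact .refl
  | tail _ h2 ih => exact ih.head (link_symm h2)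

lemma conn_mem {c : Config} {x y : ℝ} (hx : x ∈ c.points) (h : Conn c x y) : y ∈ c.points := by
  rcases Relation.ReflTransGen.cases_tail h with h | ⟨w, -, h⟩
  · rwa [h]
  · exact (link_mem h).2.1

lemma InfAt.of_conn {c : Config} {x y : ℝ} (hx : InfAt c x) (h : Conn c x y) : InfAt c y := by
  have : {z | Conn c y z} = {z | Conn c x z} := by
    ext z
    exact ⟨fun h' => Relation.ReflTransGen.trans h h',
      fun h' => Relation.ReflTransGen.trans (conn_symm h) h'⟩
  rw [InfAt, this]
  exact hx

/-- The translation of the line by an integer. -/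
abbrev shift (m : ℤ) : ℝ ≃ᵢ ℝ := IsometryEquiv.addRight (m : ℝ)

lemma exists_points_map_shift {c : Config} {m : ℤ} {p : ℝ → Prop} :
    (∃ x ∈ (c.map (shift m)).points, p x) ↔ ∃ x ∈ c.points, p (x + m) := by
  constructor
  · rintro ⟨x, hx, hp⟩
    obtain ⟨w, rfl⟩ := (shift m).surjective x
    exact ⟨w, mem_points_map.1 hx, hp⟩
  · rintro ⟨x, hx, hp⟩
    exact ⟨x + m, (mem_points_map (φ := shift m)).2 hx, hp⟩

lemma forall_points_map_shift {c : Config} {m : ℤ} {p : ℝ → Prop} :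
    (∀ x ∈ (c.map (shift m)).points, p x) ↔ ∀ x ∈ c.points, p (x + m) := by
  have := exists_points_map_shift (c := c) (m := m) (p := fun x => ¬ p x)
  rw [← not_iff_not]
  simpa using this

lemma link_map_shift (c : Config) (m : ℤ) (x y : ℝ) :
    link (c.map (shift m)) (x + m) (y + m) ↔ link c x y := link_map (shift m) c x y

lemma conn_map_shift (c : Config) (m : ℤ) (x y : ℝ) :
    Conn (c.map (shift m)) (x + m) (y + m) ↔ Conn c x y := conn_map (shift m) c x y

lemma infAt_map_shift (c : Config) (m : ℤ) (x : ℝ) :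
    InfAt (c.map (shift m)) (x + m) ↔ InfAt c x := infAt_map (shift m) c x

lemma mk_map_shift (c : Config) (m : ℤ) (x : ℝ) : (c.map (shift m)).mk {x + m} = c.mk {x} := by
  rw [mk_map]
  congr 1
  ext z
  simp

end Config

section Transport

variable {Q : Measure Config} (hQ : IsMatchingLaw Q)
include hQ

lemma IsMatchingLaw.measure_eq_of_shift {e : ℤ → Set Config} (he : ∀ m, MeasurableSet (e m))
    (hshift : ∀ m c, c.map (shift m) ∈ e m ↔ c ∈ e 0) (m n : ℤ) : Q (e m) = Q (e n) := by
  have h : ∀ m, Q (e m) = Q (e 0) := by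
    intro m
    conv_lhs => rw [← hQ.map_add m]
    rw [Measure.map_apply (Config.measurable_map _) (he m)]
    congr 1
    ext c
    exact hshift m c
  rw [h m, h n]

/-- An infinite component cannot single out one of its points: such a point would send mass to all
the points of its component, while every point receives mass at most once. -/
lemma IsMatchingLaw.ae_no_special {φ : Config → ℝ → Prop}
    (hφ : MeasurableSet {q : Config × ℝ | φ q.1 q.2})
    (hinf : ∀ c x, φ c x → InfAt c x)
    (hshift : ∀ c (m : ℤ) x, φ (c.map (shift m)) (x + m) ↔ φ c x)
    (huniq : ∀ᵐ c ∂Q, ∀ x y, φ c x → φ c y → Conn c x y → x = y) :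
    ∀ᵐ c ∂Q, ∀ x ∈ c.points, ¬ φ c x := by
  -- A special point in `[m, m + 1)` sends mass to `[m + k, m + k + 1)`.
  let e : ℤ → ℤ → Set Config := fun k m => {c | ∃ x ∈ c.points, ⌊x⌋ = m ∧ φ c x ∧
    ∃ y ∈ c.points, ⌊y⌋ = m + k ∧ Conn c x y}
  have hfloor : ∀ n : ℤ, MeasurableSet {x : ℝ | ⌊x⌋ = n} := fun n =>
    Int.measurable_floor (measurableSet_singleton n)
  have he : ∀ k m, MeasurableSet (e k m) := by
    intro k m
    refine measurableSet_exists_points measurable_id (.inter (measurable_snd (hfloor m)) (.inter ?_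
      (measurableSet_exists_points measurable_fst (.inter (measurable_snd (hfloor (m + k))) ?_))))
    · exact hφ
    · exact measurableSet_conn_comp (by fun_prop) (by fun_prop) (by fun_prop)
  have hes : ∀ k m c, c.map (shift m) ∈ e k m ↔ c ∈ e k 0 := by
    intro k m c
    simp only [e, mem_ofPred_eq]
    rw [exists_points_map_shift]
    refine exists_congr fun x => and_congr_right fun _ => ?_
    rw [exists_points_map_shift, hshift]
    simp only [Int.floor_add_intCast, conn_map_shift]
    refine and_congr (by omega) (and_congr_right fun _ => exists_congr fun y =>
      and_congr_right fun _ => and_congr_left fun _ => by omega)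
  have hm : ∀ m : ℤ, ∀ᵐ c ∂Q, {k : ℤ | c ∈ e k m}.Finite := by
    intro m
    refine ae_finite_of_transport (e := fun k => e k (-k)) (fun k => he k _)
      (fun k => hQ.measure_eq_of_shift (he k) (hes k) m (-k)) (F := fun c => c.pt (Ico 0 1))
      (hQ.mean _ measurableSet_Ico (Metric.isBounded_Ico _ _)) ?_
    filter_upwards [huniq, hQ.good] with c hc hg
    rw [pt_eq_encard hg.simple]
    refine ENat.toENNReal_mono ?_
    have h1 : ∀ k, c ∈ e k (-k) → ∃ y, (y ∈ c.points ∧ ⌊y⌋ = 0) ∧ ∃ x, ⌊x⌋ = -k ∧ φ c x ∧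
        Conn c x y := by
      rintro k ⟨x, -, hx, hφx, y, hy, hy', hxy⟩
      exact ⟨y, ⟨hy, by omega⟩, x, hx, hφx, hxy⟩
    choose! y hy x hx using h1
    refine encard_le_encard_of_injOn (f := y) ?_ ?_
    · intro k hk
      have := hy k hk
      rw [Int.floor_eq_zero_iff] at this
      exact ⟨this.2, this.1⟩
    · intro k hk l hl hkl
      have hk' := hx k hk
      have hl' := hx l hl
      have := hc _ _ hk'.2.1 hl'.2.1
        (Relation.ReflTransGen.trans (hk'.2.2) (hkl ▸ conn_symm hl'.2.2))
      have h2 := hk'.1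
      have h3 := hl'.1
      rw [this] at h2
      omega
  filter_upwards [ae_all_iff.2 hm, hQ.good] with c hc hg x hx hφx
  have hfin := hc ⌊x⌋
  have hinfx := hinf c x hφx
  rw [infAt_iff hg.simple hx] at hinfx
  refine hinfx ((hfin.biUnion fun k _ =>
    finite_points_inter hg.simple (Metric.isBounded_Icc ((⌊x⌋ + k : ℤ) : ℝ)
      ((⌊x⌋ + k : ℤ) + 1))).subset ?_)
  intro y hy
  have hyp := conn_mem hx hy
  refine mem_iUnion₂.2 ⟨⌊y⌋ - ⌊x⌋, ⟨x, hx, rfl, hφx, y, hyp, by omega, hy⟩, ?_, hyp⟩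
  rw [show ⌊x⌋ + (⌊y⌋ - ⌊x⌋) = ⌊y⌋ by ring]
  exact ⟨Int.floor_le y, (Int.lt_floor_add_one y).le⟩

/-- An infinite component has no leftmost point, which would be singled out. -/
lemma IsMatchingLaw.ae_not_bddBelow : ∀ᵐ c ∂Q, ∀ x ∈ c.points, InfAt c x →
    ¬ BddBelow {y | Conn c x y} := by
  have h := hQ.ae_no_special
    (φ := fun c x => InfAt c x ∧ ∀ y ∈ c.points, Conn c x y → x ≤ y) (.inter measurableSet_infAt
      (measurableSet_forall_points measurable_fst (.imp
        (measurableSet_conn_comp (by fun_prop) (by fun_prop) (by fun_prop))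
        (measurableSet_le (measurable_snd.comp measurable_fst) measurable_snd))))
    (fun c x h => h.1)
    (fun c m x => by
      rw [infAt_map_shift, forall_points_map_shift]
      simp only [conn_map_shift, add_le_add_iff_right])
    (hQ.good.mono fun c hg x y hx hy hxy => by
      have hxp : x ∈ c.points := by
        by_contra hnot
        rcases Relation.ReflTransGen.cases_head hxy with rfl | ⟨w, hw, -⟩
        · have : {y | Conn c x y} = {x} := by
            ext z
            refine ⟨fun hz => ?_, fun hz => hz ▸ Relation.ReflTransGen.refl⟩
            rcases Relation.ReflTransGen.cases_head hz with h | ⟨w, hw, -⟩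
            · exact h.symm
            · exact absurd (link_mem hw).1 hnot
          have h1 := hx.1
          rw [InfAt, this] at h1
          exact (c.pt_lt_top Bornology.isBounded_singleton).ne h1
        · exact hnot (link_mem hw).1
      exact le_antisymm (hx.2 y (conn_mem hxp hxy) hxy) (hy.2 x hxp (conn_symm hxy)))
  filter_upwards [h, hQ.good] with c hc hg x hx hinf hbdd
  obtain ⟨b, hb⟩ := hbdd
  have hfin : ({y | Conn c x y} ∩ Iic x).Finite :=
    (finite_points_inter hg.simple (Metric.isBounded_Icc b x)).subset
      fun y hy => ⟨⟨hb hy.1, hy.2⟩, conn_mem hx hy.1⟩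
  obtain ⟨y, ⟨hy, hyx⟩, hmin⟩ := hfin.exists_minimal (s := {y | Conn c x y} ∩ Iic x)
    ⟨x, Relation.ReflTransGen.refl, le_refl x⟩ |>.imp fun y hy =>
      (⟨hy.1, fun z hz => (le_total y z).elim id fun h => hy.2 hz h⟩ :
        y ∈ {y | Conn c x y} ∩ Iic x ∧ ∀ z ∈ {y | Conn c x y} ∩ Iic x, y ≤ z)
  refine hc y (conn_mem hx hy) ⟨hinf.of_conn hy, fun z hz hyz => ?_⟩
  by_cases hzx : z ≤ x
  · exact hmin z ⟨Relation.ReflTransGen.trans hy hyz, hzx⟩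
  · exact hyx.trans (not_le.1 hzx).le

lemma IsMatchingLaw.ae_not_bddAbove : ∀ᵐ c ∂Q, ∀ x ∈ c.points, InfAt c x →
    ¬ BddAbove {y | Conn c x y} := by
  filter_upwards [hQ.ae_map_neg hQ.ae_not_bddBelow] with c hc x hx hinf hbdd
  obtain ⟨b, hb⟩ := hbdd
  refine hc (-x) ((points_map_neg c _).2 (by rwa [neg_neg]))
    ((infAt_map (IsometryEquiv.neg ℝ) c x).2 hinf) ⟨-b, fun y hy => ?_⟩
  have : Conn c x (-y) := by
    rw [← conn_map (IsometryEquiv.neg ℝ)]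
    simpa using hy
  have := hb this
  linarith

/-- When all degrees are at most two, the points of an infinite component have degree two: otherwise
its unique point of degree one would be singled out. -/
lemma IsMatchingLaw.ae_encard_eq_two (h2 : ∀ᵐ c ∂Q, ∀ x ∈ c.points, c.mk {x} ≤ 2) :
    ∀ᵐ c ∂Q, ∀ x ∈ c.points, InfAt c x → {y | link c x y}.encard = 2 := by
  have hdeg : ∀ᵐ c ∂Q, ∀ x, {y | link c x y}.encard ≤ 2 := by
    filter_upwards [h2, hQ.good] with c hc hg x
    by_cases hx : x ∈ c.points
    · have := hc x hx
      rw [← hg.encard_eq hx] at this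
      exact_mod_cast this
    · have : {y | link c x y} = ∅ := by
        ext z
        simp only [mem_ofPred_eq, mem_empty_iff_false, iff_false]
        exact fun h => hx (link_mem h).1
      rw [this, encard_empty]
      exact zero_le
  have h := hQ.ae_no_special (φ := fun c x => InfAt c x ∧ x ∈ c.points ∧ c.mk {x} ≤ 1)
    (.inter measurableSet_infAt (.inter (measurableSet_mem_points measurable_fst measurable_snd)
      (measurableSet_le (measurable_mk_singleton measurable_fst measurable_snd) measurable_const)))
    (fun c x h => h.1)
    (fun c m x => by
      rw [infAt_map_shift, mk_map_shift]
      have := mem_points_map (φ := shift m) (c := c) (x := x)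
      rw [IsometryEquiv.addRight_apply] at this
      rw [this])
    (by
      filter_upwards [hQ.good, hdeg] with c hg hd x y hx hy hxy
      by_contra hne
      have hle : ∀ z, z ∈ c.points ∧ c.mk {z} ≤ 1 → {w | link c z w}.encard ≤ 1 := by
        rintro z ⟨hz, hz1⟩
        rw [← hg.encard_eq hz] at hz1
        exact_mod_cast hz1
      have := finite_of_two_leaves hg.isStableGraph (fun z _ => hd z) (hle x hx.2) (hle y hy.2)
        hne hxy
      exact (infAt_iff hg.simple hx.2.1).1 hx.1 this)
  filter_upwards [h, hdeg, hQ.good] with c hc hd hg x hx hinf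
  have h1 : ¬ {y | link c x y}.encard ≤ 1 := by
    intro hle
    refine hc x hx ⟨hinf, hx, ?_⟩
    rw [← hg.encard_eq hx]
    exact_mod_cast hle
  refine le_antisymm (hd x) ?_
  rw [not_le] at h1
  have := Order.add_one_le_of_lt h1
  rwa [one_add_one_eq_two] at this

end Transport

/-! ### With an infinite component, finitely many points desire the origin -/

section Infinite

variable {Q : Measure Config} (hQ : IsMatchingLaw Q)
include hQ

/-- Almost surely, an infinite component is a two-ended path that is unbounded in both directions,
and contains all the points with an infinite component. -/
lemma IsMatchingLaw.ae_path (h2 : ∀ᵐ c ∂Q, ∀ x ∈ c.points, c.mk {x} ≤ 2) :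
    ∀ᵐ c ∂Q, ∀ x₀ ∈ c.points, InfAt c x₀ →
      ¬ BddBelow {y | Conn c x₀ y} ∧ ¬ BddAbove {y | Conn c x₀ y} ∧
      (∀ x ∈ c.points, InfAt c x ↔ Conn c x₀ x) ∧
      ∃ a : ℤ → ℝ, IsPathParam (link c) a ∧ ∀ x, Conn c x₀ x → ∃ i, a i = x := by
  filter_upwards [hQ.good, hQ.ae_not_bddBelow, hQ.ae_not_bddAbove, hQ.ae_encard_eq_two h2]
    with c hg hB hA hd x₀ hx₀ hinf
  have hb := hB x₀ hx₀ hinf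
  have ha := hA x₀ hx₀ hinf
  refine ⟨hb, ha, fun x hx => ⟨fun hxi => ?_, fun h => hinf.of_conn h⟩, ?_⟩
  · by_contra hnot
    exact (infAt_iff hg.simple hx).1 hxi
      (hg.isStableGraph.finite_of_not_conn hx hb ha hnot)
  · obtain ⟨a, h1, -, h3⟩ := exists_isPathParam hg.isStableGraph
      ((infAt_iff hg.simple hx₀).1 hinf)
      fun x hx => hd x (conn_mem hx₀ hx) (hinf.of_conn hx)
    exact ⟨a, h1, h3⟩

/-- Almost surely, finitely many points of an infinite component on the right of the origin desire
the origin because of an edge to their right. A point of the window `[m, m + 1)` with such an edge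
has an edge to the right longer than `m`, and by transport this is compared with edges over the
origin starting in the window `[-m, -m + 1)`; there are at most five of these. -/
lemma IsMatchingLaw.ae_finite_desire_right [IsProbabilityMeasure Q]
    (h2 : ∀ᵐ c ∂Q, ∀ x ∈ c.points, c.mk {x} ≤ 2) :
    ∀ᵐ c ∂Q, {x | InfAt c x ∧ 0 < x ∧ ∃ z, link c x z ∧ x < z - x}.Finite := by
  let e : ℕ → ℤ → Set Config := fun k m => {c | ∃ x ∈ c.points, ⌊x⌋ = m ∧ InfAt c x ∧
    ∃ z ∈ c.points, link c x z ∧ (k : ℝ) < z - x}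
  have hfloor : ∀ n : ℤ, MeasurableSet {x : ℝ | ⌊x⌋ = n} := fun n =>
    Int.measurable_floor (measurableSet_singleton n)
  have he : ∀ k m, MeasurableSet (e k m) := by
    intro k m
    refine measurableSet_exists_points measurable_id (.inter (measurable_snd (hfloor m)) (.inter
      measurableSet_infAt (measurableSet_exists_points measurable_fst (.inter ?_ ?_))))
    · exact measurableSet_link_comp (by fun_prop) (by fun_prop) (by fun_prop)
    · exact measurableSet_lt (f := fun _ : (Config × ℝ) × ℝ => (k : ℝ))
        (g := fun r => r.2 - r.1.2) (by fun_prop) (by fun_prop)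
  have hes : ∀ k m c, c.map (shift m) ∈ e k m ↔ c ∈ e k 0 := by
    intro k m c
    simp only [e, mem_ofPred_eq]
    rw [exists_points_map_shift]
    refine exists_congr fun x => and_congr_right fun _ => ?_
    rw [exists_points_map_shift, infAt_map_shift]
    simp only [Int.floor_add_intCast, link_map_shift, add_sub_add_right_eq_sub]
    exact and_congr_left fun _ => by omega
  have hfive : ∀ᵐ c ∂Q,
      (({k : ℕ | c ∈ e (k + 1) (-(k + 1))}.encard : ℕ∞) : ℝ≥0∞) ≤ 5 := by
    filter_upwards [hQ.ae_path h2, hQ.good] with c hpath hg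
    have h1 : ∀ k ∈ {k : ℕ | c ∈ e (k + 1) (-(k + 1))}, ∃ x, (⌊x⌋ = -((k : ℤ) + 1) ∧
        x ∈ c.points ∧ InfAt c x) ∧ ∃ z, link c x z ∧ (k : ℝ) + 1 < z - x := by
      rintro k ⟨x, hx, hfl, hinf, z, -, hz, hlt⟩
      exact ⟨x, ⟨hfl, hx, hinf⟩, z, hz, by exact_mod_cast hlt⟩
    choose! x hx z hz hlt using h1
    rcases {k : ℕ | c ∈ e (k + 1) (-(k + 1))}.eq_empty_or_nonempty with hK | ⟨k₀, hk₀⟩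
    · rw [hK]; simp
    obtain ⟨-, -, hall, a, ha, hsurj⟩ := hpath _ (hx k₀ hk₀).2.1 (hx k₀ hk₀).2.2
    have h5 := ha.encard_le hg.isStableGraph (t := 0)
      (K := {k : ℕ | c ∈ e (k + 1) (-(k + 1))}) (l := x) (r := z)
      (fun k hk => by
        have h := Int.lt_floor_add_one (x k)
        rw [(hx k hk).1] at h
        push_cast at h
        have := Nat.cast_nonneg (α := ℝ) k
        linarith)
      (fun k hk => by
        have h := Int.floor_le (x k)
        rw [(hx k hk).1] at h
        push_cast at h
        have := hlt k hk
        linarith)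
      hz (fun k hk => hsurj _ ((hall _ (hx k hk).2.1).1 (hx k hk).2.2))
      (fun k hk l hl hkl => by
        have h1 := (hx k hk).1
        rw [hkl, (hx l hl).1] at h1
        omega)
    exact_mod_cast h5
  have hfin := ae_finite_of_transport (Q := Q) (e := fun k : ℕ => e (k + 1) (-(k + 1)))
    (e' := fun k : ℕ => e (k + 1) (k + 1)) (fun k => he _ _)
    (fun k => hQ.measure_eq_of_shift (he _) (hes _) _ _) (F := fun _ => 5)
    (by simp) hfive
  filter_upwards [hfin, hQ.good] with c hc hg
  refine ((hc.biUnion fun k _ => finite_points_inter hg.simple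
    (Metric.isBounded_Icc ((k : ℝ) + 1) (k + 2))).union
      (finite_points_inter hg.simple (Metric.isBounded_Icc (0 : ℝ) 1))).subset ?_
  rintro x ⟨hinf, hx0, z, hz, hlt⟩
  have hx := (link_mem hz).1
  rcases le_total x 1 with h1 | h1
  · exact Or.inr ⟨⟨hx0.le, h1⟩, hx⟩
  · have hfl : 1 ≤ ⌊x⌋ := Int.le_floor.2 (by simpa using h1)
    obtain ⟨k, hk⟩ := Int.eq_ofNat_of_zero_le (show 0 ≤ ⌊x⌋ - 1 by omega)
    have hk' : ⌊x⌋ = (k : ℤ) + 1 := by omega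
    have hl := Int.floor_le x
    have hu := (Int.lt_floor_add_one x).le
    rw [hk'] at hl hu
    push_cast at hl hu
    refine Or.inl (mem_iUnion₂.2 ⟨k, ⟨x, hx, hk', hinf, z, (link_mem hz).2.1, hz, ?_⟩,
      ⟨hl, by linarith⟩, hx⟩)
    push_cast
    linarith

/-- With an infinite component, finitely many points desire the origin. -/
lemma IsMatchingLaw.ae_finite_desire [IsProbabilityMeasure Q]
    (h2 : ∀ᵐ c ∂Q, ∀ x ∈ c.points, c.mk {x} ≤ 2) :
    ∀ᵐ c ∂Q, (∃ x ∈ c.points, InfAt c x) → {x | ∃ z, link c x z ∧ |x| < dist x z}.Finite := by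
  filter_upwards [hQ.good, hQ.ae_path h2, hQ.ae_finite_desire_right h2,
    hQ.ae_map_neg (hQ.ae_finite_desire_right h2)] with c hg hpath hR hL
  rintro ⟨x₀, hx₀, hinf⟩
  obtain ⟨hb, ha, -, a, hpar, hsurj⟩ := hpath x₀ hx₀ hinf
  refine hg.isStableGraph.finite_desire hb ha ?_ (hR.subset ?_)
    ((hL.preimage (f := fun x => -x) neg_injective.injOn).subset ?_)
  · let K := {x | Conn c x₀ x ∧ x < 0 ∧ ∃ z, link c x z ∧ 0 < z}
    have hK : ∀ x ∈ K, ∃ z, link c x z ∧ 0 < z := fun x hx => hx.2.2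
    choose! z hz hz0 using hK
    have h5 : K.encard ≤ 5 := hpar.encard_le hg.isStableGraph (l := id) (r := z)
      (fun x hx => hx.2.1) hz0 hz (fun x hx => hsurj x hx.1) (injOn_id _)
    have hKfin : K.Finite := Set.finite_of_encard_le_coe (k := 5) h5
    refine (hKfin.biUnion fun x _ => (hg.finite_link x).image (Prod.mk x)).subset ?_
    rintro ⟨x, y⟩ ⟨h1, h2, h3, h4⟩
    exact mem_iUnion₂.2 ⟨x, ⟨h1, h3, y, h2, h4⟩, y, h2, rfl⟩
  · rintro x ⟨h1, h2⟩
    exact ⟨hinf.of_conn h1, h2⟩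
  · rintro x ⟨h1, h2, z, hz, hlt⟩
    refine ⟨(infAt_map (IsometryEquiv.neg ℝ) c x).2 (hinf.of_conn h1), by linarith, -z, ?_,
      by linarith⟩
    rw [link_map_neg]
    simpa using hz

end Infinite

/-! ### Ergodicity -/

namespace Config

/-- The events that depend on the configuration in a bounded window. -/
def localEvents : Set (Set Config) :=
  {S | ∃ n : ℕ, MeasurableSet[MeasurableSpace.comap (restrict (Icc (-n : ℝ) n)) inferInstance] S}

lemma restrict_restrict {J J' : Set ℝ} (hJJ' : J ⊆ J') (c : Config) :
    (c.restrict J').restrict J = c.restrict J := by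
  refine Subtype.ext (Prod.ext ?_ ?_)
  · exact Measure.restrict_restrict_of_subset hJJ'
  · exact Measure.restrict_restrict_of_subset hJJ'

lemma isSetAlgebra_localEvents : IsSetAlgebra localEvents := by
  have hmono : ∀ {n m : ℕ}, n ≤ m →
      MeasurableSpace.comap (restrict (Icc (-n : ℝ) n)) inferInstance ≤
      MeasurableSpace.comap (restrict (Icc (-m : ℝ) m)) inferInstance := by
    intro n m hnm
    have hnm' : (n : ℝ) ≤ m := by exact_mod_cast hnm
    have : restrict (Icc (-n : ℝ) n) = restrict (Icc (-n : ℝ) n) ∘ restrict (Icc (-m : ℝ) m) :=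
      funext fun c => (restrict_restrict
        (Icc_subset_Icc (by linarith) hnm') c).symm
    rw [this, ← MeasurableSpace.comap_comp]
    exact MeasurableSpace.comap_mono (measurable_restrict measurableSet_Icc).comap_le
  refine ⟨⟨0, @MeasurableSet.empty _ (_)⟩,
    fun S ⟨n, hn⟩ => ⟨n, @MeasurableSet.compl _ _ (_) hn⟩, ?_⟩
  rintro S T ⟨n, hn⟩ ⟨m, hm⟩
  exact ⟨max n m, @MeasurableSet.union _ (_) _ _ (hmono (le_max_left _ _) _ hn)
    (hmono (le_max_right _ _) _ hm)⟩

lemma generateFrom_localEvents :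
    (inferInstance : MeasurableSpace Config) = MeasurableSpace.generateFrom localEvents := by
  refine le_antisymm ?_ (MeasurableSpace.generateFrom_le ?_)
  · have h := @measurable_of_eval Config (MeasurableSpace.generateFrom localEvents) id ?_
    · intro s hs
      exact h hs
    · intro B s hs
      obtain ⟨n, hn⟩ := exists_subset_Icc B.2.2
      refine MeasurableSpace.measurableSet_generateFrom ⟨n, eval B ⁻¹' s,
        measurable_eval B.2.1 hs, ?_⟩
      ext c
      have : eval (B : Set ℝ) (restrict (Icc (-n : ℝ) n) c) = eval (B : Set ℝ) c :=
        Prod.ext (Measure.restrict_eq_self _ hn) (Measure.restrict_eq_self _ hn)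
      simp only [mem_preimage, this, id]
  · rintro S ⟨n, T, hT, rfl⟩
    exact measurable_restrict measurableSet_Icc hT

lemma restrict_map_restrict_compl {J : Set ℝ} (hJ : MeasurableSet J) {φ : ℝ ≃ᵢ ℝ}
    (hφ : φ ⁻¹' J ⊆ Jᶜ) (c : Config) :
    ((c.restrict Jᶜ).map φ).restrict J = (c.map φ).restrict J := by
  have hm : Measurable φ := φ.continuous.measurable
  have key : ∀ ν : Measure ℝ, ((ν.restrict Jᶜ).map φ).restrict J = (ν.map φ).restrict J := by
    intro ν
    ext B hB
    rw [Measure.restrict_apply hB, Measure.restrict_apply hB, Measure.map_apply hm (hB.inter hJ),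
      Measure.map_apply hm (hB.inter hJ)]
    exact Measure.restrict_eq_self _ ((preimage_mono inter_subset_right).trans hφ)
  exact Subtype.ext (Prod.ext (key c.pt) (key c.mk))

end Config

/-- Events that are invariant under translations are trivial: they are nearly determined by a
bounded window, hence also by a far translate of it, which is independent. -/
lemma IsMatchingLaw.measure_eq_zero_or_one {Q : Measure Config} [IsProbabilityMeasure Q]
    (hQ : IsMatchingLaw Q) {A : Set Config} (hA : MeasurableSet A)
    (hinv : ∀ (m : ℤ) c, c.map (shift m) ∈ A ↔ c ∈ A) : Q A = 0 ∨ Q A = 1 := by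
  have hdense : Q.MeasureDense localEvents :=
    Measure.MeasureDense.of_generateFrom_isSetAlgebra_finite Q isSetAlgebra_localEvents
      generateFrom_localEvents
  have hkey : ∀ ε > 0, |Q.real A - Q.real A * Q.real A| ≤ 4 * ε := by
    intro ε hε
    obtain ⟨S, ⟨n, T, hT, rfl⟩, hS⟩ := hdense.approx A hA (measure_ne_top _ _) ε hε
    set J := Icc (-n : ℝ) n with hJdef
    have hJ : MeasurableSet J := measurableSet_Icc
    set S := Config.restrict J ⁻¹' T with hSdef
    have hSm : MeasurableSet S := measurable_restrict hJ hT
    let τ := shift (2 * n + 1)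
    have hτm := Config.measurable_map τ
    have hmp : MeasurePreserving (Config.map τ) Q Q := ⟨hτm, hQ.map_add _⟩
    let S' := Config.map τ ⁻¹' S
    have hS'm : MeasurableSet S' := hτm hSm
    have hpre : τ ⁻¹' J ⊆ Jᶜ := by
      intro x hx hx'
      have h1 : x + ((2 * n + 1 : ℤ) : ℝ) ≤ n := hx.2
      have h2 : (-n : ℝ) ≤ x := hx'.1
      push_cast at h1
      have := Nat.cast_nonneg (α := ℝ) n
      linarith
    have hind : Q.real (S ∩ S') = Q.real S * Q.real S := by
      have h1 := (hQ.indep J hJ).measure_inter_preimage_eq_mul T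
        (Config.map τ ⁻¹' (Config.restrict J ⁻¹' T)) hT (hτm (measurable_restrict hJ hT))
      have h2 : Config.restrict Jᶜ ⁻¹' (Config.map τ ⁻¹' (Config.restrict J ⁻¹' T)) = S' := by
        ext c
        change ((c.restrict Jᶜ).map τ).restrict J ∈ T ↔ (c.map τ).restrict J ∈ T
        rw [restrict_map_restrict_compl hJ hpre]
      rw [h2] at h1
      have h3 : Q S' = Q S := hmp.measure_preimage hSm.nullMeasurableSet
      rw [h3] at h1
      rw [measureReal_def, measureReal_def, ← ENNReal.toReal_mul]
      exact congrArg ENNReal.toReal h1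
    have hd1 : Q.real (symmDiff A S) ≤ ε := by
      rw [measureReal_def]
      exact ENNReal.toReal_le_of_le_ofReal hε.le hS.le
    have hAinv : Config.map τ ⁻¹' A = A := by
      ext c
      exact hinv _ c
    have hd2 : Q.real (symmDiff A S') ≤ ε := by
      have : symmDiff A S' = Config.map τ ⁻¹' symmDiff A S := by
        rw [preimage_symmDiff, hAinv]
      rw [this, measureReal_def, hmp.measure_preimage (hA.symmDiff hSm).nullMeasurableSet]
      exact hd1
    have hd3 : Q.real (symmDiff A (S ∩ S')) ≤ 2 * ε := by
      have hsub : symmDiff A (S ∩ S') ⊆ symmDiff A S ∪ symmDiff A S' := by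
        intro c hc
        simp only [Set.mem_symmDiff, mem_inter_iff, mem_union] at hc ⊢
        tauto
      calc Q.real (symmDiff A (S ∩ S')) ≤ Q.real (symmDiff A S ∪ symmDiff A S') :=
            measureReal_mono hsub
        _ ≤ _ := measureReal_union_le _ _
        _ ≤ 2 * ε := by linarith
    have h1 := abs_measureReal_sub_le_measureReal_symmDiff (μ := Q) hA.nullMeasurableSet
      hSm.nullMeasurableSet
    have h2 := abs_measureReal_sub_le_measureReal_symmDiff (μ := Q) hA.nullMeasurableSet
      (hSm.inter hS'm).nullMeasurableSet
    rw [hind] at h2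
    have hA0 : 0 ≤ Q.real A := measureReal_nonneg
    have hA1 : Q.real A ≤ 1 := measureReal_le_one
    have hS0 : 0 ≤ Q.real S := measureReal_nonneg
    have hS1 : Q.real S ≤ 1 := measureReal_le_one
    have h3 : |Q.real S * Q.real S - Q.real A * Q.real A| ≤ 2 * ε := by
      have e : Q.real S * Q.real S - Q.real A * Q.real A =
          -((Q.real A - Q.real S) * (Q.real S + Q.real A)) := by ring
      rw [e, abs_neg, abs_mul, abs_of_nonneg (add_nonneg hS0 hA0)]
      calc _ ≤ ε * 2 := mul_le_mul (h1.trans hd1) (by linarith) (by linarith) hε.le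
        _ = 2 * ε := by ring
    calc |Q.real A - Q.real A * Q.real A| ≤ |Q.real A - Q.real S * Q.real S| +
          |Q.real S * Q.real S - Q.real A * Q.real A| := abs_sub_le _ _ _
      _ ≤ 4 * ε := by linarith
  have h0 : Q.real A - Q.real A * Q.real A = 0 := by
    by_contra hne
    have hpos := abs_pos.2 hne
    have := hkey (|Q.real A - Q.real A * Q.real A| / 8) (by positivity)
    linarith
  have h1 : Q.real A * (1 - Q.real A) = 0 := by linarith
  rcases mul_eq_zero.1 h1 with h | h
  · left
    exact (measureReal_eq_zero_iff).1 h
  · right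
    have : Q.real A = 1 := by linarith
    rw [← ENNReal.ofReal_toReal (measure_ne_top Q A), ← measureReal_def, this, ENNReal.ofReal_one]

/-! ### Components and desires in terms of the configuration -/

section Translation

variable {c : Config} (hg : Good c) {E : Set (Sym2 ℝ)} (hE : ∀ x y, s(x, y) ∈ E ↔ link c x y)
include hE

lemma graph_adj {a b : pts c.pt} : (graph c.pt E).Adj a b ↔ link c a b := by
  simp only [graph, SimpleGraph.comap_adj, Function.Embedding.subtype_apply,
    SimpleGraph.fromEdgeSet_adj, hE]
  exact ⟨fun h => h.1, fun h => ⟨h, (link_mem h).2.2⟩⟩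

lemma graph_reachable {a b : pts c.pt} : (graph c.pt E).Reachable a b ↔ Conn c a b := by
  rw [SimpleGraph.reachable_iff_reflTransGen]
  constructor
  · intro h
    induction h with
    | refl => exact Relation.ReflTransGen.refl
    | tail _ h2 ih => exact ih.tail ((graph_adj hE).1 h2)
  · intro h
    have key : ∀ y, Conn c a y → ∃ hy : y ∈ pts c.pt,
        Relation.ReflTransGen (graph c.pt E).Adj a ⟨y, hy⟩ := by
      intro y hy
      induction hy with
      | refl => exact ⟨a.2, Relation.ReflTransGen.refl⟩
      | @tail u v _ h2 ih =>
        obtain ⟨hu, h3⟩ := ih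
        have hv : v ∈ pts c.pt := c.points_eq ▸ (link_mem h2).2.1
        exact ⟨hv, h3.tail ((graph_adj hE).2 h2)⟩
    exact (key b h).2

include hg

lemma hasInfiniteComponent_iff : HasInfiniteComponent c.pt E ↔ ∃ x ∈ c.points, InfAt c x := by
  have key : ∀ a : pts c.pt, ((graph c.pt E).connectedComponentMk a).supp.Infinite ↔
      InfAt c a := by
    intro a
    have ha : (a : ℝ) ∈ c.points := by rw [points_eq]; exact a.2
    rw [infAt_iff hg.simple ha, ← Set.infinite_image_iff (f := Subtype.val)
      Subtype.val_injective.injOn]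
    have : Subtype.val '' ((graph c.pt E).connectedComponentMk a).supp = {y | Conn c a y} := by
      ext y
      simp only [mem_image, SimpleGraph.ConnectedComponent.mem_supp_iff,
        SimpleGraph.ConnectedComponent.eq, graph_reachable hE, mem_ofPred_eq]
      constructor
      · rintro ⟨b, hb, rfl⟩
        exact conn_symm hb
      · intro h
        exact ⟨⟨y, c.points_eq ▸ conn_mem ha h⟩, conn_symm h, rfl⟩
    rw [this]
  constructor
  · rintro ⟨C, hC⟩
    obtain ⟨a, rfl⟩ := C.exists_rep
    exact ⟨a, by rw [points_eq]; exact a.2, (key a).1 hC⟩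
  · rintro ⟨x, hx, hinf⟩
    exact ⟨_, (key ⟨x, c.points_eq ▸ hx⟩).2 hinf⟩

lemma numDesire_eq : numDesire c.pt E = {x | ∃ z, link c x z ∧ |x| < dist x z}.encard := by
  rw [numDesire]
  congr 1
  ext x
  simp only [mem_ofPred_eq, Desires, longestEdge, zero_sub, abs_neg, hE, ← points_eq]
  have hset : {r : ℝ | ∃ z, link c x z ∧ r = dist x z} =
      (fun z => dist x z) '' {z | link c x z} := by
    ext r
    simp only [mem_ofPred_eq, mem_image]
    exact exists_congr fun z => and_congr_right fun _ => eq_comm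
  constructor
  · rintro ⟨hx, hlt⟩
    have hne : {r : ℝ | ∃ z, link c x z ∧ r = dist x z}.Nonempty := by
      obtain ⟨z, hz⟩ := hg.exists_link hx
      exact ⟨_, z, hz, rfl⟩
    obtain ⟨r, ⟨z, hz, rfl⟩, hr⟩ := exists_lt_of_lt_csSup hne hlt
    exact ⟨z, hz, hr⟩
  · rintro ⟨z, hz, hlt⟩
    refine ⟨(link_mem hz).1, hlt.trans_le (le_csSup ?_ ⟨z, hz, rfl⟩)⟩
    rw [hset]
    exact ((hg.finite_link x).image _).bddAbove

end Translation

end StablePoisson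

end

theorem theorem1p3 {Ω : Type*} [MeasurableSpace Ω] (P : Measure Ω) [IsProbabilityMeasure P]
    (μ : Measure ℕ) [IsProbabilityMeasure μ] (hμ : μ {0} = 0)
    (η ξ : Ω → Measure ℝ) (E : Ω → Set (Sym2 ℝ))
    (hη : StablePoisson.IsPoissonProcess P η)
    (hξ : StablePoisson.IsIIDMarking P μ η ξ)
    (hE : ∀ᵐ ω ∂P, StablePoisson.IsStableMultiMatching (η ω) (ξ ω) (E ω)) :
    ((∀ᵐ ω ∂P, ¬ StablePoisson.HasInfiniteComponent (η ω) (E ω)) →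
      ∀ᵐ ω ∂P, StablePoisson.numDesire (η ω) (E ω) = ⊤) ∧
    (μ {1, 2} = 1 →
      (∃ᵐ ω ∂P, StablePoisson.HasInfiniteComponent (η ω) (E ω)) →
      ∀ᵐ ω ∂P, StablePoisson.numDesire (η ω) (E ω) < ⊤) ∧
    (μ {1, 2} = 1 →
      ((∀ᵐ ω ∂P, StablePoisson.HasInfiniteComponent (η ω) (E ω)) ↔
        ∀ᵐ ω ∂P, StablePoisson.numDesire (η ω) (E ω) < ⊤)) := by
  have hcm := StablePoisson.measurable_cfg hη hξ
  have hprob := Measure.isProbabilityMeasure_map (μ := P) hcm.aemeasurable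
  have hQ := StablePoisson.isMatchingLaw_map_cfg hη hξ hE
  have hcomp : ∀ᵐ ω ∂P, StablePoisson.HasInfiniteComponent (η ω) (E ω) ↔
      ∃ x ∈ (StablePoisson.cfg η ξ ω).points, (StablePoisson.cfg η ξ ω).InfAt x := by
    filter_upwards [StablePoisson.cfg_ae_eq hη hξ, StablePoisson.ae_good_cfg hη hξ hE] with ω h1 h2
    rw [← h1.1]
    exact StablePoisson.hasInfiniteComponent_iff h2.1 h2.2
  have hnum : ∀ᵐ ω ∂P, StablePoisson.numDesire (η ω) (E ω) =
      {x | ∃ z, (StablePoisson.cfg η ξ ω).link x z ∧ |x| < dist x z}.encard := by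
    filter_upwards [StablePoisson.cfg_ae_eq hη hξ, StablePoisson.ae_good_cfg hη hξ hE] with ω h1 h2
    rw [← h1.1]
    exact StablePoisson.numDesire_eq h2.1 h2.2
  have hi : (∀ᵐ ω ∂P, ¬ StablePoisson.HasInfiniteComponent (η ω) (E ω)) →
      ∀ᵐ ω ∂P, StablePoisson.numDesire (η ω) (E ω) = ⊤ := by
    intro h
    filter_upwards [h, hcomp, hnum, ae_of_ae_map hcm.aemeasurable hQ.ae_infinite_desire]
      with ω h1 h2 h3 h4
    rw [h2] at h1
    push Not at h1
    rw [h3, Set.encard_eq_top_iff]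
    exact h4 h1
  have hii : μ {1, 2} = 1 → (∀ᵐ ω ∂P, StablePoisson.HasInfiniteComponent (η ω) (E ω)) →
      ∀ᵐ ω ∂P, StablePoisson.numDesire (η ω) (E ω) < ⊤ := by
    intro h12 h
    filter_upwards [h, hcomp, hnum, ae_of_ae_map hcm.aemeasurable
      (hQ.ae_finite_desire (StablePoisson.ae_mk_le_two hη hξ h12))] with ω h1 h2 h3 h4
    rw [h3, Set.encard_lt_top_iff]
    exact h4 (h2.1 h1)
  -- By ergodicity, an infinite component exists with probability zero or one.
  have h01 : (∀ᵐ ω ∂P, ¬ StablePoisson.HasInfiniteComponent (η ω) (E ω)) ∨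
      ∀ᵐ ω ∂P, StablePoisson.HasInfiniteComponent (η ω) (E ω) := by
    have hA : MeasurableSet {c : StablePoisson.Config | ∃ x ∈ c.points, c.InfAt x} :=
      StablePoisson.Config.measurableSet_exists_points measurable_id
        StablePoisson.Config.measurableSet_infAt
    rcases hQ.measure_eq_zero_or_one hA fun m c => by
      simp only [Set.mem_ofPred_eq, StablePoisson.Config.exists_points_map_shift,
        StablePoisson.Config.infAt_map_shift] with h | h
    · left
      filter_upwards [hcomp, ae_of_ae_map hcm.aemeasurable (measure_eq_zero_iff_ae_notMem.1 h)]
        with ω h1 h2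
      exact fun h => h2 (h1.1 h)
    · right
      filter_upwards [hcomp, ae_of_ae_map hcm.aemeasurable
        ((prob_compl_eq_zero_iff hA).2 h : _ ∈ ae _)] with ω h1 h2
      exact h1.2 h2
  refine ⟨hi, fun h12 hfreq => ?_, fun h12 => ⟨hii h12, fun hfin => ?_⟩⟩
  · rcases h01 with h | h
    · exact absurd h hfreq
    · exact hii h12 h
  · rcases h01 with h | h
    · obtain ⟨ω, h1, h2⟩ := ((hi h).and hfin).exists
      exact absurd h1 h2.ne
    · exact h
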